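/- **Notation.** For $a,z\in\mathbb C^n$ put $\langle a,z\rangle=\sum_p a_pz_p$, and $|a|=(\sum_p|a_p|^2)^{1/2}$. For $c\in\mathbb C$ let $l_{a,c}(z)=\langle a,z\rangle+c$, and for $a\ne0$ let $L=L_{a,c}=\{l_{a,c}=0\}$ be the corresponding hyperplane. Its periodic reproduction is $\hat S_L=\bigcup_{k\in\mathbb Z^n}\{z: l_{a,c}(z-k)=0\}$; if this set is analytic, it is identified with the divisor that has multiplicity $1$ on it. The class $\mathcal L_1$ (resp. $\mathcal L_2$) consists of the $l_{a,c}$ for which the orthogonal complement of $\{x\in\mathbb R^n:\langle a,x\rangle=0\}$ in $\mathbb R^n$ has dimension $1$ (resp. $2$). Let $\nu_{pq}(a)$ be the number of points of the form $\langle a,k\rangle$, $k\in\mathbb Z^n$, in $\{\alpha a_p+\beta a_q: 0\le\alpha,\beta<1\}$, with $\nu_{pq}(a)=0$ if $a_p=0$ or $a_q=0$. "Divisor" means positive divisor, "periodic" means invariant under translation by the unit vectors $\omega_1,\dots,\omega_n$, and an entire function has plane zeros if its zero set is a (possibly empty) union of hyperplanes. **Theorem 2.** Let $Z$ be a periodic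 divisor in $\mathbb C^n$. Then $Z$ is the divisor of an entire periodic function with plane zeros if and only if $Z=Z'+Z''$ with the following $Z'$ and $Z''$. * $Z'=\sum_{j=1}^{\mu_1}\hat S_{L'_j}$, $0\le\mu_1\le\infty$, where $L'_j=\{l'_j=0\}$, $l'_j=\langle a'^{(j)},z\rangle+c'_j\in\mathcal L_1$, the equation is written with real coefficients $a'^{(j)}\in\mathbb R^n$, each $\hat S_{L'_j}$ is analytic, and $|\operatorname{Im}c'_j|/|a'^{(j)}|\to\infty$ as $j\to\infty$ if $\mu_1=\infty$. * $Z''=\sum_{j=1}^{\mu_2}\hat S_{L_j}$, $0\le\mu_2<\infty$, where $L_j=\{l_j=0\}$, $l_j=\langle a^{(j)},z\rangle+c_j\in\mathcal L_2$, each $\hat S_{L_j}$ is analytic, and for all $p,q$ $$\sum_{j=1}^{\mu_2}\nu_{pq}(a^{(j)})\,\operatorname{sign}\operatorname{Im}\frac{a^{(j)}_q}{a^{(j)}_p}=0$$ (the terms with $a^{(j)}_p=0$ being zero). Moreover, let $Z=Z'+Z''$ be any such representation. Then one can write $a'^{(j)}=t_jk^{(j)}$ with $t_j\in\mathbb R\setminus\{0\}$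 and $k^{(j)}\in\mathbb Z^n$ with coprime coordinates, and for $j\le\mu_2$ there are $w_1^{(j)},w_2^{(j)}\in\mathbb C\setminus\{0\}$ with $T_j=w_2^{(j)}/w_1^{(j)}\notin\mathbb R$, $\{\langle a^{(j)},k\rangle:k\in\mathbb Z^n\}=\mathbb Zw_1^{(j)}+\mathbb Zw_2^{(j)}$, and integers with $a^{(j)}_p=m^{(j)}_{1p}w^{(j)}_1+m^{(j)}_{2p}w^{(j)}_2$. Fix any such choices. For $s=\pm1$ put $u_s(x)=-2is\sin(\pi x)\,e^{is\pi x}=1-e^{2\pi isx}$. *The function $F_1$.* Let $\gamma_j=c'_j/t_j$, $x_j(z)=\langle k^{(j)},z\rangle+\gamma_j$, and $\varepsilon_j=1$ if $\operatorname{Im}\gamma_j\ge0$, $\varepsilon_j=-1$ otherwise. Call a sequence of integers $d_j\ge0$ admissible if $\sum_{j\le\mu_1} e^{-2\pi(d_j+1)(|\operatorname{Im}\gamma_j|-R|k^{(j)}|)}<\infty$ for every $R\in\mathbb R$. The sequence $d_j=j-1$ is always admissible (and every sequence is if $\mu_1<\infty$). For every admissible sequence the product $$F_1(z)=\prod_{j=1}^{\mu_1}u_{\varepsilon_j}(x_j(z))\exp\Big(\sum_{r=1}^{d_j}\tfrac1r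 e^{2\pi i\varepsilon_jrx_j(z)}\Big)$$ converges locally uniformly in $\mathbb C^n$; if $d\equiv0$ is admissible, this is the sine product $\prod_ju_{\varepsilon_j}(x_j(z))$. *The function $F_2$.* With $s=\operatorname{sign}\operatorname{Im}T$ let $\Phi_T(w)=\prod_{q=0}^\infty u_{-s}(w-qT)\prod_{q=-\infty}^{-1}u_s(w-qT)$, and let $s_j=\operatorname{sign}\operatorname{Im}T_j$, $$\tilde F(z)=\prod_{j=1}^{\mu_2}\Phi_{T_j}\big(l_j(z)/w_1^{(j)}\big),\qquad \sigma^p_q=-2\pi i\sum_js_j\frac{m^{(j)}_{2p}a^{(j)}_q}{w^{(j)}_1},$$ $$\tau_p=\sum_j\Big(-2\pi is_j\Big[\frac{m^{(j)}_{2p}c_j}{w^{(j)}_1}+\frac{m^{(j)}_{2p}(m^{(j)}_{2p}+1)}2T_j\Big]+\pi i\,m^{(j)}_{2p}\Big),$$ $$H(z)=\tfrac12\sum_p\sigma^p_pz_p^2+\sum_{p<q}\sigma^p_qz_pz_q+\sum_p\big(\tau_p-\tfrac12\sigma^p_p\big)z_p,\qquad F_2=\tilde Fe^{-H}.$$ Then,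 for every admissible $d$, a function $F$ is an entire periodic function with plane zeros and with divisor $Z$ if and only if $$F(z)=e^{\Psi(z)+2\pi i\langle m,z\rangle}F_1(z)F_2(z)$$ for some $m\in\mathbb Z^n$ and some entire periodic function $\Psi$. -/

import Mathlib

open Filter Topology

noncomputable section

namespace PlaneZeros

/-- The space `ℂⁿ` with its Euclidean norm. -/
abbrev Cn (n : ℕ) : Type := EuclideanSpace ℂ (Fin n)

/-- The bilinear pairing `⟨a, z⟩ = ∑ₚ aₚ zₚ` (no conjugation). -/
def pair {n : ℕ} (a z : Cn n) : ℂ := ∑ p, a p * z p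

/-- The affine function `l_{a,c}(z) = ⟨a, z⟩ + c`. -/
def lin {n : ℕ} (a : Cn n) (c : ℂ) (z : Cn n) : ℂ := pair a z + c

/-- The unit vectors `ω_p`. -/
def unitVec {n : ℕ} (p : Fin n) : Cn n := EuclideanSpace.single p 1

/-- A vector with integer coordinates, as a vector of `ℂⁿ`. -/
def intVec {n : ℕ} (k : Fin n → ℤ) : Cn n := WithLp.toLp 2 (fun p => (k p : ℂ))

/-- Periodicity with respect to the unit vectors. -/
def IsPeriodic {n : ℕ} {α : Type} (f : Cn n → α) : Prop :=
  ∀ (p : Fin n) (z : Cn n), f (z + unitVec p) = f z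

/-! ### Divisors -/

/-- The multiplicity of the zero of `f` at `z`: the least degree `m` of a nonzero homogeneous
polynomial in the Taylor expansion `f (z + v) = ∑ₘ Pₘ(v)`, where
`Pₘ(v) = (1 / m!) (d/dt)ᵐ f (z + t v)` at `t = 0`. It is `⊤` if `f` vanishes identically
near `z`. -/
def zeroMult {n : ℕ} (f : Cn n → ℂ) (z : Cn n) : ℕ∞ :=
  ⨅ (m : ℕ) (_ : ∃ v : Cn n, iteratedDeriv m (fun t : ℂ => f (z + t • v)) 0 ≠ 0), (m : ℕ∞)

/-- A (positive) divisor in `ℂⁿ`, given by its multiplicity function: locally it is the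
multiplicity function of the zeros of a holomorphic function. As the values are finite,
the local equations are not identically zero. -/
def IsDivisor {n : ℕ} (Z : Cn n → ℕ) : Prop :=
  ∀ z : Cn n, ∃ U : Set (Cn n), IsOpen U ∧ z ∈ U ∧
    ∃ f : Cn n → ℂ, DifferentiableOn ℂ f U ∧ ∀ w ∈ U, zeroMult f w = (Z w : ℕ∞)

/-- `Z` is the divisor of the function `F`. -/
def HasDivisor {n : ℕ} (F : Cn n → ℂ) (Z : Cn n → ℕ) : Prop :=
  ∀ z, zeroMult F z = (Z z : ℕ∞)

/-- A (closed) analytic subset of `ℂⁿ`. -/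
def IsAnalyticSubset {n : ℕ} (S : Set (Cn n)) : Prop :=
  ∀ z : Cn n, ∃ U : Set (Cn n), IsOpen U ∧ z ∈ U ∧
    ∃ (r : ℕ) (f : Fin r → Cn n → ℂ), (∀ i, DifferentiableOn ℂ (f i) U) ∧
      S ∩ U = {w | w ∈ U ∧ ∀ i, f i w = 0}

/-! ### Hyperplanes and their periodic reproductions -/

/-- The hyperplane `L_{a,c}` (for `a ≠ 0`). -/
def hyperplane {n : ℕ} (a : Cn n) (c : ℂ) : Set (Cn n) := {z | lin a c z = 0}

/-- The zero set of `F` is a union of hyperplanes. -/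
def HasPlaneZeros {n : ℕ} (F : Cn n → ℂ) : Prop :=
  ∃ A : Set (Cn n × ℂ), (∀ l ∈ A, l.1 ≠ 0) ∧ {z | F z = 0} = ⋃ l ∈ A, hyperplane l.1 l.2

/-- An entire periodic function with plane zeros. -/
structure IsEntirePeriodicPlane {n : ℕ} (F : Cn n → ℂ) : Prop where
  entire : Differentiable ℂ F
  periodic : IsPeriodic F
  plane : HasPlaneZeros F

/-- The periodic reproduction `Ŝ_L` of the hyperplane `L_{a,c}`, as a set. -/
def repro {n : ℕ} (a : Cn n) (c : ℂ) : Set (Cn n) :=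
  ⋃ k : Fin n → ℤ, {z | lin a c (z - intVec k) = 0}

/-- `Ŝ_L` with multiplicity one. Its components are parallel, hence two of them coincide or are
disjoint, and the multiplicity function is the indicator function of `Ŝ_L`. -/
def reproMult {n : ℕ} (a : Cn n) (c : ℂ) : Cn n → ℕ := (repro a c).indicator 1

/-- The real subspace `A_l = {x ∈ ℝⁿ : ⟨a, x⟩ = 0}`. -/
def realKer {n : ℕ} (a : Cn n) : Submodule ℝ (EuclideanSpace ℝ (Fin n)) where
  carrier := {x | ∑ p, a p * (x p : ℂ) = 0}
  zero_mem' := by simp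
  add_mem' := by
    intro x y hx hy
    simp only [Set.mem_ofPred_eq] at hx hy ⊢
    simp [mul_add, Finset.sum_add_distrib, hx, hy]
  smul_mem' := by
    intro t x hx
    simp only [Set.mem_ofPred_eq] at hx ⊢
    have h : ∑ p, a p * ((t • x) p : ℂ) = (t : ℂ) * ∑ p, a p * (x p : ℂ) := by
      rw [Finset.mul_sum]
      refine Finset.sum_congr rfl fun p _ => ?_
      simp only [PiLp.smul_apply, smul_eq_mul, Complex.ofReal_mul]
      ring
    rw [h, hx, mul_zero]

/-- The dimension `m` of the orthogonal complement of `A_l` in `ℝⁿ`; the classes `𝓛₁` and `𝓛₂`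
are given by `m = 1` and `m = 2`. -/
def perpDim {n : ℕ} (a : Cn n) : ℕ := Module.finrank ℝ (realKer a)ᗮ

/-- The additive group `{⟨a, k⟩ : k ∈ ℤⁿ}`. -/
def periodSet {n : ℕ} (a : Cn n) : Set ℂ := {w | ∃ k : Fin n → ℤ, w = pair a (intVec k)}

/-- The half-open parallelogram `P_{pq}`. -/
def parallelogram {n : ℕ} (a : Cn n) (p q : Fin n) : Set ℂ :=
  {w | ∃ α β : ℝ, 0 ≤ α ∧ α < 1 ∧ 0 ≤ β ∧ β < 1 ∧ w = α * a p + β * a q}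

open Classical in
/-- The number `ν_{pq}` of points `⟨a, k⟩`, `k ∈ ℤⁿ`, in `P_{pq}`; zero if `a_p` or `a_q` is. -/
def nu {n : ℕ} (a : Cn n) (p q : Fin n) : ℕ :=
  if a p = 0 ∨ a q = 0 then 0 else (periodSet a ∩ parallelogram a p q).ncard

/-! ### Decompositions `Z = Z' + Z''` -/

/-- The index set of `μ` terms, `μ ≤ ∞` (counted from zero). -/
abbrev Idx (μ : ℕ∞) : Type := {j : ℕ // (j : ℕ∞) < μ}

/-- The data of two families of affine functions: `μ₁ ≤ ∞` of them for `Z'` (only the terms with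
`j < μ₁` of the sequences matter) and `μ₂ < ∞` of them for `Z''`. -/
structure Families (n : ℕ) where
  μ₁ : ℕ∞
  a₁ : ℕ → Cn n
  c₁ : ℕ → ℂ
  μ₂ : ℕ
  a₂ : Fin μ₂ → Cn n
  c₂ : Fin μ₂ → ℂ

/-- The families represent `Z` as `Z' + Z''`. A hyperplane of class `𝓛₁` has an equation with
real coefficients `a`, and the growth condition refers to equations of this form. -/
structure Families.Represents {n : ℕ} (D : Families n) (Z : Cn n → ℕ) : Prop where
  class_one : ∀ j : ℕ, (j : ℕ∞) < D.μ₁ → perpDim (D.a₁ j) = 1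
  analytic_one : ∀ j : ℕ, (j : ℕ∞) < D.μ₁ → IsAnalyticSubset (repro (D.a₁ j) (D.c₁ j))
  real_one : ∀ j : ℕ, (j : ℕ∞) < D.μ₁ → ∀ p, (D.a₁ j p).im = 0
  growth : D.μ₁ = ⊤ → Tendsto (fun j : ℕ => |(D.c₁ j).im| / ‖D.a₁ j‖) atTop atTop
  class_two : ∀ j, perpDim (D.a₂ j) = 2
  analytic_two : ∀ j, IsAnalyticSubset (repro (D.a₂ j) (D.c₂ j))
  balance : ∀ p q : Fin n,
    ∑ j, (nu (D.a₂ j) p q : ℝ) * Real.sign (D.a₂ j q / D.a₂ j p).im = 0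
  /-- The sum of the first family is taken in the discrete space `ℕ`, so that only finitely many
  terms are nonzero at each point. -/
  sum_eq : ∃ Z' Z'' : Cn n → ℕ, Z = Z' + Z'' ∧
    (∀ z, HasSum (fun j : Idx D.μ₁ => reproMult (D.a₁ j) (D.c₁ j) z) (Z' z)) ∧
    Z'' = ∑ j, reproMult (D.a₂ j) (D.c₂ j)

/-! ### The explicit form of the function -/

/-- For `s = ±1`, the factor `-2 i s sin(π x) e^{i s π x} = 1 - e^{2 π i s x}`. -/
def sineFactor (s : ℝ) (x : ℂ) : ℂ :=
  -2 * Complex.I * s * Complex.sin (Real.pi * x) * Complex.exp (Complex.I * s * Real.pi * x)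

/-- The theta-type product `Φ_T`, with simple zeros at the points of `ℤ + ℤ T`: the product over
`q ≥ 0` of the factors at `w - q T`, and the product over `q ≤ -1`. -/
def thetaProd (T w : ℂ) : ℂ :=
  (∏' q : ℕ, sineFactor (-Real.sign T.im) (w - q * T)) *
    ∏' q : ℕ, sineFactor (Real.sign T.im) (w + (q + 1) * T)

open Classical in
/-- The sign of a real number, with the value `1` at `0`. -/
def sgn (x : ℝ) : ℝ := if 0 ≤ x then 1 else -1

/-- Choices for the explicit formulas: for the first family, a primitive integer vector `k j`
proportional to `a₁ j`; for the second one, a basis `w₁, w₂` of the group `{⟨a, k⟩}` and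
the coordinates of the numbers `a_p` in it. -/
structure Families.Normalization {n : ℕ} (D : Families n) where
  k : Idx D.μ₁ → Fin n → ℤ
  t : Idx D.μ₁ → ℝ
  primitive : ∀ j, Finset.univ.gcd (k j) = 1
  t_ne : ∀ j, t j ≠ 0
  a₁_eq : ∀ (j : Idx D.μ₁) (p : Fin n), D.a₁ j p = t j * k j p
  w₁ : Fin D.μ₂ → ℂ
  w₂ : Fin D.μ₂ → ℂ
  w₁_ne : ∀ j, w₁ j ≠ 0
  ratio_im_ne : ∀ j, (w₂ j / w₁ j).im ≠ 0
  periodSet_eq : ∀ j, periodSet (D.a₂ j) = {w | ∃ r s : ℤ, w = r * w₁ j + s * w₂ j}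
  m₁ : Fin D.μ₂ → Fin n → ℤ
  m₂ : Fin D.μ₂ → Fin n → ℤ
  a₂_eq : ∀ j p, D.a₂ j p = m₁ j p * w₁ j + m₂ j p * w₂ j

namespace Families.Normalization

variable {n : ℕ} {D : Families n} (N : D.Normalization)

/-- The constant term of the normalized equation `⟨k, z⟩ + c = 0`. -/
def c (j : Idx D.μ₁) : ℂ := D.c₁ j / N.t j

/-- The factor `φ_j = E_d(u)`, with `u = e^{2 π i s (⟨k, z⟩ + c)}`, `s` the sign of `Im c`, and
`E_d(u) = (1 - u) exp (u + u²/2 + ⋯ + u^d/d)`. For `d = 0` it is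
`-2 i s sin(π (⟨k, z⟩ + c)) e^{i s π (⟨k, z⟩ + c)}`. -/
def phi (d : ℕ) (j : Idx D.μ₁) (z : Cn n) : ℂ :=
  sineFactor (sgn (N.c j).im) (lin (intVec (N.k j)) (N.c j) z) *
    Complex.exp (∑ r ∈ Finset.Icc 1 d,
      Complex.exp (2 * Real.pi * Complex.I * sgn (N.c j).im *
        lin (intVec (N.k j)) (N.c j) z) ^ r / r)

/-- The degrees `d_j` of the convergence factors are admissible: the series
`∑ⱼ exp (-2 π (d_j + 1) (|Im c_j| - R |k_j|))` converges for all `R`. -/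
def Admissible (d : ℕ → ℕ) : Prop :=
  ∀ R : ℝ, Summable (fun j : Idx D.μ₁ =>
    Real.exp (-2 * Real.pi * (d j + 1) * (|(N.c j).im| - R * ‖intVec (N.k j)‖)))

/-- The function `F₁ = ∏ⱼ φ_j` with divisor `Z'`. -/
def F₁ (d : ℕ → ℕ) (z : Cn n) : ℂ := ∏' j : Idx D.μ₁, N.phi (d j) j z

/-- The modulus `T = w₂ / w₁`. -/
def T (j : Fin D.μ₂) : ℂ := N.w₂ j / N.w₁ j

/-- The product of the functions `Φ_T (l(z) / w₁)`; its divisor is `Z''`. -/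
def Ftilde (z : Cn n) : ℂ := ∏ j, thetaProd (N.T j) (lin (D.a₂ j) (D.c₂ j) z / N.w₁ j)

/-- `Ftilde (z + ω_p) = e^{G_p(z)} Ftilde z` with `G_p(z) = ∑_q σ p q z_q + τ p`. -/
def σ (p q : Fin n) : ℂ :=
  ∑ j, -2 * Real.pi * Complex.I * Real.sign (N.T j).im * N.m₂ j p * D.a₂ j q / N.w₁ j

/-- The constant term of `G_p`. -/
def τ (p : Fin n) : ℂ :=
  ∑ j, (-2 * Real.pi * Complex.I * Real.sign (N.T j).im *
      (N.m₂ j p * D.c₂ j / N.w₁ j + N.m₂ j p * (N.m₂ j p + 1) / 2 * N.T j) +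
    Real.pi * Complex.I * N.m₂ j p)

/-- The quadratic polynomial `H` with `H (z + ω_p) - H z = G_p(z)`. -/
def H (z : Cn n) : ℂ :=
  1 / 2 * ∑ p, N.σ p p * z p ^ 2 +
    ∑ p, ∑ q ∈ Finset.univ.filter (fun q => p < q), N.σ p q * z p * z q +
    ∑ p, (N.τ p - 1 / 2 * N.σ p p) * z p

/-- The periodic function `F₂` with divisor `Z''`. -/
def F₂ (z : Cn n) : ℂ := N.Ftilde z * Complex.exp (-N.H z)

end Families.Normalization

end PlaneZeros

end

noncomputable section

namespace PlaneZeros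

/-! ### Entire functions on complex normed spaces -/

section Entire

variable {E : Type*} [NormedAddCommGroup E] [NormedSpace ℂ E] {f g : E → ℂ}

/-! On a ball, a nonzero entire function with plane zeros is a finite product of affine functions
times an entire cofactor without zeros there (`exists_eq_linProd_mul_ne_zero`). The maximum
principle bounds the number of affine factors (`exists_card_le`). Once this number is maximal, the
cofactor vanishes on no whole plane meeting the ball, and a local argument
(`exists_plane_subset_zeros`) then excludes every zero. Two consequences follow. Functions with
equal divisors, one of them with plane zeros, differ by a factor `e^h`
(`exists_eq_exp_mul_of_zeroMult_eq`). The divisor of a periodic such function is a locally finite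
sum of periodic reproductions, one class of planes modulo `ℤⁿ` at a time (`exists_family`).

The numbers `⟨a, k⟩` are isolated, being zeros of `F` on a line transversal to the plane. The real
span of the `a_p` is a real line or all of `ℂ`. In the second case the plane contains a real point,
so a translate of it meets a fixed ball, and local finiteness leaves only finitely many such terms.
In the first case a bound on `|Im c| / |a|` also puts a translate into a fixed ball, and the growth
condition follows.

For the first family a Weierstrass product converges because `|E_d(u) - 1| ≤ |u|^(d+1)` on the unit
disc. For the second family the theta products give `Ftilde`, which a shift by `ω_p` multiplies by
`e^{G_p}` with `G_p` affine. If `F = e^h F₁ Ftilde` is periodic, then `h(z + ω_p) - h(z) = -G_p(z) +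
2πi m_p`; computing `h(z + ω_p + ω_q)` in two ways forces the matrix `σ` to be symmetric
(`σ_symm_of_exponent`). Conversely, symmetry of `σ` makes `H` a primitive of the `G_p`, so that `F₂`
is periodic. Symmetry is the balance condition (`balance_iff`): `σ p q - σ q p` is a sum of lattice
determinants, and a determinant is the signed number of lattice points of a half-open parallelogram
(`nu_mul_sign`). Finally `h + H - 2πi⟨m, z⟩` is periodic, which is the general form of `F`. -/

theorem differentiable_comp_line (hf : Differentiable ℂ f) (z v : E) :
    Differentiable ℂ (fun t : ℂ => f (z + t • v)) := by fun_prop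

theorem hasDerivAt_comp_line (hf : Differentiable ℂ f) (z v : E) (t : ℂ) :
    HasDerivAt (fun t : ℂ => f (z + t • v)) (fderiv ℂ f (z + t • v) v) t := by
  have h : HasDerivAt (fun t : ℂ => z + t • v) v t := by
    simpa using ((hasDerivAt_id t).smul_const v).const_add z
  exact (hf _).hasFDerivAt.comp_hasDerivAt t h

/-- Cauchy's estimate on the complex line in direction `v`, over the disc of radius `r / ‖v‖`. -/
theorem norm_fderiv_le_of_forall_closedBall (hf : Differentiable ℂ f) {z : E} {r M : ℝ}
    (hr : 0 < r) (hM : ∀ w ∈ Metric.closedBall z r, ‖f w‖ ≤ M) : ‖fderiv ℂ f z‖ ≤ M / r := by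
  have hM0 : 0 ≤ M := (norm_nonneg _).trans (hM z (Metric.mem_closedBall_self hr.le))
  refine ContinuousLinearMap.opNorm_le_bound _ (by positivity) fun v => ?_
  rcases eq_or_ne v 0 with rfl | hv
  · simp
  have hv' : 0 < ‖v‖ := norm_pos_iff.2 hv
  have h := hasDerivAt_comp_line hf z v 0
  rw [zero_smul, add_zero] at h
  rw [← h.deriv]
  have := Complex.norm_deriv_le_of_forall_mem_sphere_norm_le (c := 0) (R := r / ‖v‖) (C := M)
    (by positivity) (differentiable_comp_line hf z v).diffContOnCl fun t ht => hM _ ?_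
  · rwa [div_div_eq_mul_div, mul_div_right_comm] at this
  · rw [mem_sphere_zero_iff_norm] at ht
    simp [norm_smul, ht, hv'.ne']

/-- Weierstrass' theorem. Cauchy's estimate applied to differences makes the derivatives uniformly
Cauchy on a smaller ball, and the limit can then be differentiated termwise. -/
theorem differentiable_of_tendstoLocallyUniformly [ProperSpace E] {ι : Type*} {l : Filter ι}
    [NeBot l] {φ : ι → E → ℂ} (hφ : ∀ i, Differentiable ℂ (φ i))
    (h : TendstoLocallyUniformly φ g l) : Differentiable ℂ g := by
  intro x
  have hK : TendstoUniformlyOn φ g l (Metric.closedBall x 2) :=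
    (tendstoLocallyUniformlyOn_iff_tendstoUniformlyOn_of_compact (isCompact_closedBall x 2)).1
      h.tendstoLocallyUniformlyOn
  have hC : UniformCauchySeqOn (fun i => fderiv ℂ (φ i)) l (Metric.ball x 1) := by
    have h1 := hK.uniformCauchySeqOn
    intro u hu
    obtain ⟨ε, hε, hεu⟩ := Metric.mem_uniformity_dist.1 hu
    filter_upwards [h1 _ (Metric.dist_mem_uniformity (half_pos hε))] with m hm y hy
    refine hεu ?_
    have hd : Differentiable ℂ (fun w => φ m.1 w - φ m.2 w) := (hφ _).sub (hφ _)
    have hle := norm_fderiv_le_of_forall_closedBall (M := ε / 2) hd (z := y) one_pos fun w hw => by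
      have : w ∈ Metric.closedBall x 2 := by
        rw [Metric.mem_closedBall] at hw ⊢
        rw [Metric.mem_ball] at hy
        linarith [dist_triangle w y x]
      simpa [dist_eq_norm] using (hm w this).le
    rw [fderiv_fun_sub (hφ _ _) (hφ _ _), div_one] at hle
    rw [dist_eq_norm]
    linarith
  have hlim : ∀ y ∈ Metric.ball x 1, ∃ L, Tendsto (fun i => fderiv ℂ (φ i) y) l (𝓝 L) :=
    fun y hy => cauchy_map_iff_exists_tendsto.1 (hC.cauchy_map hy)
  choose! g' hg' using hlim
  exact (hasFDerivAt_of_tendstoUniformlyOn Metric.isOpen_ball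
    (hC.tendstoUniformlyOn_of_tendsto hg') (fun i y _ => (hφ i y).hasFDerivAt)
    (fun y hy => (hK.tendsto_at (Metric.ball_subset_closedBall
      (Metric.ball_subset_ball one_le_two hy)))) (Metric.mem_ball_self one_pos)).differentiableAt

/-- Cauchy's estimate gives `|φ'| ≤ M` on the unit disc and `|φ''| ≤ 2M` on the disc of radius
`1/2`; the mean value inequality is then used twice. -/
theorem norm_taylor_one_le {φ : ℂ → ℂ} (hφ : Differentiable ℂ φ) {M : ℝ}
    (hM : ∀ t : ℂ, ‖t‖ ≤ 2 → ‖φ t‖ ≤ M) {t : ℂ} (ht : ‖t‖ ≤ 1 / 2) :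
    ‖φ t - φ 0 - t * deriv φ 0‖ ≤ 2 * M * ‖t‖ * ‖t‖ := by
  have hd : Differentiable ℂ (deriv φ) := fun s => (hφ.analyticAt s).deriv.differentiableAt
  have hM0 : 0 ≤ M := (norm_nonneg _).trans (hM 0 (by simp))
  have h1 : ∀ s : ℂ, ‖s‖ ≤ 1 → ‖deriv φ s‖ ≤ M := fun s hs => by
    simpa using Complex.norm_deriv_le_of_forall_mem_sphere_norm_le (c := s) (R := 1) (C := M)
      one_pos hφ.diffContOnCl fun w hw => hM w (by
        rw [mem_sphere_iff_norm] at hw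
        linarith [norm_le_norm_sub_add w s])
  have h2 : ∀ s : ℂ, ‖s‖ ≤ 1 / 2 → ‖deriv (deriv φ) s‖ ≤ 2 * M := fun s hs => by
    have := Complex.norm_deriv_le_of_forall_mem_sphere_norm_le (c := s) (R := 1 / 2) (C := M)
      (by norm_num) hd.diffContOnCl fun w hw => h1 w (by
        rw [mem_sphere_iff_norm] at hw
        linarith [norm_le_norm_sub_add w s])
    linarith
  have hc : ∀ r : ℝ, Convex ℝ (Metric.closedBall (0 : ℂ) r) := fun r => convex_closedBall _ _
  have h3 : ∀ s : ℂ, ‖s‖ ≤ ‖t‖ → ‖deriv φ s - deriv φ 0‖ ≤ 2 * M * ‖t‖ := fun s hs => by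
    have := (hc (1 / 2)).norm_image_sub_le_of_norm_deriv_le (f := deriv φ) (C := 2 * M)
      (fun w _ => hd w) (fun w hw => h2 w (by simpa using hw)) (x := 0) (y := s)
      (by simp) (by simpa using hs.trans ht)
    rw [sub_zero] at this
    exact this.trans (mul_le_mul_of_nonneg_left hs (by positivity))
  have hψ : ∀ s, HasDerivAt (fun s => φ s - s * deriv φ 0) (deriv φ s - deriv φ 0) s := fun s => by
    simpa using (hφ s).hasDerivAt.fun_sub ((hasDerivAt_id s).mul_const (deriv φ 0))
  have := (hc ‖t‖).norm_image_sub_le_of_norm_deriv_le (f := fun s => φ s - s * deriv φ 0)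
      (C := 2 * M * ‖t‖) (fun w _ => (hψ w).differentiableAt)
      (fun w hw => by rw [(hψ w).deriv]; exact h3 w (by simpa using hw)) (x := 0) (y := t)
      (by simp) (by simp)
  simpa [sub_right_comm] using this

/-- The difference quotients with step `1 / (m + 1)` are entire, and the Taylor bound makes them
converge locally uniformly to the directional derivative. -/
theorem differentiable_fderiv_apply [ProperSpace E] (hf : Differentiable ℂ f) (v : E) :
    Differentiable ℂ (fun z => fderiv ℂ f z v) := by
  have key : TendstoLocallyUniformly
      (fun (m : ℕ) (z : E) => ((m : ℂ) + 1) * (f (z + ((m : ℂ) + 1)⁻¹ • v) - f z))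
      (fun z => fderiv ℂ f z v) atTop := by
    rw [Metric.tendstoLocallyUniformly_iff]
    intro ε hε x
    obtain ⟨M, hM⟩ := (isCompact_closedBall x (1 + 2 * ‖v‖)).exists_bound_of_continuousOn
      hf.continuous.continuousOn
    have hlim : Tendsto (fun m : ℕ => 2 * M * ((m : ℝ) + 1)⁻¹) atTop (𝓝 0) := by
      simpa using (tendsto_one_div_add_atTop_nhds_zero_nat (𝕜 := ℝ)).const_mul (2 * M)
    refine ⟨Metric.closedBall x 1, Metric.closedBall_mem_nhds x one_pos, ?_⟩
    filter_upwards [hlim.eventually (gt_mem_nhds hε), eventually_ge_atTop 1] with m hm hm1 y hy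
    have hb : ∀ t : ℂ, ‖t‖ ≤ 2 → ‖f (y + t • v)‖ ≤ M := fun t ht => hM _ (by
      rw [Metric.mem_closedBall, dist_eq_norm] at hy ⊢
      calc ‖y + t • v - x‖ = ‖(y - x) + t • v‖ := by congr 1; abel
        _ ≤ ‖y - x‖ + ‖t • v‖ := norm_add_le _ _
        _ ≤ 1 + 2 * ‖v‖ := by
          rw [norm_smul]; gcongr)
    have hm0 : (0 : ℝ) < (m : ℝ) + 1 := by positivity
    have hmc : ((m : ℂ) + 1) ≠ 0 := by exact_mod_cast hm0.ne'
    have hn : ‖((m : ℂ) + 1)⁻¹‖ = ((m : ℝ) + 1)⁻¹ := by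
      rw [norm_inv]; congr 1
      rw [← Nat.cast_one, ← Nat.cast_add, Complex.norm_natCast]; push_cast; rfl
    have h := norm_taylor_one_le (differentiable_comp_line hf y v) hb
      (t := ((m : ℂ) + 1)⁻¹) (by
        rw [hn, one_div]
        gcongr
        have : (1 : ℝ) ≤ m := by exact_mod_cast hm1
        linarith)
    have hd := (hasDerivAt_comp_line hf y v 0).deriv
    simp only [zero_smul, add_zero] at hd h
    rw [hd, hn] at h
    rw [dist_comm, dist_eq_norm]
    calc ‖((m : ℂ) + 1) * (f (y + ((m : ℂ) + 1)⁻¹ • v) - f y) - fderiv ℂ f y v‖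
        = ‖((m : ℂ) + 1) * (f (y + ((m : ℂ) + 1)⁻¹ • v) - f y
            - ((m : ℂ) + 1)⁻¹ * fderiv ℂ f y v)‖ := by
          congr 1; field_simp
      _ = ((m : ℝ) + 1) * ‖f (y + ((m : ℂ) + 1)⁻¹ • v) - f y
            - ((m : ℂ) + 1)⁻¹ * fderiv ℂ f y v‖ := by
          rw [norm_mul]; congr 1
          rw [← Nat.cast_one, ← Nat.cast_add, Complex.norm_natCast]; push_cast; rfl
      _ ≤ ((m : ℝ) + 1) * (2 * M * ((m : ℝ) + 1)⁻¹ * ((m : ℝ) + 1)⁻¹) := by gcongr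
      _ = 2 * M * ((m : ℝ) + 1)⁻¹ := by field_simp
      _ < ε := hm
  exact differentiable_of_tendstoLocallyUniformly (fun m => by fun_prop) key

theorem contDiff_of_differentiable [FiniteDimensional ℂ E] (hf : Differentiable ℂ f) (m : ℕ) :
    ContDiff ℂ m f := by
  have : ProperSpace E := FiniteDimensional.proper ℂ E
  induction m generalizing f with
  | zero => exact contDiff_zero.2 hf.continuous
  | succ m ih =>
    rw [Nat.cast_succ, contDiff_succ_iff_fderiv_apply]
    refine ⟨hf, ?_, fun v => ih (differentiable_fderiv_apply hf v)⟩
    -- This clause concerns only the analytic order `ω`, and `m` is finite.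
    intro h
    exact absurd h (by simp)

/-- Up to `m!` this is the homogeneous Taylor polynomial of degree `m` at `z`. With `t` treated as
one more variable, each derivative in `t` is a directional derivative on `ℂ × E`, which preserves
entire functions. -/
theorem iteratedDeriv_line_differentiable [FiniteDimensional ℂ E] (hf : Differentiable ℂ f)
    (m : ℕ) (z : E) : Differentiable ℂ (fun v => iteratedDeriv m (fun t : ℂ => f (z + t • v)) 0) := by
  have : ProperSpace E := FiniteDimensional.proper ℂ E
  have key : ∀ (m : ℕ) (h : ℂ × E → ℂ), Differentiable ℂ h →
      Differentiable ℂ (fun x : ℂ × E => iteratedDeriv m (fun t => h (t, x.2)) x.1) := by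
    intro m
    induction m with
    | zero => intro h hh; simpa using hh
    | succ m ih =>
      intro h hh
      have h1 := ih _ (differentiable_fderiv_apply hh ((1 : ℂ), (0 : E)))
      convert h1 using 2 with x
      rw [iteratedDeriv_succ']
      congr 1
      funext t
      have := (hasDerivAt_comp_line hh ((0 : ℂ), x.2) ((1 : ℂ), (0 : E)) t).deriv
      simpa using this
  have := key m (fun x => f (z + x.1 • x.2)) (by fun_prop)
  exact this.comp (by fun_prop : Differentiable ℂ (fun v : E => ((0 : ℂ), v)))

/-- Entire functions form a domain: on the line joining a nonzero of `f` to a nonzero of `g`, the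
identity theorem in one variable applies. -/
theorem eq_zero_or_eq_zero_of_mul_eq_zero (hf : Differentiable ℂ f) (hg : Differentiable ℂ g)
    (h : ∀ z, f z * g z = 0) : (∀ z, f z = 0) ∨ (∀ z, g z = 0) := by
  by_contra! hcon
  obtain ⟨⟨x, hx⟩, ⟨y, hy⟩⟩ := hcon
  have hF := (differentiable_comp_line hf x (y - x))
  have hG := (differentiable_comp_line hg x (y - x))
  have hev : ∀ {φ : ℂ → ℂ}, Differentiable ℂ φ → (∃ᶠ t in 𝓝[≠] (0 : ℂ), φ t = 0) → ∀ t, φ t = 0 :=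
    fun {φ} hφ hfr t => congrFun
      (AnalyticOnNhd.eq_of_frequently_eq (g := fun _ => (0 : ℂ)) (z₀ := 0)
        (fun s _ => hφ.analyticAt s) analyticOnNhd_const hfr) t
  have hor : ∃ᶠ t in 𝓝[≠] (0 : ℂ), f (x + t • (y - x)) = 0 ∨ g (x + t • (y - x)) = 0 :=
    Frequently.of_forall fun t => mul_eq_zero.1 (h _)
  rcases frequently_or_distrib.1 hor with h1 | h1
  · exact hx (by simpa using hev hF h1 0)
  · exact hy (by simpa using hev hG h1 1)

theorem dense_ne_zero (hf : Differentiable ℂ f) (h0 : ∃ z, f z ≠ 0) : Dense {z | f z ≠ 0} := by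
  obtain ⟨y, hy⟩ := h0
  rw [dense_iff_closure_eq, Set.eq_univ_iff_forall]
  intro x
  rw [mem_closure_iff_frequently]
  have hc : Tendsto (fun t : ℂ => x + t • (y - x)) (𝓝[≠] 0) (𝓝 x) := by
    have : Continuous (fun t : ℂ => x + t • (y - x)) := by fun_prop
    simpa using (this.tendsto 0).mono_left nhdsWithin_le_nhds
  refine hc.frequently ?_
  by_contra hcon
  rw [not_frequently] at hcon
  have := congrFun (AnalyticOnNhd.eq_of_frequently_eq (g := fun _ => (0 : ℂ)) (z₀ := 0)
    (f := fun t : ℂ => f (x + t • (y - x)))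
    (fun s _ => (differentiable_comp_line hf x (y - x)).analyticAt s) analyticOnNhd_const
    (hcon.frequently.mono fun t ht => by simpa using ht)) 1
  exact hy (by simpa using this)

/-- The function lifts through the covering `exp` because the domain is simply connected. Locally
the lift is a constant plus a branch of the logarithm, hence holomorphic. -/
theorem exists_exp_eq_of_ne_zero (hf : Differentiable ℂ f) (h0 : ∀ z, f z ≠ 0) :
    ∃ g : E → ℂ, Differentiable ℂ g ∧ ∀ z, f z = Complex.exp (g z) := by
  let : NormedSpace ℝ E := NormedSpace.restrictScalars ℝ ℂ E
  obtain ⟨g, ⟨-, hfg⟩, -⟩ := Complex.isCoveringMapOn_exp.existsUnique_continuousMap_lifts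
    ⟨f, hf.continuous⟩ (Complex.exp_log (h0 0)) (fun x => h0 x)
  have hfg' : ∀ z, Complex.exp (g z) = f z := fun z => congrFun hfg z
  refine ⟨g, fun z => ?_, fun z => (hfg' z).symm⟩
  have hloc : ∀ᶠ w in 𝓝 z, g w = g z + Complex.log (f w / f z) := by
    have hc : ContinuousAt (fun w => (g w - g z).im) z := by fun_prop
    have hlt : (g z - g z).im < Real.pi := by simpa using Real.pi_pos
    have hgt : -Real.pi < (g z - g z).im := by simpa using Real.pi_pos
    filter_upwards [hc.eventually (lt_mem_nhds hgt), hc.eventually (gt_mem_nhds hlt)] with w h1 h2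
    rw [← hfg', ← hfg', ← Complex.exp_sub, Complex.log_exp h1 h2.le]
    ring
  refine DifferentiableAt.congr_of_eventuallyEq ?_ hloc
  have hq : DifferentiableAt ℂ (fun w => f w / f z) z := by
    simp only [div_eq_mul_inv]
    exact (hf z).mul_const _
  refine (hq.clog ?_).const_add _
  simp [h0 z]

end Entire

/-! ### Multiplicities of zeros and their additivity -/

section ZeroMult

variable {n : ℕ} {f g : Cn n → ℂ}

theorem le_zeroMult_iff {m : ℕ} {z : Cn n} :
    (m : ℕ∞) ≤ zeroMult f z ↔
      ∀ k < m, ∀ v : Cn n, iteratedDeriv k (fun t : ℂ => f (z + t • v)) 0 = 0 := by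
  simp only [zeroMult, le_iInf_iff, Nat.cast_le]
  constructor
  · intro h k hk v
    by_contra hne
    exact absurd (h k ⟨v, hne⟩) (by omega)
  · rintro h k ⟨v, hv⟩
    by_contra hlt
    exact hv (h k (by omega) v)

theorem le_zeroMult_iff_order (hf : Differentiable ℂ f) {m : ℕ} {z : Cn n} :
    (m : ℕ∞) ≤ zeroMult f z ↔
      ∀ v : Cn n, (m : ℕ∞) ≤ analyticOrderAt (fun t : ℂ => f (z + t • v)) 0 := by
  rw [le_zeroMult_iff]
  have : ∀ v : Cn n, ((m : ℕ∞) ≤ analyticOrderAt (fun t : ℂ => f (z + t • v)) 0 ↔ _) := fun v =>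
    natCast_le_analyticOrderAt_iff_iteratedDeriv_eq_zero
      ((differentiable_comp_line hf z v).analyticAt 0)
  simp only [this]
  exact ⟨fun h v k hk => h k hk v, fun h k hk v => h v k hk⟩

theorem zeroMult_le_order (hf : Differentiable ℂ f) (z v : Cn n) :
    zeroMult f z ≤ analyticOrderAt (fun t : ℂ => f (z + t • v)) 0 := by
  refine ENat.forall_natCast_le_iff_le.1 fun m hm => ?_
  exact (le_zeroMult_iff_order hf).1 hm v

theorem exists_iteratedDeriv_ne_zero {m : ℕ} {z : Cn n} (h : zeroMult f z = m) :
    ∃ v : Cn n, iteratedDeriv m (fun t : ℂ => f (z + t • v)) 0 ≠ 0 := by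
  by_contra! hcon
  have : ((m + 1 : ℕ) : ℕ∞) ≤ zeroMult f z := le_zeroMult_iff.2 fun k hk v => by
    rcases Nat.lt_succ_iff_lt_or_eq.1 hk with hk | rfl
    · exact le_zeroMult_iff.1 h.ge k hk v
    · exact hcon v
  rw [h, Nat.cast_le] at this
  omega

/-- The multiplicity is a lower bound for the order along every line; it is attained in the
directions where the leading homogeneous part does not vanish. -/
theorem order_eq_of_iteratedDeriv_ne_zero (hf : Differentiable ℂ f) {m : ℕ} {z v : Cn n}
    (h : zeroMult f z = m) (hv : iteratedDeriv m (fun t : ℂ => f (z + t • v)) 0 ≠ 0) :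
    analyticOrderAt (fun t : ℂ => f (z + t • v)) 0 = m := by
  refine le_antisymm ?_ (h ▸ zeroMult_le_order hf z v)
  by_contra hlt
  rw [not_le, ← ENat.add_one_le_iff (ENat.natCast_ne_top m), ← Nat.cast_succ,
    natCast_le_analyticOrderAt_iff_iteratedDeriv_eq_zero
      ((differentiable_comp_line hf z v).analyticAt 0)] at hlt
  exact hv (hlt m m.lt_succ_self)

theorem zeroMult_eq_zero_iff {z : Cn n} : zeroMult f z = 0 ↔ f z ≠ 0 := by
  rw [← not_iff_not, not_not, ← ne_eq, ← Order.one_le_iff_ne_zero, ← Nat.cast_one, le_zeroMult_iff]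
  simp

/-- Orders along lines are additive, which gives `≥`. For `≤`, the two leading homogeneous parts are
nonzero entire functions of the direction, so some direction is good for both. -/
theorem zeroMult_mul (hf : Differentiable ℂ f) (hg : Differentiable ℂ g) (z : Cn n) :
    zeroMult (fun w => f w * g w) z = zeroMult f z + zeroMult g z := by
  have hfg : Differentiable ℂ (fun w => f w * g w) := hf.mul hg
  have hord : ∀ v : Cn n, analyticOrderAt (fun t : ℂ => f (z + t • v) * g (z + t • v)) 0 =
      analyticOrderAt (fun t : ℂ => f (z + t • v)) 0 +
        analyticOrderAt (fun t : ℂ => g (z + t • v)) 0 := fun v =>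
    analyticOrderAt_mul ((differentiable_comp_line hf z v).analyticAt 0)
      ((differentiable_comp_line hg z v).analyticAt 0)
  have hge : zeroMult f z + zeroMult g z ≤ zeroMult (fun w => f w * g w) z := by
    refine ENat.forall_natCast_le_iff_le.1 fun m hm => (le_zeroMult_iff_order hfg).2 fun v => ?_
    rw [hord v]
    exact hm.trans (add_le_add (zeroMult_le_order hf z v) (zeroMult_le_order hg z v))
  refine le_antisymm ?_ hge
  rcases eq_or_ne (zeroMult f z) ⊤ with hf' | hf'
  · simp [hf']
  rcases eq_or_ne (zeroMult g z) ⊤ with hg' | hg'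
  · simp [hg']
  obtain ⟨k, hk⟩ := ENat.ne_top_iff_exists.1 hf'
  obtain ⟨l, hl⟩ := ENat.ne_top_iff_exists.1 hg'
  obtain ⟨v, hv⟩ := exists_iteratedDeriv_ne_zero hk.symm
  obtain ⟨w, hw⟩ := exists_iteratedDeriv_ne_zero hl.symm
  have hP := iteratedDeriv_line_differentiable hf k z
  have hQ := iteratedDeriv_line_differentiable hg l z
  obtain ⟨x, hx⟩ : ∃ x : Cn n, iteratedDeriv k (fun t : ℂ => f (z + t • x)) 0 *
      iteratedDeriv l (fun t : ℂ => g (z + t • x)) 0 ≠ 0 := by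
    by_contra! hcon
    rcases eq_zero_or_eq_zero_of_mul_eq_zero hP hQ hcon with h | h
    · exact hv (h v)
    · exact hw (h w)
  have := zeroMult_le_order hfg z x
  rw [hord x, order_eq_of_iteratedDeriv_ne_zero hf hk.symm (left_ne_zero_of_mul hx),
    order_eq_of_iteratedDeriv_ne_zero hg hl.symm (right_ne_zero_of_mul hx)] at this
  rwa [← hk, ← hl]

theorem differentiable_finsetProd {ι : Type*} {φ : ι → Cn n → ℂ} (s : Finset ι)
    (hφ : ∀ i ∈ s, Differentiable ℂ (φ i)) : Differentiable ℂ (fun w => ∏ i ∈ s, φ i w) := by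
  classical
  induction s using Finset.induction_on with
  | empty => simp
  | insert i s hi ih =>
    simp only [Finset.prod_insert hi]
    exact (hφ i (by simp)).mul (ih fun j hj => hφ j (by simp [hj]))

theorem zeroMult_prod {ι : Type*} {φ : ι → Cn n → ℂ} (s : Finset ι)
    (hφ : ∀ i ∈ s, Differentiable ℂ (φ i)) (z : Cn n) :
    zeroMult (fun w => ∏ i ∈ s, φ i w) z = ∑ i ∈ s, zeroMult (φ i) z := by
  classical
  induction s using Finset.induction_on with
  | empty => simp [zeroMult_eq_zero_iff]
  | insert i s hi ih =>
    simp only [Finset.prod_insert hi, Finset.sum_insert hi]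
    rw [zeroMult_mul (hφ i (by simp)) (differentiable_finsetProd s fun j hj => hφ j (by simp [hj])),
      ih fun j hj => hφ j (by simp [hj])]

theorem differentiable_pair (a : Cn n) : Differentiable ℂ (pair a) := by
  unfold pair; fun_prop

theorem differentiable_lin (a : Cn n) (c : ℂ) : Differentiable ℂ (lin a c) :=
  (differentiable_pair a).add_const c

theorem pair_add (a z w : Cn n) : pair a (z + w) = pair a z + pair a w := by
  simp [pair, mul_add, Finset.sum_add_distrib]

theorem pair_smul (a z : Cn n) (t : ℂ) : pair a (t • z) = t * pair a z := by
  simp only [pair, Finset.mul_sum, PiLp.smul_apply, smul_eq_mul]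
  exact Finset.sum_congr rfl fun p _ => by ring

theorem pair_sub (a z w : Cn n) : pair a (z - w) = pair a z - pair a w := by
  simp [pair, mul_sub, Finset.sum_sub_distrib]

theorem pair_unitVec (a : Cn n) (p : Fin n) : pair a (unitVec p) = a p := by
  simp [pair, unitVec, PiLp.single_apply]

theorem lin_add (a z w : Cn n) (c : ℂ) : lin a c (z + w) = lin a c z + pair a w := by
  simp only [lin, pair_add]; ring

theorem lin_sub (a z w : Cn n) (c : ℂ) : lin a c (z - w) = lin a c z - pair a w := by
  simp only [lin, pair_sub]; ring

theorem exists_pair_eq_one {a : Cn n} (ha : a ≠ 0) : ∃ v, pair a v = 1 := by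
  obtain ⟨p, hp⟩ : ∃ p, a p ≠ 0 := by
    by_contra! h
    exact ha (by ext p; simpa using h p)
  exact ⟨(a p)⁻¹ • unitVec p, by rw [pair_smul, pair_unitVec, inv_mul_cancel₀ hp]⟩

/-- In a direction `v` with `⟨a, v⟩ = 1` the function is a translate of `φ`, which has a simple
zero. -/
theorem zeroMult_comp_lin {φ : ℂ → ℂ} (hφ : Differentiable ℂ φ) {a : Cn n} (ha : a ≠ 0) {c : ℂ}
    {z : Cn n} (h0 : φ (lin a c z) = 0) (h1 : deriv φ (lin a c z) ≠ 0) :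
    zeroMult (fun w => φ (lin a c w)) z = 1 := by
  obtain ⟨v, hv⟩ := exists_pair_eq_one ha
  have hd : Differentiable ℂ (fun w => φ (lin a c w)) := hφ.comp (differentiable_lin a c)
  refine le_antisymm ?_ ?_
  · refine (zeroMult_le_order hd z v).trans (le_of_eq ?_)
    refine ((differentiable_comp_line hd z v).analyticAt 0).analyticOrderAt_eq_one_of_zero_deriv_ne_zero
      (by simpa using h0) ?_
    have : (fun t : ℂ => φ (lin a c (z + t • v))) = fun t => φ (lin a c z + t) := by
      funext t; rw [lin_add, pair_smul, hv, mul_one]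
    rw [this, deriv_comp_const_add]
    simpa using h1
  · rw [Order.one_le_iff_ne_zero, ne_eq, zeroMult_eq_zero_iff, not_not]
    exact h0

theorem zeroMult_lin {a : Cn n} (ha : a ≠ 0) {c : ℂ} {z : Cn n} (h0 : lin a c z = 0) :
    zeroMult (lin a c) z = 1 :=
  zeroMult_comp_lin (φ := fun x => x) differentiable_id ha h0 (by simp)

end ZeroMult

/-! ### Division by affine functions -/

section Division

theorem differentiable_intervalIntegral {E : Type*} [NormedAddCommGroup E] [NormedSpace ℂ E]
    [FiniteDimensional ℂ E] {K : E × ℂ → ℂ} (hK : Differentiable ℂ K) :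
    Differentiable ℂ (fun x => ∫ s in (0 : ℝ)..1, K (x, (s : ℂ))) := by
  have : ProperSpace E := FiniteDimensional.proper ℂ E
  intro x₀
  have hC : ContDiff ℂ 1 K := by exact_mod_cast contDiff_of_differentiable hK 1
  have hcont : Continuous (fderiv ℂ K) := hC.continuous_fderiv one_ne_zero
  let F' : E → ℝ → E →L[ℂ] ℂ := fun x s =>
    (fderiv ℂ K (x, (s : ℂ))).comp (ContinuousLinearMap.inl ℂ E ℂ)
  have hF'c : Continuous (fun q : E × ℝ => F' q.1 q.2) := by
    have : Continuous (fun q : E × ℝ => fderiv ℂ K (q.1, (q.2 : ℂ))) := hcont.comp (by fun_prop)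
    exact this.clm_comp continuous_const
  obtain ⟨M, hM⟩ := ((isCompact_closedBall x₀ 1).prod (isCompact_Icc (a := (0 : ℝ)) (b := 1))).exists_bound_of_continuousOn
    hF'c.continuousOn
  have hKc : ∀ x : E, Continuous (fun s : ℝ => K (x, (s : ℂ))) := fun x =>
    hK.continuous.comp (by fun_prop)
  refine (intervalIntegral.hasFDerivAt_integral_of_dominated_of_fderiv_le (𝕜 := ℂ) (μ := MeasureTheory.volume)
    (F := fun x s => K (x, (s : ℂ))) (F' := F') (bound := fun _ => M)
    (Metric.closedBall_mem_nhds x₀ one_pos) ?_ ?_ ?_ ?_ ?_ ?_).differentiableAt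
  · exact Eventually.of_forall fun x => (hKc x).aestronglyMeasurable
  · exact (hKc x₀).intervalIntegrable _ _
  · exact (hF'c.comp (by fun_prop : Continuous fun s : ℝ => (x₀, s))).aestronglyMeasurable
  · refine Eventually.of_forall fun s hs x hx => hM (x, s) ⟨hx, ?_⟩
    rw [Set.uIoc_of_le zero_le_one] at hs
    exact ⟨hs.1.le, hs.2⟩
  · exact intervalIntegrable_const
  · refine Eventually.of_forall fun s hs x hx => ?_
    exact (hK (x, (s : ℂ))).hasFDerivAt.comp x (hasFDerivAt_prodMk_left x (s : ℂ))

variable {n : ℕ} {f g : Cn n → ℂ}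

/-- Hadamard's lemma: with `⟨a, v⟩ = 1`, the point `z - l(z) v` lies on the plane, so `f(z) = l(z)
∫₀¹ ∂_v f(z - s l(z) v) ds`. The integral is the entire quotient. -/
theorem exists_eq_lin_mul (hf : Differentiable ℂ f) {a : Cn n} (ha : a ≠ 0) {c : ℂ}
    (h0 : ∀ z, lin a c z = 0 → f z = 0) :
    ∃ g : Cn n → ℂ, Differentiable ℂ g ∧ ∀ z, f z = lin a c z * g z := by
  obtain ⟨v, hv⟩ := exists_pair_eq_one ha
  have hD := differentiable_fderiv_apply hf v
  have hl := differentiable_lin a c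
  let K : Cn n × ℂ → ℂ := fun x => fderiv ℂ f (x.1 + x.2 • (-lin a c x.1) • v) v
  have hK : Differentiable ℂ K := by
    have : Differentiable ℂ (fun x : Cn n × ℂ => x.1 + x.2 • (-lin a c x.1) • v) := by fun_prop
    exact hD.comp this
  refine ⟨_, differentiable_intervalIntegral hK, fun z => ?_⟩
  have hder : ∀ s : ℝ, HasDerivAt (fun s : ℝ => f (z + (s : ℂ) • (-lin a c z) • v))
      (-lin a c z * K (z, (s : ℂ))) s := fun s => by
    have := (hasDerivAt_comp_line hf z ((-lin a c z) • v) (s : ℂ)).comp_ofReal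
    simpa [K] using this
  have hcauchy := intervalIntegral.integral_eq_sub_of_hasDerivAt (a := 0) (b := 1)
    (fun s _ => hder s) (by
      refine Continuous.intervalIntegrable ?_ _ _
      exact continuous_const.mul (hK.continuous.comp (by fun_prop)))
  rw [intervalIntegral.integral_const_mul] at hcauchy
  have hz : f (z + ((1 : ℝ) : ℂ) • (-lin a c z) • v) = 0 := h0 _ (by
    rw [lin_add, pair_smul, pair_smul, hv]; simp)
  rw [hz] at hcauchy
  simp only [Complex.ofReal_zero, zero_smul, add_zero, zero_sub, neg_mul, neg_inj] at hcauchy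
  exact hcauchy.symm

/-- The product of the affine functions `l_{a,c}` over a multiset of pairs `(a, c)`. -/
def linProd (s : Multiset (Cn n × ℂ)) (z : Cn n) : ℂ := (s.map fun l => lin l.1 l.2 z).prod

@[simp] theorem linProd_zero (z : Cn n) : linProd 0 z = 1 := by simp [linProd]

@[simp] theorem linProd_cons (l : Cn n × ℂ) (s : Multiset (Cn n × ℂ)) (z : Cn n) :
    linProd (l ::ₘ s) z = lin l.1 l.2 z * linProd s z := by simp [linProd]

theorem linProd_add (s t : Multiset (Cn n × ℂ)) (z : Cn n) :
    linProd (s + t) z = linProd s z * linProd t z := by simp [linProd]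

theorem linProd_eq_zero_iff {s : Multiset (Cn n × ℂ)} {z : Cn n} :
    linProd s z = 0 ↔ ∃ l ∈ s, lin l.1 l.2 z = 0 := by
  simp [linProd, Multiset.prod_eq_zero_iff]

theorem differentiable_linProd (s : Multiset (Cn n × ℂ)) : Differentiable ℂ (linProd s) := by
  induction s using Multiset.induction_on with
  | empty =>
    rw [show linProd (0 : Multiset (Cn n × ℂ)) = fun _ => 1 from funext linProd_zero]
    exact differentiable_const 1
  | cons l s ih =>
    have : linProd (l ::ₘ s) = fun z => lin l.1 l.2 z * linProd s z := funext (linProd_cons l s)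
    rw [this]
    exact (differentiable_lin _ _).mul ih

open Classical in
theorem zeroMult_linProd {s : Multiset (Cn n × ℂ)} (hs : ∀ l ∈ s, l.1 ≠ 0) (z : Cn n) :
    zeroMult (linProd s) z = s.countP (fun l => lin l.1 l.2 z = 0) := by
  induction s using Multiset.induction_on with
  | empty => simp [zeroMult_eq_zero_iff]
  | cons l s ih =>
    have : linProd (l ::ₘ s) = fun z => lin l.1 l.2 z * linProd s z := funext (linProd_cons l s)
    rw [this, zeroMult_mul (differentiable_lin _ _) (differentiable_linProd s),
      ih fun l hl => hs l (Multiset.mem_cons_of_mem hl), Multiset.countP_cons, add_comm]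
    push_cast
    congr 1
    split_ifs with h
    · simpa using zeroMult_lin (hs l (Multiset.mem_cons_self _ _)) h
    · simpa [zeroMult_eq_zero_iff] using h

theorem exists_eq_linProd_mul {s : Multiset (Cn n × ℂ)} (hs : ∀ l ∈ s, l.1 ≠ 0)
    (hg : Differentiable ℂ g)
    (h : ∀ z, zeroMult (linProd s) z ≤ zeroMult g z) :
    ∃ g' : Cn n → ℂ, Differentiable ℂ g' ∧ ∀ z, g z = linProd s z * g' z := by
  induction s using Multiset.induction_on generalizing g with
  | empty => exact ⟨g, hg, by simp⟩
  | cons l s ih =>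
    have hls : linProd (l ::ₘ s) = fun z => lin l.1 l.2 z * linProd s z := funext (linProd_cons l s)
    have hl := hs l (Multiset.mem_cons_self _ _)
    have hs' : ∀ l ∈ s, l.1 ≠ 0 := fun l hl => hs l (Multiset.mem_cons_of_mem hl)
    simp only [hls, zeroMult_mul (differentiable_lin _ _) (differentiable_linProd s)] at h
    obtain ⟨g₁, hg₁, hgg₁⟩ := exists_eq_lin_mul hg hl (c := l.2) fun z hz => by
      by_contra hne
      have := h z
      rw [zeroMult_lin hl hz, zeroMult_eq_zero_iff.2 hne] at this
      simp at this
    obtain ⟨g₂, hg₂, hgg₂⟩ := ih hs' hg₁ fun z => by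
      have := h z
      rw [show g = fun z => lin l.1 l.2 z * g₁ z from funext hgg₁,
        zeroMult_mul (differentiable_lin _ _) hg₁] at this
      -- Cancellation in `ℕ∞` needs the multiplicity of the affine factor to be finite; it is `1` or
      -- `0`.
      refine (ENat.add_le_add_iff_left ?_).1 this
      by_cases h0 : lin l.1 l.2 z = 0
      · rw [zeroMult_lin hl h0]; simp
      · rw [zeroMult_eq_zero_iff.2 h0]; simp
    exact ⟨g₂, hg₂, fun z => by rw [hgg₁, hgg₂, linProd_cons, mul_assoc]⟩

end Division

/-! ### Factorization over a ball of functions with plane zeros -/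

section Factorization

variable {n : ℕ} {F G : Cn n → ℂ}

/-- A form of Jensen's inequality. Each affine factor at least doubles in size from the centre to
the circle, so the maximum principle for the cofactor gains a factor `2` per affine function. -/
theorem pow_card_mul_norm_le {F' : Cn n → ℂ} (hF' : Differentiable ℂ F')
    {s : Multiset (Cn n × ℂ)} (hF : ∀ z, F z = linProd s z * F' z) {z₀ v : Cn n} (h0 : F z₀ ≠ 0)
    {R M : ℝ} (hR : 0 < R) (hM : ∀ t : ℂ, ‖t‖ = R → ‖F (z₀ + t • v)‖ ≤ M)
    (hs : ∀ l ∈ s, ∀ t : ℂ, ‖t‖ = R → 2 * ‖lin l.1 l.2 z₀‖ ≤ ‖lin l.1 l.2 (z₀ + t • v)‖) :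
    2 ^ s.card * ‖F z₀‖ ≤ M := by
  have hP : 0 < ‖linProd s z₀‖ := norm_pos_iff.2 (left_ne_zero_of_mul (hF z₀ ▸ h0))
  have hprod : ∀ t : ℂ, ‖t‖ = R → 2 ^ s.card * ‖linProd s z₀‖ ≤ ‖linProd s (z₀ + t • v)‖ := by
    intro t ht
    clear hF hP
    induction s using Multiset.induction_on with
    | empty => simp
    | cons l s ih =>
      have h1 := hs l (Multiset.mem_cons_self _ _) t ht
      have h2 := ih fun l hl => hs l (Multiset.mem_cons_of_mem hl)
      rw [linProd_cons, linProd_cons, norm_mul, norm_mul, Multiset.card_cons, pow_succ]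
      calc 2 ^ s.card * 2 * (‖lin l.1 l.2 z₀‖ * ‖linProd s z₀‖)
          = (2 * ‖lin l.1 l.2 z₀‖) * (2 ^ s.card * ‖linProd s z₀‖) := by ring
        _ ≤ _ := by gcongr
  have hbound : ‖F' z₀‖ ≤ M / (2 ^ s.card * ‖linProd s z₀‖) := by
    have := Complex.norm_le_of_forall_mem_frontier_norm_le (U := Metric.ball (0 : ℂ) R)
      Metric.isBounded_ball (differentiable_comp_line hF' z₀ v).diffContOnCl
      (C := M / (2 ^ s.card * ‖linProd s z₀‖)) (z := 0) ?_
      (subset_closure (Metric.mem_ball_self hR))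
    · simpa using this
    · intro t ht
      rw [frontier_ball _ hR.ne', mem_sphere_zero_iff_norm] at ht
      rw [le_div_iff₀ (by positivity)]
      calc ‖F' (z₀ + t • v)‖ * (2 ^ s.card * ‖linProd s z₀‖)
          ≤ ‖F' (z₀ + t • v)‖ * ‖linProd s (z₀ + t • v)‖ := by gcongr; exact hprod t ht
        _ = ‖F (z₀ + t • v)‖ := by rw [hF, norm_mul, mul_comm]
        _ ≤ M := hM t ht
  rw [le_div_iff₀ (by positivity)] at hbound
  rw [hF, norm_mul]
  linarith

theorem norm_pair_le {a z : Cn n} {A : ℝ} (hA : ∀ p, ‖a p‖ ≤ A) : ‖pair a z‖ ≤ n * (A * ‖z‖) := by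
  unfold pair
  refine (norm_sum_le _ _).trans ?_
  refine (Finset.sum_le_card_nsmul _ _ (A * ‖z‖) fun p _ => ?_).trans (by simp)
  rw [norm_mul]
  have := hA p
  have := (norm_nonneg (a p)).trans this
  gcongr
  exact PiLp.norm_apply_le z p

/-- The number of factors `l_{a,c}` of an entire function whose zero sets meet a given ball is
bounded. -/
theorem exists_card_le (hFd : Differentiable ℂ F) {z₀ : Cn n} (h0 : F z₀ ≠ 0) (ρ : ℝ) :
    ∃ N : ℕ, ∀ (s : Multiset (Cn n × ℂ)) (F' : Cn n → ℂ), Differentiable ℂ F' →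
      (∀ z, F z = linProd s z * F' z) →
      (∀ l ∈ s, l.1 ≠ 0 ∧ ∃ z ∈ Metric.ball (0 : Cn n) ρ, lin l.1 l.2 z = 0) → s.card ≤ N := by
  classical
  rcases le_or_gt ρ 0 with hρ | hρ
  · refine ⟨0, fun s F' _ _ hs => ?_⟩
    rw [nonpos_iff_eq_zero, Multiset.card_eq_zero]
    refine Multiset.eq_zero_of_forall_notMem fun l hl => ?_
    obtain ⟨-, z, hz, -⟩ := hs l hl
    rw [Metric.ball_eq_empty.2 hρ] at hz
    exact hz
  set C : ℝ := n * (‖z₀‖ + ρ) with hC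
  have hC0 : 0 ≤ C := by positivity
  -- If `a_p` is the largest coefficient and the plane meets the ball, then `|l(z₀)| ≤ C |a_p|` and
  -- `|l(z₀ + t ω_p)| ≥ (R - C) |a_p|` for `|t| = R`. The radius makes the second at least twice the
  -- first.
  set R : ℝ := 3 * C + 1 with hRdef
  have hR : 0 < R := by positivity
  have hM : ∀ p : Fin n, ∃ M : ℝ, ∀ t : ℂ, ‖t‖ = R → ‖F (z₀ + t • unitVec p)‖ ≤ M := fun p => by
    obtain ⟨M, hM⟩ := (isCompact_sphere (0 : ℂ) R).exists_bound_of_continuousOn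
      (differentiable_comp_line hFd z₀ (unitVec p)).continuous.continuousOn
    exact ⟨M, fun t ht => hM t (by simpa using ht)⟩
  choose M hM using hM
  -- The factors are sorted by a coordinate with the largest coefficient. If `k` of them belong to
  -- `p`, then `k < 2^k ≤ M p / |F(z₀)|`.
  refine ⟨∑ p, ⌊M p / ‖F z₀‖⌋₊, fun s F' hF' hF hs => ?_⟩
  have hFn : 0 < ‖F z₀‖ := norm_pos_iff.2 h0
  let good : Fin n → (Cn n × ℂ) → Prop := fun p l => l.1 p ≠ 0 ∧ ∀ q, ‖l.1 q‖ ≤ ‖l.1 p‖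
  have hgood : ∀ l : Cn n × ℂ, l.1 ≠ 0 → ∃ p, good p l := fun l hl => by
    obtain ⟨q, hq⟩ : ∃ q, l.1 q ≠ 0 := by
      by_contra! h
      exact hl (by ext p; simpa using h p)
    obtain ⟨p, -, hp⟩ := Finset.exists_max_image Finset.univ (fun p => ‖l.1 p‖) ⟨q, by simp⟩
    refine ⟨p, fun h => hq ?_, fun q => hp q (by simp)⟩
    simpa [h] using hp q (by simp)
  have hcard : ∀ s : Multiset (Cn n × ℂ), (∀ l ∈ s, l.1 ≠ 0) →
      s.card ≤ ∑ p, (s.filter (good p)).card := by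
    intro s
    induction s using Multiset.induction_on with
    | empty => simp
    | cons l s ih =>
      intro hs
      obtain ⟨p, hp⟩ := hgood l (hs l (Multiset.mem_cons_self _ _))
      have hlt : ∑ p, (s.filter (good p)).card < ∑ p, ((l ::ₘ s).filter (good p)).card := by
        refine Finset.sum_lt_sum (fun q _ => Multiset.card_le_card
          (Multiset.filter_le_filter _ (Multiset.le_cons_self s l))) ⟨p, by simp, ?_⟩
        rw [Multiset.filter_cons_of_pos _ hp, Multiset.card_cons]
        omega
      have := ih fun l hl => hs l (Multiset.mem_cons_of_mem hl)
      rw [Multiset.card_cons]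
      omega
  refine (hcard s fun l hl => (hs l hl).1).trans (Finset.sum_le_sum fun p _ => ?_)
  have hsplit : ∀ z, F z = linProd (s.filter (good p)) z *
      (linProd (s.filter fun l => ¬ good p l) z * F' z) := fun z => by
    rw [hF, ← mul_assoc, ← linProd_add, Multiset.filter_add_not]
  have key := pow_card_mul_norm_le ((differentiable_linProd _).mul hF') hsplit h0 hR (hM p) ?_
  · refine Nat.le_floor ?_
    rw [← le_div_iff₀ hFn] at key
    refine le_trans ?_ key
    exact_mod_cast Nat.lt_two_pow_self.le
  · intro l hl t ht
    rw [Multiset.mem_filter] at hl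
    obtain ⟨hls, hp0, hp⟩ := hl
    obtain ⟨-, z, hz, hlz⟩ := hs l hls
    have h1 : lin l.1 l.2 z₀ = pair l.1 (z₀ - z) := by
      rw [pair_sub]; unfold lin at hlz ⊢; linear_combination hlz
    have h2 : ‖lin l.1 l.2 z₀‖ ≤ C * ‖l.1 p‖ := by
      rw [h1]
      refine (norm_pair_le hp).trans ?_
      rw [mem_ball_zero_iff] at hz
      have : ‖z₀ - z‖ ≤ ‖z₀‖ + ρ := (norm_sub_le _ _).trans (by linarith)
      calc (n : ℝ) * (‖l.1 p‖ * ‖z₀ - z‖) ≤ n * (‖l.1 p‖ * (‖z₀‖ + ρ)) := by gcongr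
        _ = C * ‖l.1 p‖ := by rw [hC]; ring
    have h3 : ‖t * l.1 p‖ ≤ ‖lin l.1 l.2 (z₀ + t • unitVec p)‖ + ‖lin l.1 l.2 z₀‖ := by
      rw [lin_add, pair_smul, pair_unitVec]
      calc ‖t * l.1 p‖ = ‖(lin l.1 l.2 z₀ + t * l.1 p) - lin l.1 l.2 z₀‖ := by congr 1; ring
        _ ≤ _ := norm_sub_le _ _
    rw [norm_mul, ht, hRdef] at h3
    nlinarith [norm_nonneg (l.1 p)]

theorem exists_factor_eq_zero {ι : Type*} (s : Multiset ι) {φ : ι → Cn n → ℂ}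
    (hφ : ∀ i, Differentiable ℂ (φ i)) (h : ∀ z, (s.map fun i => φ i z).prod = 0) :
    ∃ i ∈ s, ∀ z, φ i z = 0 := by
  have hd : ∀ s : Multiset ι, Differentiable ℂ (fun z => (s.map fun i => φ i z).prod) := by
    intro s
    induction s using Multiset.induction_on with
    | empty => simp
    | cons i s ih =>
      simp only [Multiset.map_cons, Multiset.prod_cons]
      exact (hφ i).mul ih
  induction s using Multiset.induction_on with
  | empty => simp at h
  | cons i s ih =>
    simp only [Multiset.map_cons, Multiset.prod_cons] at h
    rcases eq_zero_or_eq_zero_of_mul_eq_zero (hφ i) (hd s) h with h | h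
    · exact ⟨i, Multiset.mem_cons_self _ _, h⟩
    · obtain ⟨j, hj, hzero⟩ := ih h
      exact ⟨j, Multiset.mem_cons_of_mem hj, hzero⟩

/-- The projection to the hyperplane `l = 0` along the vector `v`. -/
def planeProj (l : Cn n × ℂ) (v z : Cn n) : Cn n := z - (lin l.1 l.2 z / pair l.1 v) • v

theorem differentiable_planeProj (l : Cn n × ℂ) (v : Cn n) : Differentiable ℂ (planeProj l v) := by
  have := differentiable_lin l.1 l.2
  unfold planeProj
  simp only [div_eq_mul_inv]
  fun_prop

theorem planeProj_of_mem {l : Cn n × ℂ} (v : Cn n) {z : Cn n} (hz : lin l.1 l.2 z = 0) :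
    planeProj l v z = z := by simp [planeProj, hz]

theorem lin_planeProj {l : Cn n × ℂ} {v : Cn n} (hv : pair l.1 v ≠ 0) (z : Cn n) :
    lin l.1 l.2 (planeProj l v z) = 0 := by
  rw [planeProj, lin_sub, pair_smul]
  field_simp
  ring

/-- An entire function whose zeros near one of them lie on finitely many hyperplanes vanishes on
one of these hyperplanes. -/
theorem exists_plane_subset_zeros (hF : Differentiable ℂ F) (hne : ∃ w, F w ≠ 0) {z : Cn n}
    (hz : F z = 0) {s : Multiset (Cn n × ℂ)} (hs : ∀ l ∈ s, l.1 ≠ 0) {U : Set (Cn n)}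
    (hU : U ∈ 𝓝 z) (hsub : ∀ w ∈ U, F w = 0 → linProd s w = 0) :
    ∃ l ∈ s, ∀ w, lin l.1 l.2 w = 0 → F w = 0 := by
  -- The direction is transversal to all planes of `s`, and `F` is not identically zero on the line
  -- through `z`. Without such a direction a product of nonzero entire functions of `v` would
  -- vanish.
  obtain ⟨v, hFv, hsv⟩ : ∃ v, F (z + v) ≠ 0 ∧ ∀ l ∈ s, pair l.1 v ≠ 0 := by
    by_contra! hcon
    have hP : ∀ v, F (z + v) * (s.map fun l => pair l.1 v).prod = 0 := fun v => by
      by_cases h : F (z + v) = 0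
      · rw [h, zero_mul]
      · obtain ⟨l, hl, hl0⟩ := hcon v h
        rw [Multiset.prod_eq_zero (Multiset.mem_map.2 ⟨l, hl, hl0⟩), mul_zero]
    by_cases h : ∃ v, (s.map fun l => pair l.1 v).prod ≠ 0
    · have hd : Differentiable ℂ (fun v => (s.map fun l => pair l.1 v).prod) := by
        have := differentiable_linProd (s.map fun l => (l.1, (0 : ℂ)))
        convert this using 2 with v
        simp [linProd, lin]
      rcases eq_zero_or_eq_zero_of_mul_eq_zero (by fun_prop : Differentiable ℂ fun v => F (z + v))
        hd hP with h' | h'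
      · obtain ⟨w, hw⟩ := hne
        exact hw (by simpa using h' (w - z))
      · obtain ⟨v, hv⟩ := h
        exact hv (h' v)
    · push Not at h
      obtain ⟨l, hl, hl0⟩ := exists_factor_eq_zero s (φ := fun l v => pair l.1 v)
        (fun l => differentiable_pair l.1) h
      obtain ⟨v, hv⟩ := exists_pair_eq_one (hs l hl)
      rw [hl0] at hv
      exact zero_ne_one hv
  have hφ := differentiable_comp_line hF z v
  have hiso : ∀ᶠ t in 𝓝[≠] (0 : ℂ), F (z + t • v) ≠ 0 := by
    by_contra hcon
    have := congrFun (AnalyticOnNhd.eq_of_frequently_eq (g := fun _ => (0 : ℂ)) (z₀ := 0)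
      (fun s _ => hφ.analyticAt s) analyticOnNhd_const
      ((not_eventually.1 hcon).mono fun t ht => not_not.1 ht)) 1
    exact hFv (by simpa using this)
  have hUt : ∀ᶠ t in 𝓝 (0 : ℂ), U ∈ 𝓝 (z + t • v) := by
    have hc : Tendsto (fun t : ℂ => z + t • v) (𝓝 0) (𝓝 z) := by
      have : Continuous (fun t : ℂ => z + t • v) := by fun_prop
      simpa using this.tendsto 0
    exact hc.eventually (eventually_mem_nhds_iff.2 hU)
  rw [eventually_nhdsWithin_iff] at hiso
  obtain ⟨r, hr, hball⟩ := Metric.nhds_basis_closedBall.eventually_iff.1 (hiso.and hUt)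
  have hsph : ∀ t ∈ Metric.sphere (0 : ℂ) r, F (z + t • v) ≠ 0 := fun t ht =>
    (hball (Metric.sphere_subset_closedBall ht)).1 (by
      rintro rfl
      simp at ht
      exact hr.ne ht)
  obtain ⟨ε, hε, hεs⟩ : ∃ ε > 0, ∀ t ∈ Metric.sphere (0 : ℂ) r, ε < ‖F (z + t • v)‖ := by
    obtain ⟨t₀, ht₀, hmin⟩ := (isCompact_sphere (0 : ℂ) r).exists_isMinOn
      (NormedSpace.sphere_nonempty.2 hr.le) hφ.continuous.norm.continuousOn
    refine ⟨‖F (z + t₀ • v)‖ / 2, by have := norm_pos_iff.2 (hsph t₀ ht₀); positivity, fun t ht => ?_⟩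
    have h1 := hmin ht
    have h2 := norm_pos_iff.2 (hsph t₀ ht₀)
    simp only [Set.mem_ofPred_eq] at h1
    linarith
  have hjc : Continuous (fun q : Cn n × ℂ => ‖F (q.1 + q.2 • v) - F q.1‖) := by
    have := hF.continuous
    fun_prop
  have ev1 : ∀ᶠ w in 𝓝 z, ∀ t ∈ Metric.sphere (0 : ℂ) r, ε < ‖F (w + t • v) - F w‖ := by
    refine (isCompact_sphere (0 : ℂ) r).eventually_forall_of_forall_eventually fun t ht => ?_
    refine (hjc.tendsto (z, t)).eventually (lt_mem_nhds ?_)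
    simpa [hz] using hεs t ht
  have ev2 : ∀ᶠ w in 𝓝 z, ∀ t ∈ Metric.closedBall (0 : ℂ) r, w + t • v ∈ U := by
    refine (isCompact_closedBall (0 : ℂ) r).eventually_forall_of_forall_eventually fun t ht => ?_
    have : Continuous (fun q : Cn n × ℂ => q.1 + q.2 • v) := by fun_prop
    exact (this.tendsto (z, t)).eventually (hball ht).2
  have ev3 : ∀ᶠ w in 𝓝 z, ‖F w‖ < ε / 2 :=
    hF.continuous.norm.continuousAt.eventually (gt_mem_nhds (by simpa [hz] using hε))
  -- For `w` near `z`, a zero of `F` persists on the line through `w` in direction `v`. It lies on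
  -- some plane of `s`, so it is the projection of `w` to that plane, and the product vanishes.
  have ev : ∀ᶠ w in 𝓝 z, (s.map fun l => F (planeProj l v w)).prod = 0 := by
    filter_upwards [ev1, ev2, ev3] with w h1 h2 h3
    have hψ := differentiable_comp_line hF w v
    have hfreq : ∃ᶠ t in 𝓝 (0 : ℂ), F (w + t • v) ≠ F (w + (0 : ℂ) • v) := by
      intro hcon
      have hev : ∀ᶠ t in 𝓝 (0 : ℂ), F (w + t • v) = F (w + (0 : ℂ) • v) := by
        simpa using hcon
      have hconst := congrFun (AnalyticOnNhd.eq_of_eventuallyEq (z₀ := 0)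
        (g := fun _ => F (w + (0 : ℂ) • v))
        (fun s _ => hψ.analyticAt s) analyticOnNhd_const hev)
      obtain ⟨t, ht⟩ := (NormedSpace.sphere_nonempty (x := (0 : ℂ)).2 hr.le)
      have := h1 t ht
      rw [hconst t] at this
      simp at this
      exact absurd this hε.not_gt
    -- Quantitative open mapping: the image of the disc contains the ball of radius `ε / 2` about
    -- `F(w)`, and `|F(w)| < ε / 2` puts `0` into it.
    have := hψ.diffContOnCl.ball_subset_image_closedBall (ε := ε) hr
      (fun t ht => by simpa using (h1 t ht).le) hfreq
    obtain ⟨t, ht, hFt⟩ := this (by simpa using h3 : (0 : ℂ) ∈ _)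
    obtain ⟨l, hl, hl0⟩ := linProd_eq_zero_iff.1 (hsub _ (h2 t ht) hFt)
    refine Multiset.prod_eq_zero (Multiset.mem_map.2 ⟨l, hl, ?_⟩)
    rw [lin_add, pair_smul] at hl0
    have : planeProj l v w = w + t • v := by
      rw [planeProj, sub_eq_add_neg, ← neg_smul]
      congr 2
      field_simp [hsv l hl]
      linear_combination -hl0
    rw [this]
    exact hFt
  have hall : ∀ w, (s.map fun l => F (planeProj l v w)).prod = 0 := by
    have hd : Differentiable ℂ (fun w => (s.map fun l => F (planeProj l v w)).prod) := by
      clear ev ev1 ev2 hsub hs hsv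
      induction s using Multiset.induction_on with
      | empty => simp
      | cons i s ih =>
        simp only [Multiset.map_cons, Multiset.prod_cons]
        exact (hF.comp (differentiable_planeProj i v)).mul ih
    by_contra! hcon
    obtain ⟨w, hw, hw'⟩ := (dense_ne_zero hd hcon).inter_nhds_nonempty ev
    exact hw hw'
  obtain ⟨l, hl, hl0⟩ := exists_factor_eq_zero s
    (fun l => hF.comp (differentiable_planeProj l v)) hall
  exact ⟨l, hl, fun w hw => by simpa [planeProj_of_mem v hw] using hl0 w⟩

/-- Among the factorizations by planes meeting the ball, one with the most factors is taken;
`exists_card_le` bounds their number. Its cofactor vanishes on no whole plane meeting the ball.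
Hence on each plane of zeros of `F` through the ball the affine product vanishes identically, and
any zero of the cofactor in the ball would lie on a plane of `s`; `exists_plane_subset_zeros` then
contradicts maximality. -/
theorem exists_eq_linProd_mul_ne_zero (hF : Differentiable ℂ F) (hne : ∃ w, F w ≠ 0)
    (hplane : HasPlaneZeros F) (ρ : ℝ) :
    ∃ (s : Multiset (Cn n × ℂ)) (F' : Cn n → ℂ), Differentiable ℂ F' ∧
      (∀ z, F z = linProd s z * F' z) ∧ (∀ l ∈ s, l.1 ≠ 0) ∧
      ∀ z ∈ Metric.ball (0 : Cn n) ρ, F' z ≠ 0 := by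
  obtain ⟨z₀, h0⟩ := hne
  obtain ⟨N, hN⟩ := exists_card_le hF h0 ρ
  let P : ℕ → Prop := fun k => ∃ (s : Multiset (Cn n × ℂ)) (F' : Cn n → ℂ), s.card = k ∧
    Differentiable ℂ F' ∧ (∀ z, F z = linProd s z * F' z) ∧
    (∀ l ∈ s, l.1 ≠ 0 ∧ ∃ z ∈ Metric.ball (0 : Cn n) ρ, lin l.1 l.2 z = 0)
  obtain ⟨k, ⟨s, F', hk, hF', hFF', hs⟩, hmax⟩ : ∃ k, P k ∧ ∀ m, P m → m ≤ k := by
    classical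
    have hP0 : P 0 := ⟨0, F, by simp, hF, by simp, by simp⟩
    have hPN : ∀ m, P m → m ≤ N := by
      rintro m ⟨s, F', hk, hF', hFF', hs⟩
      exact hk ▸ hN s F' hF' hFF' hs
    exact ⟨Nat.findGreatest P N, Nat.findGreatest_spec (Nat.zero_le N) hP0,
      fun m hm => Nat.le_findGreatest (hPN m hm) hm⟩
  have hext : ∀ l : Cn n × ℂ, l.1 ≠ 0 → (∃ z ∈ Metric.ball (0 : Cn n) ρ, lin l.1 l.2 z = 0) →
      ¬ ∀ z, lin l.1 l.2 z = 0 → F' z = 0 := by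
    intro l hl hlz hcon
    obtain ⟨F'', hF'', hFF''⟩ := exists_eq_lin_mul hF' hl hcon
    have := hmax (k + 1) ⟨l ::ₘ s, F'', by simp [hk], hF'', fun z => by
      rw [hFF', hFF'', linProd_cons]; ring, fun l' hl' => by
        rcases Multiset.mem_cons.1 hl' with rfl | hl'
        · exact ⟨hl, hlz⟩
        · exact hs l' hl'⟩
    omega
  refine ⟨s, F', hF', hFF', fun l hl => (hs l hl).1, fun z hz hz0 => ?_⟩
  obtain ⟨A, hA0, hA⟩ := hplane
  have hcover : ∀ w ∈ Metric.ball (0 : Cn n) ρ, F' w = 0 → linProd s w = 0 := by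
    intro w hw hw0
    have hFw : w ∈ {z | F z = 0} := by simp [hFF', hw0]
    rw [hA] at hFw
    simp only [Set.mem_iUnion, exists_prop] at hFw
    obtain ⟨l, hl, hlw⟩ := hFw
    by_contra hne
    obtain ⟨v, hv⟩ := exists_pair_eq_one (hA0 l hl)
    have hv' : pair l.1 v ≠ 0 := by simp [hv]
    have hprod : ∀ z, linProd s (planeProj l v z) * F' (planeProj l v z) = 0 := fun z => by
      rw [← hFF']
      have : planeProj l v z ∈ {z | F z = 0} := by
        rw [hA]
        simp only [Set.mem_iUnion, exists_prop]
        exact ⟨l, hl, lin_planeProj hv' z⟩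
      exact this
    rcases eq_zero_or_eq_zero_of_mul_eq_zero
      ((differentiable_linProd s).comp (differentiable_planeProj l v))
      (hF'.comp (differentiable_planeProj l v)) hprod with h | h
    · exact hne (by simpa [planeProj_of_mem v hlw] using h w)
    · exact hext l (hA0 l hl) ⟨w, hw, hlw⟩ fun z hz => by
        simpa [planeProj_of_mem v hz] using h z
  have hne' : ∃ w, F' w ≠ 0 := ⟨z₀, right_ne_zero_of_mul (hFF' z₀ ▸ h0)⟩
  obtain ⟨l, hl, hl0⟩ := exists_plane_subset_zeros hF' hne' hz0 (fun l hl => (hs l hl).1)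
    (Metric.isOpen_ball.mem_nhds hz) hcover
  exact hext l (hs l hl).1 (hs l hl).2 hl0

theorem zeroMult_linProd_ne_top {s : Multiset (Cn n × ℂ)} (hs : ∀ l ∈ s, l.1 ≠ 0) (z : Cn n) :
    zeroMult (linProd s) z ≠ ⊤ := by
  rw [zeroMult_linProd hs]
  exact ENat.natCast_ne_top _

/-- Two entire functions with the same divisor, one of which has plane zeros, differ by a factor
without zeros. -/
theorem exists_eq_mul_of_zeroMult_eq (hF : Differentiable ℂ F) (hG : Differentiable ℂ G)
    (hne : ∃ w, F w ≠ 0) (hplane : HasPlaneZeros F) (hFG : ∀ z, zeroMult F z = zeroMult G z) :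
    ∃ h : Cn n → ℂ, Differentiable ℂ h ∧ (∀ z, h z ≠ 0) ∧ ∀ z, G z = F z * h z := by
  -- On the ball of radius `|w| + 1` the same affine product is split off both functions, and both
  -- cofactors are free of zeros there.
  have hex : ∀ w : Cn n, ∃ (s : Multiset (Cn n × ℂ)) (F' G' : Cn n → ℂ), Differentiable ℂ F' ∧
      Differentiable ℂ G' ∧ (∀ z, F z = linProd s z * F' z) ∧ (∀ z, G z = linProd s z * G' z) ∧
      ∀ z ∈ Metric.ball (0 : Cn n) (‖w‖ + 1), F' z ≠ 0 ∧ G' z ≠ 0 := by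
    intro w
    obtain ⟨s, F', hF', hFF', hs, hF0⟩ := exists_eq_linProd_mul_ne_zero hF hne hplane (‖w‖ + 1)
    have hle : ∀ z, zeroMult F z = zeroMult (linProd s) z + zeroMult F' z := fun z => by
      rw [show F = fun z => linProd s z * F' z from funext hFF',
        zeroMult_mul (differentiable_linProd s) hF']
    obtain ⟨G', hG', hGG'⟩ := exists_eq_linProd_mul hs hG fun z => by
      rw [← hFG, hle]; exact le_self_add
    refine ⟨s, F', G', hF', hG', hFF', hGG', fun z hz => ⟨hF0 z hz, ?_⟩⟩
    have hGle : zeroMult G z = zeroMult (linProd s) z + zeroMult G' z := by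
      rw [show G = fun z => linProd s z * G' z from funext hGG',
        zeroMult_mul (differentiable_linProd s) hG']
    rw [← hFG, hle] at hGle
    rw [← zeroMult_eq_zero_iff,
      ← ENat.add_right_injective_of_ne_top (zeroMult_linProd_ne_top hs z) hGle]
    exact zeroMult_eq_zero_iff.2 (hF0 z hz)
  choose s A B hA hB hFA hGB hAB using hex
  have hmem : ∀ w : Cn n, w ∈ Metric.ball (0 : Cn n) (‖w‖ + 1) := fun w => by simp
  have hcross : ∀ w w' z, B w z * A w' z = B w' z * A w z := by
    intro w w'
    have h1 : ∀ z, (B w z * A w' z - B w' z * A w z) * (linProd (s w) z * linProd (s w') z) = 0 := by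
      intro z
      have h1 := hFA w z
      have h2 := hFA w' z
      have h3 := hGB w z
      have h4 := hGB w' z
      have e1 : B w z * A w' z * (linProd (s w) z * linProd (s w') z) = G z * F z := by
        rw [h3, h2]; ring
      have e2 : B w' z * A w z * (linProd (s w) z * linProd (s w') z) = G z * F z := by
        rw [h4, h1]; ring
      rw [sub_mul, e1, e2, sub_self]
    obtain ⟨z₀, hz₀⟩ := hne
    rcases eq_zero_or_eq_zero_of_mul_eq_zero (((hB w).mul (hA w')).sub ((hB w').mul (hA w)))
      ((differentiable_linProd _).mul (differentiable_linProd _)) h1 with h | h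
    · exact fun z => sub_eq_zero.1 (h z)
    · rcases mul_eq_zero.1 (h z₀) with h | h
      · exact absurd (by rw [hFA w, h, zero_mul]) hz₀
      · exact absurd (by rw [hFA w', h, zero_mul]) hz₀
  -- The value at `w` comes from the factorization chosen for `w`; `hcross` shows that near `w` any
  -- one choice may be used, so the quotient is holomorphic.
  refine ⟨fun w => B w w / A w w, fun w => ?_, fun w => div_ne_zero (hAB w w (hmem w)).2
    (hAB w w (hmem w)).1, fun w => ?_⟩
  · have hloc : (fun z => B z z / A z z) =ᶠ[𝓝 w] fun z => B w z / A w z := by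
      filter_upwards [Metric.isOpen_ball.mem_nhds (hmem w)] with z hz
      rw [div_eq_div_iff (hAB z z (hmem z)).1 (hAB w z hz).1]
      exact hcross z w z
    refine DifferentiableAt.congr_of_eventuallyEq ?_ hloc
    simp only [div_eq_mul_inv]
    exact (hB w w).mul ((hA w w).inv (hAB w w (hmem w)).1)
  · have := (hAB w w (hmem w)).1
    rw [hFA w w, hGB w w]
    field_simp

theorem exists_eq_exp_mul_of_zeroMult_eq (hF : Differentiable ℂ F) (hG : Differentiable ℂ G)
    (hne : ∃ w, F w ≠ 0) (hplane : HasPlaneZeros F) (hFG : ∀ z, zeroMult F z = zeroMult G z) :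
    ∃ h : Cn n → ℂ, Differentiable ℂ h ∧ ∀ z, F z = Complex.exp (h z) * G z := by
  obtain ⟨q, hq, hq0, hGq⟩ := exists_eq_mul_of_zeroMult_eq hF hG hne hplane hFG
  obtain ⟨h, hh, hqh⟩ := exists_exp_eq_of_ne_zero hq hq0
  refine ⟨fun z => -h z, hh.neg, fun z => ?_⟩
  rw [hGq, hqh, mul_comm (F z), ← mul_assoc, ← Complex.exp_add]
  simp

end Factorization

/-! ### Locally uniform infinite products and their multiplicities -/

section Products

variable {n : ℕ} {ι : Type*} {φ : ι → Cn n → ℂ}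

/-- On each ball, the factors differ from `1` by the terms of a convergent series, up to finitely
many factors. -/
def NearOne (φ : ι → Cn n → ℂ) : Prop :=
  ∀ R : ℝ, ∃ u : ι → ℝ, Summable u ∧ ∀ᶠ i in cofinite, ∀ z, ‖z‖ ≤ R → ‖φ i z - 1‖ ≤ u i

theorem NearOne.hasProdLocallyUniformlyOn (h : NearOne φ) (hφ : ∀ i, Differentiable ℂ (φ i)) :
    HasProdLocallyUniformlyOn φ (fun z => ∏' i, φ i z) Set.univ := by
  refine hasProdLocallyUniformlyOn_of_forall_compact isOpen_univ fun K _ hK => ?_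
  obtain ⟨R, hR⟩ := hK.isBounded.exists_norm_le
  obtain ⟨u, hu, hb⟩ := h R
  have := Summable.hasProdUniformlyOn_one_add (f := fun i z => φ i z - 1) hK hu
    (hb.mono fun i hi z hz => hi z (hR z hz)) fun i => ((hφ i).continuous.sub continuous_const).continuousOn
  simpa using this

theorem NearOne.summable (h : NearOne φ) (z : Cn n) : Summable fun i => ‖φ i z - 1‖ := by
  obtain ⟨u, hu, hb⟩ := h ‖z‖
  refine Summable.of_norm_bounded_eventually hu ?_
  filter_upwards [hb] with i hi
  simpa using hi z le_rfl

theorem NearOne.multipliable (h : NearOne φ) (z : Cn n) : Multipliable fun i => φ i z := by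
  simpa using multipliable_one_add_of_summable (h.summable z)

theorem NearOne.differentiable_tprod (h : NearOne φ) (hφ : ∀ i, Differentiable ℂ (φ i)) :
    Differentiable ℂ (fun z => ∏' i, φ i z) := by
  have h1 := hasProdLocallyUniformlyOn_iff_tendstoLocallyUniformlyOn.1
    (h.hasProdLocallyUniformlyOn hφ)
  rw [tendstoLocallyUniformlyOn_univ] at h1
  exact differentiable_of_tendstoLocallyUniformly
    (fun s => differentiable_finsetProd s fun i _ => hφ i) h1

theorem NearOne.finite_zeros (h : NearOne φ) (z : Cn n) : {i | φ i z = 0}.Finite := by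
  have := (h.summable z).tendsto_cofinite_zero.eventually (gt_mem_nhds one_pos)
  refine (Filter.eventually_cofinite.1 this).subset fun i (hi : φ i z = 0) => ?_
  simp [hi]

/-- The factors in `s` are split off and replaced by `1`, which keeps the product convergent. The
remaining product has no zero factor at `z` and is therefore nonzero there. -/
theorem NearOne.zeroMult_tprod (h : NearOne φ) (hφ : ∀ i, Differentiable ℂ (φ i)) {z : Cn n}
    {s : Finset ι} (hs : ∀ i ∉ s, φ i z ≠ 0) :
    zeroMult (fun z => ∏' i, φ i z) z = ∑ i ∈ s, zeroMult (φ i) z := by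
  classical
  let ψ : ι → Cn n → ℂ := fun i z => if i ∈ s then 1 else φ i z
  have hψd : ∀ i, Differentiable ℂ (ψ i) := fun i => by
    by_cases hi : i ∈ s
    · simp only [ψ, hi, if_true]; exact differentiable_const 1
    · simp only [ψ, hi, if_false]; exact hφ i
  have hψ : NearOne ψ := fun R => by
    obtain ⟨u, hu, hb⟩ := h R
    refine ⟨u, hu, ?_⟩
    filter_upwards [hb, s.eventually_cofinite_notMem] with i hi his z hz
    simpa [ψ, his] using hi z hz
  have hsplit : ∀ w, ∏' i, φ i w = (∏ i ∈ s, φ i w) * ∏' i, ψ i w := fun w => by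
    have h1 : ∏' i, (if i ∈ s then φ i w else 1) = ∏ i ∈ s, φ i w := by
      rw [tprod_eq_prod (s := s) fun i hi => if_neg hi]
      exact Finset.prod_congr rfl fun i hi => if_pos hi
    rw [← h1, ← Multipliable.tprod_mul (multipliable_of_ne_finset_one (s := s) fun i hi => if_neg hi)
        (hψ.multipliable w)]
    refine tprod_congr fun i => ?_
    by_cases hi : i ∈ s <;> simp [ψ, hi]
  have hne : ∏' i, ψ i z ≠ 0 := by
    have := tprod_one_add_ne_zero_of_summable (f := fun i => ψ i z - 1) (fun i => ?_) (hψ.summable z)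
    · simpa using this
    · by_cases hi : i ∈ s
      · simp [ψ, hi]
      · simpa [ψ, hi] using hs i hi
  rw [show (fun z => ∏' i, φ i z) = fun w => (∏ i ∈ s, φ i w) * ∏' i, ψ i w from funext hsplit,
    zeroMult_mul (differentiable_finsetProd s fun i _ => hφ i) (hψ.differentiable_tprod hψd),
    zeroMult_prod s (fun i _ => hφ i), zeroMult_eq_zero_iff.2 hne, add_zero]

end Products

/-! ### Elementary factors and sine factors -/

section Factors

/-- The elementary factor `E_d(u) = (1 - u) exp (u + u² / 2 + ⋯ + u^d / d)`. -/
def elemFactor (d : ℕ) (u : ℂ) : ℂ := (1 - u) * Complex.exp (∑ r ∈ Finset.Icc 1 d, u ^ r / r)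

theorem one_sub_mul_sum_pow {R : Type*} [CommRing R] (d : ℕ) (u : R) :
    (1 - u) * ∑ r ∈ Finset.Icc 1 d, u ^ (r - 1) = 1 - u ^ d := by
  induction d with
  | zero => simp
  | succ d ih =>
    rw [Finset.sum_Icc_succ_top (by omega), mul_add, ih, Nat.add_sub_cancel]
    ring

/-- The geometric sum `(1 - u) ∑ u^(r-1) = 1 - u^d` cancels the term `-1` coming from `1 - u`. -/
theorem hasDerivAt_elemFactor (d : ℕ) (u : ℂ) :
    HasDerivAt (elemFactor d) (-(u ^ d * Complex.exp (∑ r ∈ Finset.Icc 1 d, u ^ r / r))) u := by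
  have hS : HasDerivAt (fun u : ℂ => ∑ r ∈ Finset.Icc 1 d, u ^ r / r)
      (∑ r ∈ Finset.Icc 1 d, u ^ (r - 1)) u := by
    refine HasDerivAt.fun_sum fun r hr => ?_
    have hr0 : (r : ℂ) ≠ 0 := by
      have := (Finset.mem_Icc.1 hr).1
      exact_mod_cast (by omega : r ≠ 0)
    have := (hasDerivAt_pow r u).div_const (r : ℂ)
    rwa [mul_div_cancel_left₀ _ hr0] at this
  have := ((hasDerivAt_id u).const_sub 1).mul hS.cexp
  refine this.congr_deriv ?_
  simp only [id]
  linear_combination (Complex.exp (∑ r ∈ Finset.Icc 1 d, u ^ r / r)) * one_sub_mul_sum_pow d u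

theorem hasDerivAt_elemFactor_real (d : ℕ) (t : ℝ) :
    HasDerivAt (fun t : ℝ => (1 - t) * Real.exp (∑ r ∈ Finset.Icc 1 d, t ^ r / r))
      (-(t ^ d * Real.exp (∑ r ∈ Finset.Icc 1 d, t ^ r / r))) t := by
  have hS : HasDerivAt (fun u : ℝ => ∑ r ∈ Finset.Icc 1 d, u ^ r / r)
      (∑ r ∈ Finset.Icc 1 d, t ^ (r - 1)) t := by
    refine HasDerivAt.fun_sum fun r hr => ?_
    have hr0 : (r : ℝ) ≠ 0 := by
      have := (Finset.mem_Icc.1 hr).1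
      exact_mod_cast (by omega : r ≠ 0)
    have := (hasDerivAt_pow r t).div_const (r : ℝ)
    rwa [mul_div_cancel_left₀ _ hr0] at this
  have := ((hasDerivAt_id t).const_sub 1).mul hS.exp
  refine this.congr_deriv ?_
  simp only [id]
  linear_combination (Real.exp (∑ r ∈ Finset.Icc 1 d, t ^ r / r)) * one_sub_mul_sum_pow d t

/-- On `0 ≤ t ≤ 1` the derivative of `E_d(tu) - 1` is dominated by that of `|u|^(d+1) (1 - E_d(t))`,
and both vanish at `t = 0`. At `t = 1` the majorant is `|u|^(d+1)`, since `E_d(1) = 0`. -/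
theorem norm_elemFactor_sub_one_le (d : ℕ) {u : ℂ} (hu : ‖u‖ ≤ 1) :
    ‖elemFactor d u - 1‖ ≤ ‖u‖ ^ (d + 1) := by
  have hf : ∀ t : ℝ, HasDerivAt (fun t : ℝ => elemFactor d (t * u) - 1)
      (-((t * u) ^ d * Complex.exp (∑ r ∈ Finset.Icc 1 d, (t * u) ^ r / r)) * u) t := fun t => by
    have h1 : HasDerivAt (fun t : ℂ => t * u) u (t : ℂ) := by
      simpa using (hasDerivAt_id (t : ℂ)).mul_const u
    exact (((hasDerivAt_elemFactor d _).comp (t : ℂ) h1).comp_ofReal).sub_const 1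
  have hB : ∀ t : ℝ, HasDerivAt
      (fun t : ℝ => ‖u‖ ^ (d + 1) * (1 - (1 - t) * Real.exp (∑ r ∈ Finset.Icc 1 d, t ^ r / r)))
      (‖u‖ ^ (d + 1) * (t ^ d * Real.exp (∑ r ∈ Finset.Icc 1 d, t ^ r / r))) t := fun t => by
    simpa using ((hasDerivAt_elemFactor_real d t).const_sub 1).const_mul (‖u‖ ^ (d + 1))
  have hsum0 : ∑ r ∈ Finset.Icc 1 d, (0 : ℂ) ^ r / r = 0 := Finset.sum_eq_zero fun r hr => by
    have := (Finset.mem_Icc.1 hr).1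
    rw [zero_pow (by omega), zero_div]
  have hsum0' : ∑ r ∈ Finset.Icc 1 d, (0 : ℝ) ^ r / r = 0 := Finset.sum_eq_zero fun r hr => by
    have := (Finset.mem_Icc.1 hr).1
    rw [zero_pow (by omega), zero_div]
  have := image_norm_le_of_norm_deriv_right_le_deriv_boundary (a := 0) (b := 1)
    (fun t _ => (hf t).continuousAt.continuousWithinAt) (fun t _ => (hf t).hasDerivWithinAt)
    (by simp [elemFactor, hsum0, hsum0']) hB ?_ (x := 1) (by simp)
  · simpa using this
  · intro t ht
    have ht0 : 0 ≤ t := ht.1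
    rw [norm_mul, norm_neg, norm_mul, norm_pow, norm_mul, Complex.norm_real, Real.norm_of_nonneg ht0,
      Complex.norm_exp]
    have hle : (∑ r ∈ Finset.Icc 1 d, ((t : ℂ) * u) ^ r / r).re ≤ ∑ r ∈ Finset.Icc 1 d, t ^ r / r := by
      refine (Complex.re_le_norm _).trans ((norm_sum_le _ _).trans (Finset.sum_le_sum fun r _ => ?_))
      rw [norm_div, norm_pow, norm_mul, Complex.norm_real, Real.norm_of_nonneg ht0,
        Complex.norm_natCast]
      gcongr
      exact mul_le_of_le_one_right ht0 hu
    calc (t * ‖u‖) ^ d * Real.exp _ * ‖u‖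
        ≤ (t * ‖u‖) ^ d * Real.exp (∑ r ∈ Finset.Icc 1 d, t ^ r / r) * ‖u‖ := by gcongr
      _ = _ := by rw [mul_pow]; ring

theorem sineFactor_eq {s : ℝ} (hs : s = 1 ∨ s = -1) (x : ℂ) :
    sineFactor s x = 1 - Complex.exp (2 * Real.pi * Complex.I * s * x) := by
  have h1 : Complex.exp (2 * Real.pi * Complex.I * s * x) =
      Complex.exp (Complex.I * s * Real.pi * x) * Complex.exp (Complex.I * s * Real.pi * x) := by
    rw [← Complex.exp_add]; congr 1; ring
  have h2 : Complex.exp (-(Real.pi * x) * Complex.I) * Complex.exp ((Real.pi * x) * Complex.I) = 1 := by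
    rw [← Complex.exp_add]; simp
  rw [h1, sineFactor, Complex.sin]
  set A := Complex.exp (-(Real.pi * x) * Complex.I) with hA
  set B := Complex.exp ((Real.pi * x) * Complex.I) with hB
  rcases hs with rfl | rfl
  · have : Complex.I * ((1 : ℝ) : ℂ) * Real.pi * x = (Real.pi * x) * Complex.I := by push_cast; ring
    rw [this, ← hB]
    push_cast
    linear_combination h2 - (A * B - B ^ 2) * Complex.I_sq
  · have : Complex.I * ((-1 : ℝ) : ℂ) * Real.pi * x = -(Real.pi * x) * Complex.I := by
      push_cast; ring
    rw [this, ← hA]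
    push_cast
    linear_combination h2 + (A ^ 2 - A * B) * Complex.I_sq

theorem sineFactor_eq_zero_iff {s : ℝ} (hs : s = 1 ∨ s = -1) {x : ℂ} :
    sineFactor s x = 0 ↔ ∃ m : ℤ, x = m := by
  have hpi : (Real.pi : ℂ) ≠ 0 := by exact_mod_cast Real.pi_ne_zero
  have hs0 : (s : ℂ) ≠ 0 := by rcases hs with rfl | rfl <;> simp
  simp only [sineFactor, mul_eq_zero, Complex.exp_ne_zero, or_false, Complex.I_ne_zero, hs0,
    Complex.sin_eq_zero_iff, neg_eq_zero, OfNat.ofNat_ne_zero, false_or]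
  refine exists_congr fun m => ?_
  rw [mul_comm (m : ℂ), mul_right_inj' hpi]

theorem differentiable_sineFactor (s : ℝ) : Differentiable ℂ (sineFactor s) := by
  unfold sineFactor; fun_prop

theorem deriv_sineFactor_ne_zero {s : ℝ} (hs : s = 1 ∨ s = -1) (x : ℂ) :
    deriv (sineFactor s) x ≠ 0 := by
  have : sineFactor s = fun x => 1 - Complex.exp (2 * Real.pi * Complex.I * s * x) :=
    funext (sineFactor_eq hs)
  have hd : HasDerivAt (fun x => 1 - Complex.exp (2 * Real.pi * Complex.I * s * x))
      (-(Complex.exp (2 * Real.pi * Complex.I * s * x) * (2 * Real.pi * Complex.I * s))) x := by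
    simpa using (((hasDerivAt_id x).const_mul (2 * Real.pi * Complex.I * s)).cexp).const_sub 1
  rw [this, hd.deriv]
  have hpi : (Real.pi : ℂ) ≠ 0 := by exact_mod_cast Real.pi_ne_zero
  have hs0 : (s : ℂ) ≠ 0 := by rcases hs with rfl | rfl <;> simp
  simp [hpi, hs0, Complex.exp_ne_zero]

open Classical in
theorem zeroMult_sineFactor_lin {n : ℕ} {s : ℝ} (hs : s = 1 ∨ s = -1) {a : Cn n} (ha : a ≠ 0)
    (c : ℂ) (z : Cn n) :
    zeroMult (fun w => sineFactor s (lin a c w)) z = if ∃ m : ℤ, lin a c z = m then 1 else 0 := by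
  split_ifs with h
  · exact zeroMult_comp_lin (differentiable_sineFactor s) ha ((sineFactor_eq_zero_iff hs).2 h)
      (deriv_sineFactor_ne_zero hs _)
  · exact zeroMult_eq_zero_iff.2 fun h0 => h ((sineFactor_eq_zero_iff hs).1 h0)

theorem sineFactor_add_int {s : ℝ} (hs : s = 1 ∨ s = -1) (x : ℂ) (m : ℤ) :
    sineFactor s (x + m) = sineFactor s x := by
  rw [sineFactor_eq hs, sineFactor_eq hs]
  congr 1
  rw [Complex.exp_eq_exp_iff_exists_int]
  rcases hs with rfl | rfl
  · exact ⟨m, by push_cast; ring⟩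
  · exact ⟨-m, by push_cast; ring⟩

end Factors

/-! ### The first family and the product `F₁` -/

section FirstFamily

variable {n : ℕ}

theorem mem_repro_iff {a : Cn n} {c : ℂ} {z : Cn n} : z ∈ repro a c ↔ lin a c z ∈ periodSet a := by
  simp only [repro, Set.mem_iUnion, Set.mem_ofPred_eq, periodSet, lin_sub, sub_eq_zero]

theorem zeroMult_mul_exp {f g : Cn n → ℂ} (hf : Differentiable ℂ f) (hg : Differentiable ℂ g)
    (z : Cn n) : zeroMult (fun w => f w * Complex.exp (g w)) z = zeroMult f z := by
  rw [zeroMult_mul hf hg.cexp,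
    (zeroMult_eq_zero_iff (f := fun w => Complex.exp (g w))).2 (Complex.exp_ne_zero _), add_zero]

theorem norm_pair_le_mul (a z : Cn n) : ‖pair a z‖ ≤ ‖a‖ * ‖z‖ := by
  rw [EuclideanSpace.norm_eq, EuclideanSpace.norm_eq]
  refine (norm_sum_le _ _).trans ?_
  simp only [norm_mul]
  exact Real.sum_mul_le_sqrt_mul_sqrt _ _ _

theorem sgn_eq_or (x : ℝ) : sgn x = 1 ∨ sgn x = -1 := by
  unfold sgn; split_ifs <;> simp

theorem sgn_mul_self (x : ℝ) : sgn x * x = |x| := by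
  unfold sgn; split_ifs with h
  · rw [one_mul, abs_of_nonneg h]
  · rw [abs_of_neg (not_le.1 h), neg_one_mul]

theorem pair_intVec (k m : Fin n → ℤ) :
    pair (intVec k) (intVec m) = ((∑ p, k p * m p : ℤ) : ℂ) := by
  simp [pair, intVec]

theorem exists_sum_mul_eq_one {k : Fin n → ℤ} (hk : Finset.univ.gcd k = 1) :
    ∃ m : Fin n → ℤ, ∑ p, k p * m p = 1 := by
  obtain ⟨m, hm⟩ := Finset.gcd_eq_sum_mul Finset.univ k
  exact ⟨m, by rw [← hk, hm]⟩

theorem one_le_norm_intVec {k : Fin n → ℤ} (hk : Finset.univ.gcd k = 1) : 1 ≤ ‖intVec k‖ := by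
  obtain ⟨p, hp⟩ : ∃ p, k p ≠ 0 := by
    by_contra! h
    have : Finset.univ.gcd k = 0 := Finset.gcd_eq_zero_iff.2 fun p _ => h p
    omega
  refine le_trans ?_ (PiLp.norm_apply_le (intVec k) p)
  simp only [intVec]
  rw [Complex.norm_intCast]
  exact_mod_cast Int.one_le_abs hp

theorem intVec_ne_zero {k : Fin n → ℤ} (hk : Finset.univ.gcd k = 1) : intVec k ≠ 0 := by
  have := one_le_norm_intVec hk
  rw [← norm_pos_iff]
  linarith

namespace Families.Normalization

variable {D : Families n} (N : D.Normalization)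

theorem phi_eq (d : ℕ) (j : Idx D.μ₁) (z : Cn n) :
    N.phi d j z = elemFactor d (Complex.exp (2 * Real.pi * Complex.I * sgn (N.c j).im *
        lin (intVec (N.k j)) (N.c j) z)) := by
  rw [phi, elemFactor, sineFactor_eq (sgn_eq_or _)]

theorem differentiable_phi (d : ℕ) (j : Idx D.μ₁) : Differentiable ℂ (N.phi d j) := by
  have h1 := differentiable_lin (intVec (N.k j)) (N.c j)
  have h2 := (differentiable_sineFactor (sgn (N.c j).im)).comp h1
  refine h2.mul (Differentiable.cexp ?_)
  have h3 : Differentiable ℂ fun u : ℂ => ∑ r ∈ Finset.Icc 1 d, u ^ r / (r : ℂ) := by fun_prop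
  exact h3.comp ((h1.const_mul _).cexp)

theorem norm_exp_lin_le (j : Idx D.μ₁) (z : Cn n) :
    ‖Complex.exp (2 * Real.pi * Complex.I * sgn (N.c j).im * lin (intVec (N.k j)) (N.c j) z)‖ ≤
      Real.exp (-2 * Real.pi * (|(N.c j).im| - ‖intVec (N.k j)‖ * ‖z‖)) := by
  rw [Complex.norm_exp, Real.exp_le_exp]
  have hre : (2 * Real.pi * Complex.I * sgn (N.c j).im * lin (intVec (N.k j)) (N.c j) z).re =
      -2 * Real.pi * (sgn (N.c j).im * (pair (intVec (N.k j)) z).im + |(N.c j).im|) := by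
    rw [show 2 * Real.pi * Complex.I * sgn (N.c j).im * lin (intVec (N.k j)) (N.c j) z =
      ((2 * Real.pi * sgn (N.c j).im : ℝ) : ℂ) * (Complex.I * lin (intVec (N.k j)) (N.c j) z) by
        push_cast; ring, Complex.re_ofReal_mul, Complex.I_mul_re, ← sgn_mul_self (N.c j).im]
    simp only [lin, Complex.add_im]
    ring
  rw [hre]
  have h1 : |sgn (N.c j).im * (pair (intVec (N.k j)) z).im| ≤ ‖intVec (N.k j)‖ * ‖z‖ := by
    rw [abs_mul, show |sgn (N.c j).im| = 1 by rcases sgn_eq_or (N.c j).im with h | h <;> simp [h],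
      one_mul]
    exact (Complex.abs_im_le_norm _).trans (norm_pair_le_mul _ _)
  have h2 := (abs_le.1 h1).1
  have := Real.pi_pos
  nlinarith

/-- The admissibility term is `x^(d_j + 1)`, where `x` bounds the exponential in `φ_j` on the ball
of radius `R`. All but finitely many terms are below `1`; then `x ≤ 1` and the bound for elementary
factors applies. -/
theorem nearOne_phi {d : ℕ → ℕ} (hd : N.Admissible d) :
    NearOne (fun (j : Idx D.μ₁) z => N.phi (d j) j z) := by
  intro R
  refine ⟨_, hd R, ?_⟩
  filter_upwards [(hd R).tendsto_cofinite_zero.eventually (gt_mem_nhds one_pos)] with j hj z hz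
  set x := Real.exp (-2 * Real.pi * (|(N.c j).im| - R * ‖intVec (N.k j)‖)) with hx
  have hpow : Real.exp (-2 * Real.pi * (d j + 1) * (|(N.c j).im| - R * ‖intVec (N.k j)‖)) =
      x ^ (d j + 1) := by
    rw [hx, ← Real.exp_nat_mul]
    congr 1
    push_cast
    ring
  rw [hpow] at hj ⊢
  have hx1 : x ≤ 1 := by
    by_contra h
    exact absurd hj (one_le_pow₀ (not_le.1 h).le).not_gt
  have hle := N.norm_exp_lin_le j z
  have hle' : ‖Complex.exp (2 * Real.pi * Complex.I * sgn (N.c j).im *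
      lin (intVec (N.k j)) (N.c j) z)‖ ≤ x := by
    refine hle.trans (Real.exp_le_exp.2 ?_)
    have h1 : ‖intVec (N.k j)‖ * ‖z‖ ≤ R * ‖intVec (N.k j)‖ := by
      rw [mul_comm]; gcongr
    nlinarith [Real.pi_pos]
  rw [N.phi_eq]
  exact (norm_elemFactor_sub_one_le _ (hle'.trans hx1)).trans (by gcongr)

theorem lin_eq (j : Idx D.μ₁) (z : Cn n) :
    lin (D.a₁ j) (D.c₁ j) z = N.t j * lin (intVec (N.k j)) (N.c j) z := by
  have ht : (N.t j : ℂ) ≠ 0 := by exact_mod_cast N.t_ne j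
  have h : pair (D.a₁ j) z = N.t j * pair (intVec (N.k j)) z := by
    simp only [pair, N.a₁_eq, intVec, Finset.mul_sum, mul_assoc]
  rw [lin, lin, h, c]
  field_simp

/-- By Bézout, coprimality of the coordinates of `k` makes the period group equal to `t ℤ`. -/
theorem mem_repro_iff_int (j : Idx D.μ₁) (z : Cn n) :
    z ∈ repro (D.a₁ j) (D.c₁ j) ↔ ∃ m : ℤ, lin (intVec (N.k j)) (N.c j) z = m := by
  have ht : (N.t j : ℂ) ≠ 0 := by exact_mod_cast N.t_ne j
  rw [mem_repro_iff, N.lin_eq]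
  have hp : ∀ m : Fin n → ℤ, pair (D.a₁ j) (intVec m) = N.t j * ((∑ p, N.k j p * m p : ℤ) : ℂ) := by
    intro m
    rw [← pair_intVec]
    simp only [pair, N.a₁_eq, intVec, Finset.mul_sum, mul_assoc]
  constructor
  · rintro ⟨m, hm⟩
    rw [hp, mul_right_inj' ht] at hm
    exact ⟨_, hm⟩
  · rintro ⟨m, hm⟩
    obtain ⟨e, he⟩ := exists_sum_mul_eq_one (N.primitive j)
    refine ⟨fun p => m * e p, ?_⟩
    rw [hp, hm]
    congr 2
    calc m = m * ∑ p, N.k j p * e p := by rw [he, mul_one]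
      _ = _ := by rw [Finset.mul_sum]; exact Finset.sum_congr rfl fun p _ => by ring

theorem zeroMult_phi (d : ℕ) (j : Idx D.μ₁) (z : Cn n) :
    zeroMult (N.phi d j) z = reproMult (D.a₁ j) (D.c₁ j) z := by
  classical
  have h1 := differentiable_lin (intVec (N.k j)) (N.c j)
  have h2 := (differentiable_sineFactor (sgn (N.c j).im)).comp h1
  have h3 : Differentiable ℂ fun u : ℂ => ∑ r ∈ Finset.Icc 1 d, u ^ r / (r : ℂ) := by fun_prop
  have h4 := h3.comp (h1.const_mul (2 * Real.pi * Complex.I * sgn (N.c j).im)).cexp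
  refine (zeroMult_mul_exp h2 h4 z).trans ?_
  refine (zeroMult_sineFactor_lin (sgn_eq_or _) (intVec_ne_zero (N.primitive j)) _ z).trans ?_
  simp only [reproMult, Set.indicator, N.mem_repro_iff_int]
  split_ifs <;> simp

theorem phi_periodic (d : ℕ) (j : Idx D.μ₁) : IsPeriodic (N.phi d j) := by
  intro p z
  have hl : lin (intVec (N.k j)) (N.c j) (z + unitVec p) =
      lin (intVec (N.k j)) (N.c j) z + (N.k j p : ℂ) := by
    rw [lin_add, pair_unitVec]; rfl
  rw [N.phi_eq, N.phi_eq, hl]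
  congr 1
  rw [Complex.exp_eq_exp_iff_exists_int]
  rcases sgn_eq_or (N.c j).im with h | h
  · exact ⟨N.k j p, by rw [h]; push_cast; ring⟩
  · exact ⟨-N.k j p, by rw [h]; push_cast; ring⟩

theorem hasProd_F₁ {d : ℕ → ℕ} (hd : N.Admissible d) :
    HasProdLocallyUniformlyOn (fun (j : Idx D.μ₁) z => N.phi (d j) j z) (N.F₁ d) Set.univ :=
  (N.nearOne_phi hd).hasProdLocallyUniformlyOn fun j => N.differentiable_phi (d j) j

theorem differentiable_F₁ {d : ℕ → ℕ} (hd : N.Admissible d) : Differentiable ℂ (N.F₁ d) :=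
  (N.nearOne_phi hd).differentiable_tprod fun j => N.differentiable_phi (d j) j

theorem F₁_periodic (d : ℕ → ℕ) : IsPeriodic (N.F₁ d) := fun p z =>
  tprod_congr fun j => N.phi_periodic (d j) j p z

theorem zeroMult_F₁ {d : ℕ → ℕ} (hd : N.Admissible d) {z : Cn n} {m : ℕ}
    (hm : HasSum (fun j : Idx D.μ₁ => reproMult (D.a₁ j) (D.c₁ j) z) m) :
    zeroMult (N.F₁ d) z = m := by
  have hfin := (N.nearOne_phi hd).finite_zeros z
  have h1 := (N.nearOne_phi hd).zeroMult_tprod (fun j => N.differentiable_phi (d j) j)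
    (z := z) (s := hfin.toFinset) (fun j hj => by simpa using hj)
  refine h1.trans ?_
  simp only [N.zeroMult_phi]
  have h2 : HasSum (fun j : Idx D.μ₁ => reproMult (D.a₁ j) (D.c₁ j) z)
      (∑ j ∈ hfin.toFinset, reproMult (D.a₁ j) (D.c₁ j) z) := by
    refine hasSum_sum_of_ne_finset_zero fun j hj => ?_
    have h0 : N.phi (d j) j z ≠ 0 := by simpa using hj
    rw [← zeroMult_eq_zero_iff, N.zeroMult_phi] at h0
    exact_mod_cast h0
  rw [hm.unique h2]
  push_cast
  rfl

/-- The ratio in the growth condition does not change under normalization. Once it exceeds `R + 1`,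
the inequality `|k_j| ≥ 1` gives `|Im c_j| - R |k_j| ≥ 1`, and the terms are dominated by the
geometric series of ratio `e^{-2π}`. -/
theorem admissible_id (hg : D.μ₁ = ⊤ → Tendsto (fun j : ℕ => |(D.c₁ j).im| / ‖D.a₁ j‖) atTop atTop) :
    N.Admissible fun j => j := by
  intro R
  by_cases hμ : D.μ₁ = ⊤
  · have hnorm : ∀ j : Idx D.μ₁, |(D.c₁ j).im| / ‖D.a₁ j‖ = |(N.c j).im| / ‖intVec (N.k j)‖ := by
      intro j
      have ha : D.a₁ j = (N.t j : ℂ) • intVec (N.k j) := by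
        ext p; simp [N.a₁_eq, intVec]
      have hc : D.c₁ j = N.t j * N.c j := by
        have ht : (N.t j : ℂ) ≠ 0 := by exact_mod_cast N.t_ne j
        rw [c]; field_simp
      rw [ha, hc, norm_smul, Complex.im_ofReal_mul, abs_mul, Complex.norm_real, Real.norm_eq_abs,
        mul_div_mul_left _ _ (abs_ne_zero.2 (N.t_ne j))]
    have hinj : Function.Injective (fun j : Idx D.μ₁ => (j : ℕ)) := Subtype.val_injective
    have hq : Summable fun j : Idx D.μ₁ => Real.exp (-2 * Real.pi) ^ (j : ℕ) :=
      (summable_geometric_of_lt_one (Real.exp_pos _).le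
        (Real.exp_lt_one_iff.2 (by linarith [Real.pi_pos]))).comp_injective hinj
    refine Summable.of_norm_bounded_eventually hq ?_
    have hev := hinj.tendsto_cofinite.eventually
      (Nat.cofinite_eq_atTop ▸ (hg hμ).eventually_ge_atTop (R + 1))
    filter_upwards [hev] with j hj
    rw [hnorm j, le_div_iff₀ (by linarith [one_le_norm_intVec (N.primitive j)])] at hj
    rw [Real.norm_of_nonneg (Real.exp_pos _).le, ← Real.exp_nat_mul, Real.exp_le_exp]
    have h1 := one_le_norm_intVec (N.primitive j)
    have h2 : 1 ≤ |(N.c j).im| - R * ‖intVec (N.k j)‖ := by linarith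
    have h3 : (0 : ℝ) ≤ (j : ℕ) := Nat.cast_nonneg _
    have h4 : (j : ℝ) ≤ ((j : ℕ) + 1) * (|(N.c j).im| - R * ‖intVec (N.k j)‖) := by nlinarith
    nlinarith [Real.pi_pos]
  · obtain ⟨m, hm⟩ := ENat.ne_top_iff_exists.1 hμ
    have : Finite (Idx D.μ₁) := by
      refine Set.Finite.to_subtype (s := {j : ℕ | (j : ℕ∞) < D.μ₁}) ((Set.finite_Iio m).subset fun j hj => ?_)
      rw [Set.mem_ofPred_eq, ← hm, Nat.cast_lt] at hj
      exact hj
    exact Summable.of_finite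

end Families.Normalization

end FirstFamily

/-! ### The theta product and its quasi-periodicity -/

section Theta

variable {n : ℕ} {T : ℂ}

/-- The hypothesis `h` says that the shift by `rT` goes into the half-plane where the exponential
with sign `ε` decays. This is why the two halves of the theta product carry opposite signs. -/
theorem norm_sineFactor_sub_one_le {ε : ℝ} (hε : ε = 1 ∨ ε = -1) {x : ℂ} {r : ℝ} {q : ℕ}
    (h : q * |T.im| ≤ ε * r * T.im) :
    ‖sineFactor ε (x + r * T) - 1‖ ≤
      Real.exp (2 * Real.pi * ‖x‖) * Real.exp (-2 * Real.pi * |T.im|) ^ q := by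
  rw [sineFactor_eq hε, sub_sub_cancel_left, norm_neg, Complex.norm_exp, ← Real.exp_nat_mul,
    ← Real.exp_add, Real.exp_le_exp]
  rw [show 2 * Real.pi * Complex.I * ε * (x + r * T) =
    ((2 * Real.pi * ε : ℝ) : ℂ) * (Complex.I * (x + r * T)) by push_cast; ring,
    Complex.re_ofReal_mul, Complex.I_mul_re, Complex.add_im, Complex.im_ofReal_mul]
  have h1 : |ε * x.im| ≤ ‖x‖ := by
    rw [abs_mul, show |ε| = 1 by rcases hε with h | h <;> simp [h], one_mul]
    exact Complex.abs_im_le_norm x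
  have h2 := (abs_le.1 h1).1
  nlinarith [Real.pi_pos]

theorem sign_eq_or (hT : T.im ≠ 0) : Real.sign T.im = 1 ∨ Real.sign T.im = -1 :=
  (Real.sign_apply_eq_of_ne_zero _ hT).symm

theorem neg_sign_eq_or (hT : T.im ≠ 0) : -Real.sign T.im = 1 ∨ -Real.sign T.im = -1 := by
  rcases sign_eq_or hT with h | h <;> simp [h]

theorem sign_mul_self_eq_abs (x : ℝ) : Real.sign x * x = |x| := by
  rcases lt_trichotomy x 0 with h | rfl | h
  · rw [Real.sign_of_neg h, abs_of_neg h, neg_one_mul]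
  · simp
  · rw [Real.sign_of_pos h, abs_of_pos h, one_mul]

theorem norm_theta_factor_neg_le (hT : T.im ≠ 0) (x : ℂ) (q : ℕ) :
    ‖sineFactor (-Real.sign T.im) (x - q * T) - 1‖ ≤
      Real.exp (2 * Real.pi * ‖x‖) * Real.exp (-2 * Real.pi * |T.im|) ^ q := by
  have := norm_sineFactor_sub_one_le (T := T) (neg_sign_eq_or hT) (x := x) (r := -q) (q := q) (by
    rw [← sign_mul_self_eq_abs]; apply le_of_eq; ring)
  simpa [sub_eq_add_neg] using this

theorem norm_theta_factor_pos_le (hT : T.im ≠ 0) (x : ℂ) (q : ℕ) :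
    ‖sineFactor (Real.sign T.im) (x + (q + 1) * T) - 1‖ ≤
      Real.exp (2 * Real.pi * ‖x‖) * Real.exp (-2 * Real.pi * |T.im|) ^ q := by
  have := norm_sineFactor_sub_one_le (T := T) (sign_eq_or hT) (x := x) (r := q + 1) (q := q) (by
    have h1 := sign_mul_self_eq_abs T.im
    have h2 := abs_nonneg T.im
    nlinarith)
  simpa using this

theorem summable_theta_bound (hT : T.im ≠ 0) (C : ℝ) :
    Summable fun q : ℕ => C * Real.exp (-2 * Real.pi * |T.im|) ^ q := by
  refine (summable_geometric_of_lt_one (Real.exp_pos _).le (Real.exp_lt_one_iff.2 ?_)).mul_left C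
  have := abs_pos.2 hT
  nlinarith [Real.pi_pos]

theorem multipliable_theta_neg (hT : T.im ≠ 0) (x : ℂ) :
    Multipliable fun q : ℕ => sineFactor (-Real.sign T.im) (x - q * T) := by
  simpa using multipliable_one_add_of_summable
    (f := fun q : ℕ => sineFactor (-Real.sign T.im) (x - q * T) - 1)
    ((summable_theta_bound hT _).of_nonneg_of_le (fun _ => norm_nonneg _)
      (norm_theta_factor_neg_le hT x))

theorem multipliable_theta_pos (hT : T.im ≠ 0) (x : ℂ) :
    Multipliable fun q : ℕ => sineFactor (Real.sign T.im) (x + (q + 1) * T) := by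
  simpa using multipliable_one_add_of_summable
    (f := fun q : ℕ => sineFactor (Real.sign T.im) (x + (q + 1) * T) - 1)
    ((summable_theta_bound hT _).of_nonneg_of_le (fun _ => norm_nonneg _)
      (norm_theta_factor_pos_le hT x))

theorem norm_lin_le (a : Cn n) (c : ℂ) {z : Cn n} {R : ℝ} (hz : ‖z‖ ≤ R) :
    ‖lin a c z‖ ≤ ‖a‖ * R + ‖c‖ :=
  (norm_add_le _ _).trans (by gcongr; exact (norm_pair_le_mul a z).trans (by gcongr))

theorem nearOne_theta_neg (hT : T.im ≠ 0) (a : Cn n) (c : ℂ) :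
    NearOne fun (q : ℕ) z => sineFactor (-Real.sign T.im) (lin a c z - q * T) := fun R =>
  ⟨_, summable_theta_bound hT (Real.exp (2 * Real.pi * (‖a‖ * R + ‖c‖))),
    Eventually.of_forall fun q z hz => (norm_theta_factor_neg_le hT _ q).trans (by
      have := Real.pi_pos
      gcongr
      exact norm_lin_le a c hz)⟩

theorem nearOne_theta_pos (hT : T.im ≠ 0) (a : Cn n) (c : ℂ) :
    NearOne fun (q : ℕ) z => sineFactor (Real.sign T.im) (lin a c z + (q + 1) * T) := fun R =>
  ⟨_, summable_theta_bound hT (Real.exp (2 * Real.pi * (‖a‖ * R + ‖c‖))),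
    Eventually.of_forall fun q z hz => (norm_theta_factor_pos_le hT _ q).trans (by
      have := Real.pi_pos
      gcongr
      exact norm_lin_le a c hz)⟩

theorem differentiable_theta_factor_neg (T : ℂ) (a : Cn n) (c : ℂ) (q : ℕ) :
    Differentiable ℂ fun z => sineFactor (-Real.sign T.im) (lin a c z - q * T) :=
  (differentiable_sineFactor _).comp ((differentiable_lin a c).sub_const _)

theorem differentiable_theta_factor_pos (T : ℂ) (a : Cn n) (c : ℂ) (q : ℕ) :
    Differentiable ℂ fun z => sineFactor (Real.sign T.im) (lin a c z + (q + 1) * T) :=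
  (differentiable_sineFactor _).comp ((differentiable_lin a c).add_const _)

theorem differentiable_thetaProd_lin (hT : T.im ≠ 0) (a : Cn n) (c : ℂ) :
    Differentiable ℂ fun z => thetaProd T (lin a c z) :=
  ((nearOne_theta_neg hT a c).differentiable_tprod (differentiable_theta_factor_neg T a c)).mul
    ((nearOne_theta_pos hT a c).differentiable_tprod (differentiable_theta_factor_pos T a c))

theorem int_combination_unique (hT : T.im ≠ 0) {r s r' s' : ℤ}
    (h : (r : ℂ) + s * T = r' + s' * T) : s = s' := by
  have := congrArg Complex.im h
  simp at this
  rcases this with h | h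
  · exact h
  · exact absurd h hT

open Classical in
-- As `1` and `T` are independent over `ℝ`, the lattice point `r + sT` is a zero of exactly one
-- factor: the one with `q = s` in the first product if `s ≥ 0`, the one with `q = -s - 1` in the
-- second if `s < 0`.
theorem zeroMult_thetaProd_lin (hT : T.im ≠ 0) {a : Cn n} (ha : a ≠ 0) (c : ℂ) (z : Cn n) :
    zeroMult (fun z => thetaProd T (lin a c z)) z =
      if ∃ r s : ℤ, lin a c z = r + s * T then 1 else 0 := by
  have hneg : ∀ q : ℕ, zeroMult (fun z => sineFactor (-Real.sign T.im) (lin a c z - q * T)) z =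
      if ∃ m : ℤ, lin a c z - q * T = m then 1 else 0 := fun q => by
    have e : ∀ w, lin a c w - q * T = lin a (c - q * T) w := fun w => by simp only [lin]; ring
    simp only [e]
    convert zeroMult_sineFactor_lin (neg_sign_eq_or hT) ha (c - q * T) z
  have hpos : ∀ q : ℕ,
      zeroMult (fun z => sineFactor (Real.sign T.im) (lin a c z + (q + 1) * T)) z =
      if ∃ m : ℤ, lin a c z + (q + 1) * T = m then 1 else 0 := fun q => by
    have e : ∀ w, lin a c w + (q + 1) * T = lin a (c + (q + 1) * T) w := fun w => by
      simp only [lin]; ring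
    simp only [e]
    convert zeroMult_sineFactor_lin (sign_eq_or hT) ha (c + (q + 1) * T) z
  have hP := fun s hs => (nearOne_theta_neg hT a c).zeroMult_tprod (z := z) (s := s)
    (differentiable_theta_factor_neg T a c) hs
  have hQ := fun s hs => (nearOne_theta_pos hT a c).zeroMult_tprod (z := z) (s := s)
    (differentiable_theta_factor_pos T a c) hs
  have hmul := zeroMult_mul
    ((nearOne_theta_neg hT a c).differentiable_tprod (differentiable_theta_factor_neg T a c))
    ((nearOne_theta_pos hT a c).differentiable_tprod (differentiable_theta_factor_pos T a c)) z
  refine hmul.trans ?_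
  simp only [ne_eq, sineFactor_eq_zero_iff (neg_sign_eq_or hT),
    sineFactor_eq_zero_iff (sign_eq_or hT)] at hP hQ
  split_ifs with h
  · obtain ⟨r, s, hrs⟩ := h
    have key1 : ∀ q : ℕ, (∃ m : ℤ, lin a c z - q * T = m) → (q : ℤ) = s := by
      rintro q ⟨m, hm⟩
      refine int_combination_unique hT (r := m) (r' := r) ?_
      rw [← hrs, ← hm]; push_cast; ring
    have key2 : ∀ q : ℕ, (∃ m : ℤ, lin a c z + (q + 1) * T = m) → -(q : ℤ) - 1 = s := by
      rintro q ⟨m, hm⟩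
      refine int_combination_unique hT (r := m) (r' := r) ?_
      rw [← hrs, ← hm]; push_cast; ring
    rcases lt_or_ge s 0 with hs | hs
    · obtain ⟨k, hk⟩ : ∃ k : ℕ, s = -(k : ℤ) - 1 := ⟨(-s - 1).toNat, by omega⟩
      rw [hP ∅ fun q _ hq => by have := key1 q hq; omega,
        hQ {k} fun q hqk hq => hqk (by have := key2 q hq; simp; omega)]
      simp only [Finset.sum_empty, Finset.sum_singleton, zero_add, hpos]
      refine if_pos ⟨r, ?_⟩
      rw [hrs, hk]; push_cast; ring
    · obtain ⟨k, hk⟩ : ∃ k : ℕ, s = k := ⟨s.toNat, by omega⟩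
      rw [hQ ∅ fun q _ hq => by have := key2 q hq; omega,
        hP {k} fun q hqk hq => hqk (by have := key1 q hq; simp; omega)]
      simp only [Finset.sum_empty, Finset.sum_singleton, add_zero, hneg]
      refine if_pos ⟨r, ?_⟩
      rw [hrs, hk]; push_cast; ring
  · rw [hP ∅, hQ ∅]
    · simp
    · rintro q - ⟨m, hm⟩
      exact h ⟨m, -(q + 1), by rw [← hm]; push_cast; ring⟩
    · rintro q - ⟨m, hm⟩
      exact h ⟨m, q, by rw [← hm]; push_cast; ring⟩

theorem thetaProd_add_int (hT : T.im ≠ 0) (w : ℂ) (m : ℤ) :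
    thetaProd T (w + m) = thetaProd T w := by
  unfold thetaProd
  congr 1
  · refine tprod_congr fun q => ?_
    rw [add_sub_right_comm, sineFactor_add_int (neg_sign_eq_or hT)]
  · refine tprod_congr fun q => ?_
    rw [add_right_comm, sineFactor_add_int (sign_eq_or hT)]

theorem sineFactor_neg_eq {s : ℝ} (hs : s = 1 ∨ s = -1) (x : ℂ) :
    sineFactor (-s) x =
      Complex.exp (-2 * Real.pi * Complex.I * s * x + Real.pi * Complex.I) * sineFactor s x := by
  rw [sineFactor_eq hs, sineFactor_eq (by rcases hs with h | h <;> simp [h]), Complex.exp_add,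
    Complex.exp_pi_mul_I]
  have h : Complex.exp (-2 * Real.pi * Complex.I * s * x) *
      Complex.exp (2 * Real.pi * Complex.I * s * x) = 1 := by
    rw [← Complex.exp_add]; ring_nf; simp
  rw [show 2 * Real.pi * Complex.I * ((-s : ℝ) : ℂ) * x = -2 * Real.pi * Complex.I * s * x by
    push_cast; ring]
  linear_combination -h

/-- The shift by `T` moves one factor, at `w + T`, from the second product to the first and reverses
its sign parameter; `sineFactor_neg_eq` gives the resulting quotient. -/
theorem thetaProd_add_self (hT : T.im ≠ 0) (w : ℂ) :
    thetaProd T (w + T) = Complex.exp (-2 * Real.pi * Complex.I * Real.sign T.im * (w + T) +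
      Real.pi * Complex.I) * thetaProd T w := by
  have h1 : ∏' q : ℕ, sineFactor (-Real.sign T.im) (w + T - q * T) =
      sineFactor (-Real.sign T.im) (w + T) * ∏' q : ℕ, sineFactor (-Real.sign T.im) (w - q * T) := by
    have e : ∀ q : ℕ, sineFactor (-Real.sign T.im) (w + T - ((q + 1 : ℕ) : ℂ) * T) =
        sineFactor (-Real.sign T.im) (w - q * T) := fun q => by
      congr 1; push_cast; ring
    have := tprod_eq_zero_mul'
      (f := fun q : ℕ => sineFactor (-Real.sign T.im) (w + T - q * T))
      (by simp only [e]; exact multipliable_theta_neg hT w)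
    simpa only [e, Nat.cast_zero, zero_mul, sub_zero] using this
  have h2 : ∏' q : ℕ, sineFactor (Real.sign T.im) (w + (q + 1) * T) =
      sineFactor (Real.sign T.im) (w + T) *
        ∏' q : ℕ, sineFactor (Real.sign T.im) (w + T + (q + 1) * T) := by
    have e : ∀ q : ℕ, sineFactor (Real.sign T.im) (w + (((q + 1 : ℕ) : ℂ) + 1) * T) =
        sineFactor (Real.sign T.im) (w + T + (q + 1) * T) := fun q => by
      congr 1; push_cast; ring
    have := tprod_eq_zero_mul'
      (f := fun q : ℕ => sineFactor (Real.sign T.im) (w + (q + 1) * T))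
      (by simp only [e]; exact multipliable_theta_pos hT (w + T))
    simpa only [e, Nat.cast_zero, zero_add, one_mul] using this
  unfold thetaProd
  rw [h1, h2, sineFactor_neg_eq (sign_eq_or hT)]
  ring

theorem thetaProd_add_int_mul (hT : T.im ≠ 0) (w : ℂ) (m : ℤ) :
    thetaProd T (w + m * T) = Complex.exp (-2 * Real.pi * Complex.I * Real.sign T.im *
      (m * w + m * (m + 1) / 2 * T) + Real.pi * Complex.I * m) * thetaProd T w := by
  induction m using Int.induction_on with
  | zero => simp
  | succ m ih =>
    rw [show w + ((m + 1 : ℤ) : ℂ) * T = w + (m : ℤ) * T + T by push_cast; ring,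
      thetaProd_add_self hT, ih, ← mul_assoc, ← Complex.exp_add]
    congr 2
    push_cast
    ring
  | pred m ih =>
    have h := thetaProd_add_self hT (w + ((-m - 1 : ℤ) : ℂ) * T)
    rw [show w + ((-m - 1 : ℤ) : ℂ) * T + T = w + ((-m : ℤ) : ℂ) * T by push_cast; ring, ih] at h
    -- For a downward step, the relation for one shift is solved for the value at the smaller
    -- argument by multiplying with the inverse exponential.
    have h' := congrArg (fun x => Complex.exp (-(-2 * Real.pi * Complex.I * Real.sign T.im *
      (w + ((-m : ℤ) : ℂ) * T) + Real.pi * Complex.I)) * x) h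
    simp only [← mul_assoc, ← Complex.exp_add, neg_add_cancel, Complex.exp_zero, one_mul] at h'
    rw [← h']
    congr 2
    push_cast
    ring

theorem thetaProd_add_lattice (hT : T.im ≠ 0) (w : ℂ) (m₁ m₂ : ℤ) :
    thetaProd T (w + (m₁ + m₂ * T)) = Complex.exp (-2 * Real.pi * Complex.I * Real.sign T.im *
      (m₂ * w + m₂ * (m₂ + 1) / 2 * T) + Real.pi * Complex.I * m₂) * thetaProd T w := by
  rw [add_comm (m₁ : ℂ), ← add_assoc, thetaProd_add_int hT, thetaProd_add_int_mul hT]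

end Theta

/-! ### The second family, `Ftilde` and its periodic correction `F₂` -/

section SecondFamily

namespace Families.Normalization

variable {n : ℕ} {D : Families n} (N : D.Normalization)

theorem a₂_ne_zero {n : ℕ} {D : Families n} (N : D.Normalization) (j : Fin D.μ₂) :
    D.a₂ j ≠ 0 := by
  intro h
  have : N.w₁ j ∈ periodSet (D.a₂ j) := by
    rw [N.periodSet_eq]; exact ⟨1, 0, by simp⟩
  obtain ⟨k, hk⟩ := this
  exact N.w₁_ne j (by rw [hk, h]; simp [pair])

theorem T_im_ne (j : Fin D.μ₂) : (N.T j).im ≠ 0 := N.ratio_im_ne j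

theorem lin_div (j : Fin D.μ₂) (z : Cn n) : lin (D.a₂ j) (D.c₂ j) z / N.w₁ j =
    lin ((N.w₁ j)⁻¹ • D.a₂ j) (D.c₂ j / N.w₁ j) z := by
  simp only [lin, pair, add_div, Finset.sum_div, PiLp.smul_apply, smul_eq_mul]
  congr 1
  exact Finset.sum_congr rfl fun p _ => by ring

theorem mem_repro_iff_lattice (j : Fin D.μ₂) (z : Cn n) : z ∈ repro (D.a₂ j) (D.c₂ j) ↔
    ∃ r s : ℤ, lin (D.a₂ j) (D.c₂ j) z / N.w₁ j = r + s * N.T j := by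
  have h := N.w₁_ne j
  rw [mem_repro_iff, N.periodSet_eq, Set.mem_ofPred_eq]
  refine exists_congr fun r => exists_congr fun s => ?_
  rw [T, div_eq_iff h]
  have : ((r : ℂ) + s * (N.w₂ j / N.w₁ j)) * N.w₁ j = r * N.w₁ j + s * N.w₂ j := by
    field_simp
  rw [this]

theorem differentiable_thetaProd_factor (j : Fin D.μ₂) :
    Differentiable ℂ fun z => thetaProd (N.T j) (lin (D.a₂ j) (D.c₂ j) z / N.w₁ j) := by
  simp only [N.lin_div]
  exact differentiable_thetaProd_lin (N.T_im_ne j) _ _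

theorem differentiable_Ftilde : Differentiable ℂ N.Ftilde :=
  differentiable_finsetProd _ fun j _ => N.differentiable_thetaProd_factor j

theorem zeroMult_Ftilde (z : Cn n) :
    zeroMult N.Ftilde z = ((∑ j, reproMult (D.a₂ j) (D.c₂ j) z : ℕ) : ℕ∞) := by
  classical
  have h := zeroMult_prod Finset.univ (fun j _ => N.differentiable_thetaProd_factor j) z
  refine h.trans ?_
  push_cast
  refine Finset.sum_congr rfl fun j _ => ?_
  have hm := N.mem_repro_iff_lattice j z
  simp only [N.lin_div] at hm ⊢
  rw [zeroMult_thetaProd_lin (N.T_im_ne j)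
    (smul_ne_zero (inv_ne_zero (N.w₁_ne j)) (N.a₂_ne_zero j))]
  simp only [reproMult, Set.indicator, hm]
  split_ifs <;> simp

/-- A shift by `ω_p` moves the argument of the `j`-th theta product by the lattice vector `m₁ + m₂
T`; `σ` and `τ` collect the multipliers. -/
theorem Ftilde_add_unitVec (p : Fin n) (z : Cn n) :
    N.Ftilde (z + unitVec p) = Complex.exp (∑ q, N.σ p q * z q + N.τ p) * N.Ftilde z := by
  have hexp : ∑ q, N.σ p q * z q + N.τ p = ∑ j, (-2 * Real.pi * Complex.I * Real.sign (N.T j).im *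
      (N.m₂ j p * (lin (D.a₂ j) (D.c₂ j) z / N.w₁ j) + N.m₂ j p * (N.m₂ j p + 1) / 2 * N.T j) +
      Real.pi * Complex.I * N.m₂ j p) := by
    simp only [σ, τ, Finset.sum_mul]
    rw [Finset.sum_comm, ← Finset.sum_add_distrib]
    refine Finset.sum_congr rfl fun j _ => ?_
    have : ∑ q, -2 * Real.pi * Complex.I * Real.sign (N.T j).im * N.m₂ j p * D.a₂ j q / N.w₁ j * z q
        = -2 * Real.pi * Complex.I * Real.sign (N.T j).im * N.m₂ j p * pair (D.a₂ j) z / N.w₁ j := by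
      rw [pair, Finset.mul_sum, Finset.sum_div]
      exact Finset.sum_congr rfl fun q _ => by ring
    rw [this, lin]
    ring
  rw [hexp, Complex.exp_sum, Ftilde, Ftilde, ← Finset.prod_mul_distrib]
  refine Finset.prod_congr rfl fun j _ => ?_
  have : lin (D.a₂ j) (D.c₂ j) (z + unitVec p) / N.w₁ j =
      lin (D.a₂ j) (D.c₂ j) z / N.w₁ j + (N.m₁ j p + N.m₂ j p * N.T j) := by
    have := N.w₁_ne j
    rw [lin_add, pair_unitVec, N.a₂_eq, T]
    field_simp
  rw [this]
  exact thetaProd_add_lattice (N.T_im_ne j) _ _ _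

theorem H_eq (hσ : ∀ p q, N.σ p q = N.σ q p) (z : Cn n) :
    N.H z = 1 / 2 * ∑ p, ∑ q, N.σ p q * z p * z q + ∑ p, (N.τ p - 1 / 2 * N.σ p p) * z p := by
  have h1 : ∀ p q, N.σ p q * z p * z q = (if q = p then N.σ p p * z p ^ 2 else 0) +
      (if p < q then N.σ p q * z p * z q else 0) + (if q < p then N.σ q p * z q * z p else 0) := by
    intro p q
    rcases lt_trichotomy p q with h | rfl | h
    · simp [h, h.ne', h.not_gt]
    · simp; ring
    · simp [h, h.ne, h.not_gt, hσ p q]; ring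
  have h2 : ∑ p, ∑ q, N.σ p q * z p * z q = ∑ p, N.σ p p * z p ^ 2 +
      ∑ p, ∑ q, (if p < q then N.σ p q * z p * z q else 0) +
      ∑ p, ∑ q, (if q < p then N.σ q p * z q * z p else 0) := by
    rw [← Finset.sum_add_distrib, ← Finset.sum_add_distrib]
    refine Finset.sum_congr rfl fun p _ => ?_
    rw [Finset.sum_congr rfl fun q _ => h1 p q, Finset.sum_add_distrib, Finset.sum_add_distrib,
      Finset.sum_ite_eq' Finset.univ p]
    simp
  rw [h2, Finset.sum_comm (f := fun p q => if q < p then N.σ q p * z q * z p else 0), H]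
  simp only [Finset.sum_filter]
  ring

/-- By symmetry, the quadratic part increases by `∑ σ_pq z_q + σ_pp / 2`; the correction `-σ_pp / 2`
in the linear part removes the extra constant. -/
theorem H_add_unitVec (hσ : ∀ p q, N.σ p q = N.σ q p) (p : Fin n) (z : Cn n) :
    N.H (z + unitVec p) = N.H z + (∑ q, N.σ p q * z q + N.τ p) := by
  have hu : ∀ q, (z + unitVec p) q = z q + if q = p then 1 else 0 := fun q => by
    simp [unitVec, PiLp.single_apply]
  rw [N.H_eq hσ, N.H_eq hσ]
  simp only [hu, mul_add, add_mul, Finset.sum_add_distrib, mul_ite, mul_one, mul_zero, ite_mul,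
    zero_mul, Finset.sum_ite_eq', Finset.mem_univ, if_true, Finset.sum_ite_irrel,
    Finset.sum_const_zero]
  have : ∑ q, N.σ q p * z q = ∑ q, N.σ p q * z q :=
    Finset.sum_congr rfl fun q _ => by rw [hσ q p]
  rw [this]
  ring

theorem differentiable_H : Differentiable ℂ N.H := by
  unfold H; fun_prop

theorem differentiable_F₂ : Differentiable ℂ N.F₂ :=
  N.differentiable_Ftilde.mul N.differentiable_H.neg.cexp

theorem zeroMult_F₂ (z : Cn n) :
    zeroMult N.F₂ z = ((∑ j, reproMult (D.a₂ j) (D.c₂ j) z : ℕ) : ℕ∞) :=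
  (zeroMult_mul_exp N.differentiable_Ftilde N.differentiable_H.neg z).trans (N.zeroMult_Ftilde z)

theorem F₂_periodic (hσ : ∀ p q, N.σ p q = N.σ q p) : IsPeriodic N.F₂ := fun p z => by
  rw [F₂, F₂, N.Ftilde_add_unitVec, N.H_add_unitVec hσ, mul_right_comm, ← Complex.exp_add, mul_comm]
  congr 2
  ring

end Families.Normalization

end SecondFamily

/-! ### Period groups: rank, discreteness and bases -/

section Lattices

variable {n : ℕ} {a : Cn n}

/-- The group of the numbers `⟨a, k⟩` with `k ∈ ℤⁿ`. -/
def periodGroup (a : Cn n) : AddSubgroup ℂ where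
  carrier := periodSet a
  zero_mem' := ⟨0, by simp [pair, intVec]⟩
  add_mem' := by
    rintro _ _ ⟨k, rfl⟩ ⟨l, rfl⟩
    exact ⟨k + l, by rw [← pair_add]; congr 1; ext p; simp [intVec]⟩
  neg_mem' := by
    rintro _ ⟨k, rfl⟩
    exact ⟨-k, by simp [pair, intVec]⟩

theorem intVec_single (p : Fin n) : intVec (Pi.single p 1) = (unitVec p : Cn n) := by
  ext q
  by_cases h : q = p
  · subst h; simp [intVec, unitVec]
  · simp [intVec, unitVec, h]

theorem coord_mem_periodSet (a : Cn n) (p : Fin n) : a p ∈ periodSet a :=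
  ⟨Pi.single p 1, by rw [intVec_single, pair_unitVec]⟩

theorem IsPeriodic.add_intVec {α : Type} {f : Cn n → α} (hf : IsPeriodic f) (k : Fin n → ℤ)
    (z : Cn n) : f (z + intVec k) = f z := by
  let P : AddSubgroup (Cn n) :=
    { carrier := {v | ∀ z, f (z + v) = f z}
      zero_mem' := fun z => by simp
      add_mem' := fun {v w} hv hw z => by rw [← add_assoc, hw, hv]
      neg_mem' := fun {v} hv z => by rw [← hv (z + -v), neg_add_cancel_right] }
  have : intVec k = ∑ p, k p • (unitVec p : Cn n) := by
    ext q
    simp [intVec, unitVec, Pi.single_apply]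
  have hmem : intVec k ∈ P := by
    rw [this]
    exact P.sum_mem fun p _ => P.zsmul_mem (fun z => hf p z) _
  exact hmem z

/-- The real linear map `x ↦ ⟨a, x⟩` on `ℝⁿ`. -/
def realMap (a : Cn n) : EuclideanSpace ℝ (Fin n) →ₗ[ℝ] ℂ where
  toFun x := ∑ p, a p * (x p : ℂ)
  map_add' x y := by simp [mul_add, Finset.sum_add_distrib]
  map_smul' t x := by
    simp only [PiLp.smul_apply, smul_eq_mul, Complex.ofReal_mul, RingHom.id_apply,
      Complex.real_smul, Finset.mul_sum]
    exact Finset.sum_congr rfl fun p _ => by ring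

/-- By rank and nullity, the two classes are distinguished by whether the real span of the `a_p` is
a line or all of `ℂ`. -/
theorem perpDim_eq_finrank_range (a : Cn n) :
    perpDim a = Module.finrank ℝ (LinearMap.range (realMap a)) := by
  have h1 := (realMap a).finrank_range_add_finrank_ker
  have h2 := Submodule.finrank_add_finrank_orthogonal (realKer a)
  have h3 : LinearMap.ker (realMap a) = realKer a := by
    ext x; rfl
  rw [h3] at h1
  unfold perpDim
  omega

theorem realMap_single (a : Cn n) (p : Fin n) (t : ℝ) :
    realMap a (EuclideanSpace.single p t) = a p * t := by
  simp only [realMap, LinearMap.coe_mk, AddHom.coe_mk, PiLp.single_apply]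
  rw [Finset.sum_eq_single p]
  · simp
  · intro q _ hq; simp [hq]
  · simp

theorem one_le_perpDim (ha : a ≠ 0) : 1 ≤ perpDim a := by
  rw [perpDim_eq_finrank_range, Nat.one_le_iff_ne_zero, ne_eq, Submodule.finrank_eq_zero,
    LinearMap.range_eq_bot]
  intro h
  refine ha ?_
  ext p
  have := realMap_single a p 1
  simpa [h] using this.symm

theorem perpDim_le_two (a : Cn n) : perpDim a ≤ 2 := by
  rw [perpDim_eq_finrank_range, ← Complex.finrank_real_complex]
  exact Submodule.finrank_le _

theorem exists_realMap_eq (h : perpDim a = 2) (w : ℂ) : ∃ x, realMap a x = w := by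
  rw [perpDim_eq_finrank_range, ← Complex.finrank_real_complex] at h
  have := Submodule.eq_top_of_finrank_eq h
  exact LinearMap.range_eq_top.1 this w

theorem exists_eq_real_mul (h : perpDim a = 1) :
    ∃ (w : ℂ) (b : Fin n → ℝ), w ≠ 0 ∧ ∀ p, a p = w * b p := by
  rw [perpDim_eq_finrank_range, finrank_eq_one_iff'] at h
  obtain ⟨⟨w, hw⟩, hw0, hall⟩ := h
  have : ∀ p, ∃ t : ℝ, a p = w * t := fun p => by
    obtain ⟨t, ht⟩ := hall ⟨a p, EuclideanSpace.single p 1, by rw [realMap_single]; simp⟩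
    refine ⟨t, ?_⟩
    have := congrArg Subtype.val ht
    simp only [SetLike.mk_smul_mk, Complex.real_smul] at this
    rw [← this, mul_comm]
  choose b hb using this
  exact ⟨w, b, fun h => hw0 (Subtype.ext h), hb⟩

theorem perpDim_of_real (ha : a ≠ 0) (hr : ∀ p, (a p).im = 0) : perpDim a = 1 := by
  refine le_antisymm ?_ (one_le_perpDim ha)
  rw [perpDim_eq_finrank_range]
  refine (Submodule.finrank_mono (t := Submodule.span ℝ {(1 : ℂ)}) ?_).trans
    (finrank_span_singleton (one_ne_zero)).le
  rintro _ ⟨x, rfl⟩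
  rw [Submodule.mem_span_singleton]
  refine ⟨∑ p, (a p).re * x p, ?_⟩
  simp only [realMap, LinearMap.coe_mk, AddHom.coe_mk, Complex.real_smul, mul_one]
  push_cast
  refine Finset.sum_congr rfl fun p _ => ?_
  congr 1
  apply Complex.ext <;> simp [hr p]

theorem ne_zero_of_perpDim (h : perpDim a ≠ 0) : a ≠ 0 := by
  rintro rfl
  apply h
  rw [perpDim_eq_finrank_range, Submodule.finrank_eq_zero, LinearMap.range_eq_bot]
  ext x
  simp [realMap]

/-- The group `{⟨a, k⟩ : k ∈ ℤⁿ}` is discrete. -/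
def DiscretePeriods (a : Cn n) : Prop := ∃ ε > 0, ∀ w ∈ periodSet a, ‖w‖ < ε → w = 0

theorem discretePeriods_of_zeros {φ : ℂ → ℂ} (hφ : ∀ᶠ t in 𝓝[≠] (0 : ℂ), φ t ≠ 0)
    (h : ∀ᶠ t in 𝓝 (0 : ℂ), t ∈ periodSet a → φ t = 0) : DiscretePeriods a := by
  rw [eventually_nhdsWithin_iff] at hφ
  obtain ⟨ε, hε, hball⟩ := Metric.eventually_nhds_iff.1 (hφ.and h)
  refine ⟨ε, hε, fun w hw hwε => ?_⟩
  by_contra hne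
  obtain ⟨h1, h2⟩ := hball (by simpa using hwε)
  exact h1 hne (h2 hw)

theorem exists_mem_hyperplane (ha : a ≠ 0) (c : ℂ) : ∃ z, lin a c z = 0 := by
  obtain ⟨v, hv⟩ := exists_pair_eq_one ha
  exact ⟨(-c) • v, by rw [lin, pair_smul, hv]; ring⟩

/-- A transversal line through a point of the plane meets the reproduction exactly in the period
group. This group is countable, so some local equation is not identically zero on the line, and its
zeros are isolated. -/
theorem discretePeriods_of_isAnalyticSubset (ha : a ≠ 0) {c : ℂ}
    (h : IsAnalyticSubset (repro a c)) : DiscretePeriods a := by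
  obtain ⟨v, hv⟩ := exists_pair_eq_one ha
  obtain ⟨z₀, hz₀⟩ := exists_mem_hyperplane ha c
  obtain ⟨U, hU, hzU, r, f, hf, hS⟩ := h z₀
  have hline : Continuous fun t : ℂ => z₀ + t • v := by fun_prop
  have hUt : ∀ᶠ t in 𝓝 (0 : ℂ), z₀ + t • v ∈ U :=
    hline.tendsto 0 (by simpa using hU.mem_nhds hzU)
  have hmem : ∀ t : ℂ, z₀ + t • v ∈ repro a c ↔ t ∈ periodSet a := fun t => by
    rw [mem_repro_iff, lin_add, pair_smul, hv, hz₀, zero_add, mul_one]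
  have hcount : (periodSet a).Countable := by
    have : periodSet a = Set.range fun k : Fin n → ℤ => pair a (intVec k) := by
      ext w; simp [periodSet, eq_comm]
    rw [this]
    exact Set.countable_range _
  have han : ∀ i, AnalyticAt ℂ (fun t : ℂ => f i (z₀ + t • v)) 0 := fun i => by
    have hd : DifferentiableOn ℂ (fun t : ℂ => f i (z₀ + t • v)) ((fun t : ℂ => z₀ + t • v) ⁻¹' U) :=
      (hf i).comp (by fun_prop) fun t ht => ht
    exact hd.analyticAt hUt
  obtain ⟨i, hi⟩ : ∃ i, ¬ ∀ᶠ t in 𝓝 (0 : ℂ), f i (z₀ + t • v) = 0 := by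
    by_contra! hall
    have hev : ∀ᶠ t in 𝓝 (0 : ℂ), t ∈ periodSet a := by
      filter_upwards [hUt, eventually_all.2 hall] with t ht hft
      rw [← hmem t]
      have : z₀ + t • v ∈ repro a c ∩ U := by rw [hS]; exact ⟨ht, hft⟩
      exact this.1
    obtain ⟨t, ht, ht'⟩ := (hcount.dense_compl ℝ).inter_nhds_nonempty hev
    exact ht ht'
  refine discretePeriods_of_zeros
    ((han i).eventually_eq_zero_or_eventually_ne_zero.resolve_left hi) ?_
  filter_upwards [hUt] with t ht htp
  have : z₀ + t • v ∈ repro a c ∩ U := ⟨(hmem t).2 htp, ht⟩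
  rw [hS] at this
  exact this.2 i

/-- By periodicity `F` vanishes at every period on a transversal line. The line is drawn through a
point where `F ≠ 0`, so the zeros on it are isolated. -/
theorem discretePeriods_of_plane_zeros {F : Cn n → ℂ} (hF : Differentiable ℂ F)
    (hne : ∃ w, F w ≠ 0) (hper : IsPeriodic F) (ha : a ≠ 0) {c : ℂ}
    (h : ∀ z, lin a c z = 0 → F z = 0) : DiscretePeriods a := by
  obtain ⟨v, hv⟩ := exists_pair_eq_one ha
  obtain ⟨z₁, hz₁⟩ := hne
  set z₀ := z₁ - lin a c z₁ • v with hz₀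
  have hlz₀ : lin a c z₀ = 0 := by rw [hz₀, lin_sub, pair_smul, hv]; ring
  have hd := differentiable_comp_line hF z₀ v
  refine discretePeriods_of_zeros (φ := fun t => F (z₀ + t • v)) ?_ ?_
  · refine (hd.analyticAt 0).eventually_eq_zero_or_eventually_ne_zero.resolve_left fun hev => ?_
    have := congrFun (AnalyticOnNhd.eq_of_eventuallyEq (z₀ := 0) (g := fun _ => (0 : ℂ))
      (fun s _ => hd.analyticAt s) analyticOnNhd_const hev) (lin a c z₁)
    exact hz₁ (by simpa [hz₀] using this)
  · refine Eventually.of_forall fun t => ?_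
    rintro ⟨k, hk⟩
    have := h (z₀ + t • v - intVec k) (by
      rw [lin_sub, lin_add, pair_smul, hv, hlz₀, ← hk]; ring)
    rwa [← hper.add_intVec k, sub_add_cancel] at this

theorem DiscretePeriods.eventually_eq (h : DiscretePeriods a) (w : ℂ) :
    ∃ u : ℂ, ∀ᶠ t in 𝓝 w, t ∈ periodSet a → t = u := by
  obtain ⟨ε, hε, hd⟩ := h
  by_cases hex : ∃ u ∈ periodSet a, ‖u - w‖ < ε / 2
  · obtain ⟨u, hu, huw⟩ := hex
    refine ⟨u, ?_⟩
    filter_upwards [Metric.ball_mem_nhds w (half_pos hε)] with t ht htp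
    rw [mem_ball_iff_norm] at ht
    refine sub_eq_zero.1 (hd _ ((periodGroup a).sub_mem htp hu) ?_)
    calc ‖t - u‖ = ‖(t - w) - (u - w)‖ := by congr 1; ring
      _ ≤ ‖t - w‖ + ‖u - w‖ := norm_sub_le _ _
      _ < ε := by linarith
  · push Not at hex
    refine ⟨0, ?_⟩
    filter_upwards [Metric.ball_mem_nhds w (half_pos hε)] with t ht htp
    rw [mem_ball_iff_norm] at ht
    exact absurd ht (hex t htp).not_gt

open Classical in
-- Near any point only one value `u` of the affine function can be a period, so locally the set is a
-- single hyperplane or empty; the constant equation `1` covers the latter case.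
theorem DiscretePeriods.isAnalyticSubset (h : DiscretePeriods a) (c : ℂ) :
    IsAnalyticSubset (repro a c) := by
  intro z
  obtain ⟨u, hu⟩ := h.eventually_eq (lin a c z)
  obtain ⟨W, hWsub, hW, hzW⟩ := eventually_nhds_iff.1 hu
  have hl := differentiable_lin a c
  refine ⟨lin a c ⁻¹' W, hW.preimage hl.continuous, hzW, 1,
    fun _ w => if u ∈ periodSet a then lin a c w - u else 1, fun _ => ?_, ?_⟩
  · split_ifs
    · exact (hl.sub_const u).differentiableOn
    · exact differentiableOn_const 1
  · ext w
    simp only [Set.mem_inter_iff, mem_repro_iff, Set.mem_preimage, Set.mem_ofPred_eq]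
    constructor
    · rintro ⟨h1, h2⟩
      have := hWsub _ h2 h1
      refine ⟨h2, fun _ => ?_⟩
      rw [if_pos (this ▸ h1), this, sub_self]
    · rintro ⟨h1, h2⟩
      refine ⟨?_, h1⟩
      have := h2 0
      split_ifs at this with hu
      · rw [sub_eq_zero.1 this]; exact hu
      · exact absurd this one_ne_zero

/-- A discrete subgroup of `ℝ` is cyclic. Its generator `t` divides every `a_p`, and since `t` is
itself of the form `⟨a, m⟩`, the quotients satisfy a Bézout relation. -/
theorem exists_primitive_of_real (ha : a ≠ 0) (hr : ∀ p, (a p).im = 0) (hd : DiscretePeriods a) :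
    ∃ (k : Fin n → ℤ) (t : ℝ), Finset.univ.gcd k = 1 ∧ t ≠ 0 ∧ ∀ p, a p = t * k p := by
  obtain ⟨ε, hε, hdε⟩ := hd
  let G : AddSubgroup ℝ := (periodGroup a).comap Complex.ofRealHom.toAddMonoidHom
  have hG : ∀ x : ℝ, x ∈ G ↔ (x : ℂ) ∈ periodSet a := fun x => Iff.rfl
  obtain ⟨t, ht⟩ := AddSubgroup.cyclic_of_isolated_zero (H := G) hε (by
    rw [Set.disjoint_left]
    rintro x hx ⟨h0, h1⟩
    have := hdε _ ((hG x).1 hx) (by rw [Complex.norm_real, Real.norm_of_nonneg h0.le]; exact h1)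
    exact h0.ne' (by exact_mod_cast this))
  have hmem : ∀ x : ℝ, x ∈ G ↔ ∃ m : ℤ, m • t = x := fun x => by
    rw [ht, AddSubgroup.mem_closure_singleton]
  have hare : ∀ p, a p = ((a p).re : ℂ) := fun p => by apply Complex.ext <;> simp [hr p]
  have hk : ∀ p, ∃ m : ℤ, a p = t * m := fun p => by
    obtain ⟨m, hm⟩ := (hmem (a p).re).1 ((hG _).2 (by rw [← hare]; exact coord_mem_periodSet a p))
    refine ⟨m, ?_⟩
    rw [hare, ← hm]
    push_cast [zsmul_eq_mul]
    ring
  choose k hk using hk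
  have ht0 : t ≠ 0 := by
    rintro rfl
    exact ha (by ext p; simp [hk p])
  refine ⟨k, t, ?_, ht0, hk⟩
  obtain ⟨m, hm⟩ := (hG t).1 ((hmem t).2 ⟨1, by simp⟩)
  have hsum : ∑ p, k p * m p = 1 := by
    have h1 : pair a (intVec m) = t * ((∑ p, k p * m p : ℤ) : ℂ) := by
      simp only [pair, hk, intVec]
      push_cast
      rw [Finset.mul_sum]
      exact Finset.sum_congr rfl fun p _ => by ring
    rw [h1] at hm
    have htc : (t : ℂ) ≠ 0 := by exact_mod_cast ht0
    have : ((∑ p, k p * m p : ℤ) : ℂ) = 1 := by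
      rw [← mul_right_inj' htc, ← hm, mul_one]
    exact_mod_cast this
  have hdvd : Finset.univ.gcd k ∣ 1 := by
    rw [← hsum]
    exact Finset.dvd_sum fun p hp => (Finset.gcd_dvd hp).mul_right _
  rw [← Finset.normalize_gcd]
  exact normalize_eq_one.2 (isUnit_of_dvd_one hdvd)

/-- The `a_p` span `ℂ` over `ℝ`, so the discrete period group is a lattice of rank two. An integral
basis of it is independent over `ℝ`, hence has nonreal ratio. -/
theorem exists_lattice_basis (ha : perpDim a = 2) (hd : DiscretePeriods a) :
    ∃ w₁ w₂ : ℂ, w₁ ≠ 0 ∧ (w₂ / w₁).im ≠ 0 ∧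
      periodSet a = {w | ∃ r s : ℤ, w = r * w₁ + s * w₂} := by
  let L : Submodule ℤ ℂ := (periodGroup a).toIntSubmodule
  have hL : ∀ w, w ∈ L ↔ w ∈ periodSet a := fun w => Iff.rfl
  have : DiscreteTopology L := by
    obtain ⟨ε, hε, hdε⟩ := hd
    rw [discreteTopology_iff_isOpen_singleton_zero]
    refine ⟨Metric.ball 0 ε, Metric.isOpen_ball, ?_⟩
    ext x
    simp only [Set.mem_preimage, mem_ball_zero_iff, Set.mem_singleton_iff]
    constructor
    · intro hx
      exact Subtype.ext (hdε _ x.2 hx)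
    · rintro rfl
      simpa using hε
  have : IsZLattice ℝ L := ⟨by
    rw [eq_top_iff]
    intro w _
    obtain ⟨x, rfl⟩ := exists_realMap_eq ha w
    simp only [realMap, LinearMap.coe_mk, AddHom.coe_mk]
    refine Submodule.sum_mem _ fun p _ => ?_
    rw [mul_comm, ← Complex.real_smul]
    exact Submodule.smul_mem _ _ (Submodule.subset_span (coord_mem_periodSet a p))⟩
  let b : Module.Basis (Fin 2) ℤ L := Module.finBasisOfFinrankEq ℤ L
    (by rw [ZLattice.rank ℝ L, Complex.finrank_real_complex])
  let B := b.ofZLatticeBasis ℝ L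
  have hB : ∀ i, B i = b i := fun i => b.ofZLatticeBasis_apply ℝ L i
  have h0 : (b 0 : ℂ) ≠ 0 := by rw [← hB]; exact B.ne_zero 0
  refine ⟨b 0, b 1, h0, fun him => ?_, ?_⟩
  · have hli := B.linearIndependent
    rw [Fintype.linearIndependent_iff] at hli
    have := hli ![((b 1 : ℂ) / b 0).re, -1] (by
      simp only [Fin.sum_univ_two, hB, Matrix.cons_val_zero, Matrix.cons_val_one, Complex.real_smul]
      have : (((b 1 : ℂ) / b 0).re : ℂ) = (b 1 : ℂ) / b 0 := by
        apply Complex.ext <;> simp [him]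
      rw [this, div_mul_cancel₀ _ h0]
      simp) 1
    simp at this
  · ext w
    rw [← hL]
    constructor
    · intro hw
      refine ⟨b.repr ⟨w, hw⟩ 0, b.repr ⟨w, hw⟩ 1, ?_⟩
      have := b.sum_repr ⟨w, hw⟩
      rw [Fin.sum_univ_two] at this
      have := congrArg Subtype.val this
      simp only [Submodule.coe_add, Submodule.coe_smul, zsmul_eq_mul] at this
      exact this.symm
    · rintro ⟨r, s, rfl⟩
      have := L.add_mem (L.smul_mem r (b 0).2) (L.smul_mem s (b 1).2)
      simpa [zsmul_eq_mul] using this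

theorem nonempty_normalization {D : Families n}
    (h₁ : ∀ j : ℕ, (j : ℕ∞) < D.μ₁ → D.a₁ j ≠ 0 ∧ (∀ p, (D.a₁ j p).im = 0) ∧ DiscretePeriods (D.a₁ j))
    (h₂ : ∀ j, perpDim (D.a₂ j) = 2 ∧ DiscretePeriods (D.a₂ j)) : Nonempty D.Normalization := by
  have H₁ : ∀ j : Idx D.μ₁, ∃ (k : Fin n → ℤ) (t : ℝ), Finset.univ.gcd k = 1 ∧ t ≠ 0 ∧
      ∀ p, D.a₁ j p = t * k p := fun j =>
    exists_primitive_of_real (h₁ j j.2).1 (h₁ j j.2).2.1 (h₁ j j.2).2.2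
  choose k t hk ht hkt using H₁
  choose w₁ w₂ hw₁ hw hper using fun j => exists_lattice_basis (h₂ j).1 (h₂ j).2
  have H₂ : ∀ j p, ∃ r s : ℤ, D.a₂ j p = r * w₁ j + s * w₂ j := fun j p => by
    have := coord_mem_periodSet (D.a₂ j) p
    rw [hper] at this
    exact this
  choose m₁ m₂ hm using H₂
  exact ⟨⟨k, t, hk, ht, hkt, w₁, w₂, hw₁, hw, hper, m₁, m₂, hm⟩⟩

end Lattices

/-! ### Lattice points in parallelograms and the balance condition -/

section Counting

/-- The integer points of a half-open parallelogram with integer vertices. -/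
def intParallelogram (u v : Fin 2 → ℤ) : Set (Fin 2 → ℤ) :=
  {x | ∃ α β : ℝ, 0 ≤ α ∧ α < 1 ∧ 0 ≤ β ∧ β < 1 ∧ ∀ i, (x i : ℝ) = α * u i + β * v i}

theorem eq_zero_of_real_combination {u v : Fin 2 → ℤ} (hD : u 0 * v 1 - u 1 * v 0 ≠ 0) {α β : ℝ}
    (h : ∀ i, α * u i + β * v i = 0) : α = 0 ∧ β = 0 := by
  have hD' : (u 0 * v 1 - u 1 * v 0 : ℝ) ≠ 0 := by exact_mod_cast hD
  have h0 := h 0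
  have h1 := h 1
  constructor
  · refine (mul_eq_zero.1 (?_ : α * (u 0 * v 1 - u 1 * v 0 : ℝ) = 0)).resolve_right hD'
    linear_combination (v 1 : ℝ) * h0 - (v 0 : ℝ) * h1
  · refine (mul_eq_zero.1 (?_ : β * (u 0 * v 1 - u 1 * v 0 : ℝ) = 0)).resolve_right hD'
    linear_combination (u 0 : ℝ) * h1 - (u 1 : ℝ) * h0

/-- The half-open parallelogram is a set of representatives of `ℤ²` modulo the sublattice spanned by
`u` and `v`, whose index is the absolute value of the determinant. -/
theorem ncard_intParallelogram {u v : Fin 2 → ℤ} (hD : u 0 * v 1 - u 1 * v 0 ≠ 0) :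
    (intParallelogram u v).ncard = (u 0 * v 1 - u 1 * v 0).natAbs := by
  have hD' : (u 0 * v 1 - u 1 * v 0 : ℝ) ≠ 0 := by exact_mod_cast hD
  have hli : LinearIndependent ℤ ![u, v] := by
    rw [LinearIndependent.pair_iff]
    intro r s hrs
    have := eq_zero_of_real_combination hD (α := r) (β := s) fun i => by
      have := congrFun hrs i
      simp only [Pi.add_apply, Pi.smul_apply, smul_eq_mul, Pi.zero_apply] at this
      exact_mod_cast this
    exact ⟨by exact_mod_cast this.1, by exact_mod_cast this.2⟩
  let b := Module.Basis.span hli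
  have hmem : ∀ x, x ∈ Submodule.span ℤ (Set.range ![u, v]) ↔ ∃ r s : ℤ, r • u + s • v = x := by
    intro x
    rw [Matrix.range_cons, Matrix.range_cons, Matrix.range_empty, Set.union_empty,
      Set.singleton_union, Submodule.mem_span_pair]
  have hcard := Submodule.natAbs_det_basis_change (Pi.basisFun ℤ (Fin 2)) _ b
  have hcomp : ((↑) ∘ b : Fin 2 → Fin 2 → ℤ) = ![u, v] := by
    funext i
    simp only [Function.comp_apply, b, Module.Basis.span_apply]
  rw [hcomp, Pi.basisFun_det_apply, Matrix.det_fin_two] at hcard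
  simp only [Matrix.of_apply, Matrix.cons_val_zero, Matrix.cons_val_one] at hcard
  rw [hcard, ← Nat.card_coe_set_eq]
  refine Nat.card_congr (Equiv.ofBijective
    (fun x : intParallelogram u v => Submodule.Quotient.mk (x : Fin 2 → ℤ)) ⟨?_, ?_⟩)
  · rintro ⟨x, α, β, hα0, hα1, hβ0, hβ1, hx⟩ ⟨y, α', β', hα0', hα1', hβ0', hβ1', hy⟩ hxy
    rw [Submodule.Quotient.eq, hmem] at hxy
    obtain ⟨r, s, hrs⟩ := hxy
    have key := eq_zero_of_real_combination hD (α := α - α' - r) (β := β - β' - s) fun i => by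
      have h1 : (r * u i + s * v i : ℝ) = x i - y i := by
        have := congrFun hrs i
        simp only [Pi.add_apply, Pi.smul_apply, smul_eq_mul, Pi.sub_apply] at this
        exact_mod_cast this
      rw [hx i, hy i] at h1
      linear_combination -h1
    have hr : r = 0 := by
      have h1 : (r : ℝ) < 1 := by linarith [key.1]
      have h2 : (-1 : ℝ) < r := by linarith [key.1]
      have h1' : r < 1 := by exact_mod_cast h1
      have h2' : -1 < r := by exact_mod_cast h2
      omega
    have hs : s = 0 := by
      have h1 : (s : ℝ) < 1 := by linarith [key.2]
      have h2 : (-1 : ℝ) < s := by linarith [key.2]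
      have h1' : s < 1 := by exact_mod_cast h1
      have h2' : -1 < s := by exact_mod_cast h2
      omega
    rw [hr, hs] at hrs
    simp only [zero_smul, add_zero] at hrs
    exact Subtype.ext (sub_eq_zero.1 hrs.symm)
  · intro y
    obtain ⟨x, rfl⟩ := Submodule.Quotient.mk_surjective _ y
    set d : ℝ := (u 0 * v 1 - u 1 * v 0 : ℝ) with hd
    set α : ℝ := (x 0 * v 1 - x 1 * v 0) / d with hα
    set β : ℝ := (u 0 * x 1 - u 1 * x 0) / d with hβ
    have hx : ∀ i, (x i : ℝ) = α * u i + β * v i := by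
      intro i
      rw [hα, hβ]
      field_simp
      rw [hd]
      fin_cases i <;> simp <;> ring
    -- The representative is obtained from the real coordinates `α`, `β` of `x`, given by Cramer's
    -- rule, by keeping their fractional parts.
    refine ⟨⟨x - (⌊α⌋ • u + ⌊β⌋ • v), Int.fract α, Int.fract β, Int.fract_nonneg _,
      Int.fract_lt_one _, Int.fract_nonneg _, Int.fract_lt_one _, fun i => ?_⟩, ?_⟩
    · simp only [Pi.sub_apply, Pi.add_apply, Pi.smul_apply, smul_eq_mul]
      push_cast
      rw [hx i, Int.fract, Int.fract]
      ring
    · change Submodule.Quotient.mk (x - (⌊α⌋ • u + ⌊β⌋ • v)) = _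
      rw [Submodule.Quotient.eq, hmem]
      exact ⟨-⌊α⌋, -⌊β⌋, by simp only [neg_smul]; abel⟩

theorem real_combination_unique {T : ℂ} (hT : T.im ≠ 0) {x y x' y' : ℝ}
    (h : (x : ℂ) + y * T = x' + y' * T) : x = x' ∧ y = y' := by
  have him := congrArg Complex.im h
  simp at him
  have hy : y = y' := him.resolve_right hT
  subst hy
  have := congrArg Complex.re h
  simp at this
  exact ⟨this, rfl⟩

variable {n : ℕ}

theorem sign_mul_pos {x y : ℝ} (hy : 0 < y) : Real.sign (x * y) = Real.sign x := by
  rcases lt_trichotomy x 0 with h | rfl | h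
  · rw [Real.sign_of_neg h, Real.sign_of_neg (mul_neg_of_neg_of_pos h hy)]
  · simp
  · rw [Real.sign_of_pos h, Real.sign_of_pos (mul_pos h hy)]

theorem sign_mul_eq (x y : ℝ) : Real.sign (x * y) = Real.sign x * Real.sign y := by
  rcases lt_trichotomy x 0 with h | rfl | h <;> rcases lt_trichotomy y 0 with h' | rfl | h'
  · rw [Real.sign_of_neg h, Real.sign_of_neg h', Real.sign_of_pos (mul_pos_of_neg_of_neg h h')]; simp
  · simp
  · rw [Real.sign_of_neg h, Real.sign_of_pos h', Real.sign_of_neg (mul_neg_of_neg_of_pos h h')]; simp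
  · simp
  · simp
  · simp
  · rw [Real.sign_of_pos h, Real.sign_of_neg h', Real.sign_of_neg (mul_neg_of_pos_of_neg h h')]; simp
  · simp
  · rw [Real.sign_of_pos h, Real.sign_of_pos h', Real.sign_of_pos (mul_pos h h')]; simp

/-- The orientation and the number of lattice points of a parallelogram with lattice vertices are
given by the determinant of its sides. -/
theorem nu_mul_sign {a : Cn n} {w₁ w₂ : ℂ} (hw₁ : w₁ ≠ 0) (hT : (w₂ / w₁).im ≠ 0)
    (hper : periodSet a = {w | ∃ r s : ℤ, w = r * w₁ + s * w₂}) {m₁ m₂ : Fin n → ℤ}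
    (ha : ∀ p, a p = m₁ p * w₁ + m₂ p * w₂) (p q : Fin n) :
    (nu a p q : ℝ) * Real.sign (a q / a p).im =
      Real.sign (w₂ / w₁).im * (m₁ p * m₂ q - m₂ p * m₁ q : ℤ) := by
  set T := w₂ / w₁ with hTdef
  have hw₂ : w₂ = T * w₁ := by rw [hTdef]; field_simp
  have hap : ∀ p, a p = (m₁ p + m₂ p * T) * w₁ := fun p => by rw [ha, hw₂]; ring
  -- The orientation of `(a_p, a_q)` is that of `(w₁, w₂)` times the sign of the coordinate
  -- determinant.
  have him : (a q / a p).im =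
      ((m₁ p * m₂ q - m₂ p * m₁ q : ℤ) : ℝ) * T.im * (Complex.normSq (m₁ p + m₂ p * T))⁻¹ := by
    rw [hap, hap, mul_div_mul_right _ _ hw₁, Complex.div_im]
    simp
    ring
  by_cases hdet : m₁ p * m₂ q - m₂ p * m₁ q = 0
  · rw [him, hdet]; simp
  have hne : ∀ p, (m₁ p ≠ 0 ∨ m₂ p ≠ 0) → (m₁ p + m₂ p * T : ℂ) ≠ 0 := by
    intro p hp h0
    have := real_combination_unique hT (x := m₁ p) (y := m₂ p) (x' := 0) (y' := 0) (by
      push_cast; rw [h0]; ring)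
    rcases hp with hp | hp
    · exact hp (by exact_mod_cast this.1)
    · exact hp (by exact_mod_cast this.2)
  have hp0 : (m₁ p + m₂ p * T : ℂ) ≠ 0 := hne p (by
    by_contra! h; exact hdet (by rw [h.1, h.2]; ring))
  have hq0 : (m₁ q + m₂ q * T : ℂ) ≠ 0 := hne q (by
    by_contra! h; exact hdet (by rw [h.1, h.2]; ring))
  have hap0 : a p ≠ 0 := by rw [hap]; exact mul_ne_zero hp0 hw₁
  have haq0 : a q ≠ 0 := by rw [hap]; exact mul_ne_zero hq0 hw₁
  have hnu : nu a p q = (m₁ p * m₂ q - m₂ p * m₁ q).natAbs := by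
    rw [nu, if_neg (by tauto)]
    have h1 := ncard_intParallelogram (u := ![m₁ p, m₂ p]) (v := ![m₁ q, m₂ q]) (by simpa using hdet)
    simp only [Matrix.cons_val_zero, Matrix.cons_val_one] at h1
    rw [← h1]
    have hinj : Function.Injective (fun x : Fin 2 → ℤ => ((x 0 : ℂ) + x 1 * T) * w₁) := by
      intro x y hxy
      have := real_combination_unique hT (x := x 0) (y := x 1) (x' := y 0) (y' := y 1) (by
        have := mul_right_cancel₀ hw₁ hxy
        push_cast
        exact this)
      funext i
      fin_cases i
      · exact_mod_cast this.1
      · exact_mod_cast this.2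
    rw [← Set.ncard_image_of_injective _ hinj]
    congr 1
    ext w
    constructor
    · rintro ⟨hw, α, β, hα0, hα1, hβ0, hβ1, hwe⟩
      rw [hper] at hw
      obtain ⟨r, s, hrs⟩ := hw
      refine ⟨![r, s], ⟨α, β, hα0, hα1, hβ0, hβ1, ?_⟩, ?_⟩
      · have := real_combination_unique hT (x := r) (y := s) (x' := α * m₁ p + β * m₁ q)
          (y' := α * m₂ p + β * m₂ q) (by
            refine mul_right_cancel₀ hw₁ ?_
            push_cast
            have e : (r + s * T) * w₁ = α * a p + β * a q := by
              rw [← hwe, hrs, hw₂]; ring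
            rw [e, hap, hap]
            ring)
        intro i
        fin_cases i
        · simpa using this.1
        · simpa using this.2
      · simp only [Matrix.cons_val_zero, Matrix.cons_val_one]
        rw [hrs, hw₂]; ring
    · rintro ⟨x, ⟨α, β, hα0, hα1, hβ0, hβ1, hx⟩, rfl⟩
      refine ⟨?_, α, β, hα0, hα1, hβ0, hβ1, ?_⟩
      · rw [hper]
        exact ⟨x 0, x 1, by rw [hw₂]; ring⟩
      · have h0 : (x 0 : ℂ) = α * m₁ p + β * m₁ q := by exact_mod_cast hx 0
        have h1 : (x 1 : ℂ) = α * m₂ p + β * m₂ q := by exact_mod_cast hx 1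
        simp only
        rw [h0, h1, hap, hap]
        ring
  rw [hnu, him, sign_mul_pos (inv_pos.2 (Complex.normSq_pos.2 hp0)), sign_mul_eq, Nat.cast_natAbs,
    Int.cast_abs, ← sign_mul_self_eq_abs]
  have hs : Real.sign ((m₁ p * m₂ q - m₂ p * m₁ q : ℤ) : ℝ) *
      Real.sign ((m₁ p * m₂ q - m₂ p * m₁ q : ℤ) : ℝ) = 1 := by
    have : ((m₁ p * m₂ q - m₂ p * m₁ q : ℤ) : ℝ) ≠ 0 := by exact_mod_cast hdet
    rcases Real.sign_apply_eq_of_ne_zero _ this with h | h <;> rw [h] <;> norm_num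
  linear_combination (((m₁ p * m₂ q - m₂ p * m₁ q : ℤ) : ℝ) * Real.sign T.im) * hs

/-- In `m₂p a_q - m₂q a_p` the `w₂` terms cancel and `w₁` times a determinant remains. Hence `σ p q
- σ q p` is `2πi` times the balance sum. -/
theorem Families.Normalization.balance_iff {D : Families n} (N : D.Normalization) (p q : Fin n) :
    ∑ j, (nu (D.a₂ j) p q : ℝ) * Real.sign (D.a₂ j q / D.a₂ j p).im = 0 ↔ N.σ p q = N.σ q p := by
  have h1 : ∀ j, (nu (D.a₂ j) p q : ℝ) * Real.sign (D.a₂ j q / D.a₂ j p).im =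
      Real.sign (N.T j).im * (N.m₁ j p * N.m₂ j q - N.m₂ j p * N.m₁ j q : ℤ) := fun j =>
    nu_mul_sign (N.w₁_ne j) (N.T_im_ne j) (N.periodSet_eq j) (N.a₂_eq j) p q
  have h2 : N.σ p q - N.σ q p = 2 * Real.pi * Complex.I *
      ((∑ j, (nu (D.a₂ j) p q : ℝ) * Real.sign (D.a₂ j q / D.a₂ j p).im : ℝ) : ℂ) := by
    simp only [h1]
    push_cast
    rw [Finset.mul_sum, σ, σ, ← Finset.sum_sub_distrib]
    refine Finset.sum_congr rfl fun j _ => ?_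
    have hw := N.w₁_ne j
    have hT : N.w₂ j = N.T j * N.w₁ j := by rw [T]; field_simp
    rw [N.a₂_eq, N.a₂_eq, hT]
    field_simp
    ring
  have hpi : (2 * Real.pi * Complex.I : ℂ) ≠ 0 := by simp [Real.pi_ne_zero]
  rw [← sub_eq_zero (a := N.σ p q), h2, mul_eq_zero, or_iff_right hpi, Complex.ofReal_eq_zero]

end Counting

/-! ### The divisor as a sum of periodic reproductions -/

section Decomposition

variable {n : ℕ}

theorem lin_eq_of_hyperplane_subset {a b : Cn n} (ha : a ≠ 0) {c e : ℂ}
    (h : ∀ z, lin a c z = 0 → lin b e z = 0) : ∃ t : ℂ, ∀ z, lin b e z = t * lin a c z := by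
  obtain ⟨v, hv⟩ := exists_pair_eq_one ha
  refine ⟨pair b v, fun z => ?_⟩
  have := h (z - lin a c z • v) (by rw [lin_sub, pair_smul, hv]; ring)
  rw [lin_sub, pair_smul] at this
  linear_combination this

theorem hyperplane_eq_of_subset {a b : Cn n} (ha : a ≠ 0) (hb : b ≠ 0) {c e : ℂ}
    (h : ∀ z, lin a c z = 0 → lin b e z = 0) : hyperplane b e = hyperplane a c := by
  obtain ⟨t, ht⟩ := lin_eq_of_hyperplane_subset ha h
  have ht0 : t ≠ 0 := by
    rintro rfl
    obtain ⟨v, hv⟩ := exists_pair_eq_one hb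
    have h0 := ht 0
    have h1 := ht (0 + v)
    rw [lin_add, h0, hv] at h1
    simp at h1
  ext z
  simp [hyperplane, ht z, ht0]

/-- The translates of a set by integer vectors. -/
def translates (P : Set (Cn n)) : Set (Set (Cn n)) :=
  Set.range fun k : Fin n → ℤ => {z | z - intVec k ∈ P}

theorem intVec_zero : intVec (0 : Fin n → ℤ) = 0 := by ext p; simp [intVec]

theorem intVec_add (k l : Fin n → ℤ) : intVec (k + l) = intVec k + intVec l := by
  ext p; simp [intVec]

theorem intVec_neg (k : Fin n → ℤ) : intVec (-k) = -intVec k := by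
  ext p; simp [intVec]

theorem self_mem_translates (P : Set (Cn n)) : P ∈ translates P :=
  ⟨0, by simp [intVec_zero]⟩

theorem translates_eq_of_mem {P Q : Set (Cn n)} (h : Q ∈ translates P) :
    translates Q = translates P := by
  obtain ⟨k, rfl⟩ := h
  ext R
  constructor
  · rintro ⟨l, rfl⟩
    exact ⟨l + k, by ext z; simp [intVec_add, sub_sub]⟩
  · rintro ⟨l, rfl⟩
    refine ⟨l - k, Set.ext fun z => ?_⟩
    rw [Set.mem_ofPred_eq, Set.mem_ofPred_eq, Set.mem_ofPred_eq, sub_eq_add_neg l, intVec_add,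
      intVec_neg, show z - (intVec l + -intVec k) - intVec k = z - intVec l by abel]

theorem sUnion_translates_hyperplane (a : Cn n) (c : ℂ) :
    ⋃₀ translates (hyperplane a c) = repro a c := by
  ext z
  simp [translates, repro, hyperplane]

theorem translate_hyperplane (a : Cn n) (c : ℂ) (k : Fin n → ℤ) :
    {z | z - intVec k ∈ hyperplane a c} = hyperplane a (c - pair a (intVec k)) := by
  ext z
  simp only [hyperplane, Set.mem_ofPred_eq, lin_sub]
  rw [show lin a (c - pair a (intVec k)) z = lin a c z - pair a (intVec k) by simp only [lin]; ring]

theorem eq_of_mem_translates_hyperplane {a : Cn n} {c : ℂ} {P Q : Set (Cn n)}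
    (hP : P ∈ translates (hyperplane a c)) (hQ : Q ∈ translates (hyperplane a c)) {z : Cn n}
    (hzP : z ∈ P) (hzQ : z ∈ Q) : P = Q := by
  obtain ⟨k, rfl⟩ := hP
  obtain ⟨l, rfl⟩ := hQ
  simp only [hyperplane, Set.mem_ofPred_eq, lin_sub] at hzP hzQ ⊢
  have : pair a (intVec k) = pair a (intVec l) := by linear_combination hzQ - hzP
  rw [this]

variable {F : Cn n → ℂ} {Z : Cn n → ℕ}

/-- The classes of the hyperplanes on which `F` vanishes, modulo translations by integer
vectors. -/
def planeClasses (F : Cn n → ℂ) : Set (Set (Set (Cn n))) :=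
  {K | ∃ (a : Cn n) (c : ℂ), a ≠ 0 ∧ (∀ z, lin a c z = 0 → F z = 0) ∧
    K = translates (hyperplane a c)}

/-- The multiplicity of a class of hyperplanes in a divisor. -/
def classMult (Z : Cn n → ℕ) (K : Set (Set (Cn n))) : ℕ := sInf (Z '' ⋃₀ K)

theorem HasDivisor.ne_zero (h : HasDivisor F Z) : ∃ w, F w ≠ 0 := by
  by_contra! hcon
  have h0 := h 0
  have : zeroMult F 0 = ⊤ := by
    refine ENat.eq_top_iff_forall_ge.2 fun m => le_zeroMult_iff.2 fun k _ v => ?_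
    simp [hcon]
  rw [this] at h0
  exact ENat.top_ne_natCast _ h0

/-- Pulled back to the plane by a projection, the product vanishes while the cofactor does not, so
one affine factor vanishes on the whole plane. -/
theorem exists_mem_of_hyperplane_subset {s : Multiset (Cn n × ℂ)} {F' : Cn n → ℂ}
    (hF' : Differentiable ℂ F') (hFF' : ∀ z, F z = linProd s z * F' z) (hs : ∀ l ∈ s, l.1 ≠ 0)
    {a : Cn n} (ha : a ≠ 0) {c : ℂ} (hsub : ∀ z, lin a c z = 0 → F z = 0) {z₁ : Cn n}
    (hz₁ : lin a c z₁ = 0) (hne : F' z₁ ≠ 0) :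
    ∃ l ∈ s, hyperplane l.1 l.2 = hyperplane a c := by
  obtain ⟨v, hv⟩ := exists_pair_eq_one ha
  have hv' : pair (a, c).1 v ≠ 0 := by simp [hv]
  have hπ := differentiable_planeProj (a, c) v
  rcases eq_zero_or_eq_zero_of_mul_eq_zero ((differentiable_linProd s).comp hπ) (hF'.comp hπ)
    (fun z => by
      have := hsub _ (lin_planeProj hv' z)
      rwa [hFF'] at this) with h | h
  · obtain ⟨l, hl, hl0⟩ := exists_factor_eq_zero s (φ := fun l z => lin l.1 l.2 (planeProj (a, c) v z))
      (fun l => (differentiable_lin _ _).comp hπ) h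
    refine ⟨l, hl, hyperplane_eq_of_subset ha (hs l hl) fun z hz => ?_⟩
    simpa [planeProj_of_mem (l := (a, c)) v hz] using hl0 z
  · exact absurd (by simpa [planeProj_of_mem (l := (a, c)) v hz₁] using h z₁) hne

open Classical in
theorem exists_generic_point {s : Multiset (Cn n × ℂ)} (hs : ∀ l ∈ s, l.1 ≠ 0)
    {a : Cn n} (ha : a ≠ 0) {c : ℂ} {U : Set (Cn n)} {z₁ : Cn n} (hU : U ∈ 𝓝 z₁)
    (hz₁ : lin a c z₁ = 0) :
    ∃ w ∈ U, lin a c w = 0 ∧ ∀ l ∈ s, hyperplane l.1 l.2 ≠ hyperplane a c → lin l.1 l.2 w ≠ 0 := by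
  obtain ⟨v, hv⟩ := exists_pair_eq_one ha
  have hv' : pair (a, c).1 v ≠ 0 := by simp [hv]
  have hπ := differentiable_planeProj (a, c) v
  set t := s.filter fun l => hyperplane l.1 l.2 ≠ hyperplane a c with ht
  by_cases hall : ∀ z, linProd t (planeProj (a, c) v z) = 0
  · exfalso
    obtain ⟨l, hl, hl0⟩ := exists_factor_eq_zero t (φ := fun l z => lin l.1 l.2 (planeProj (a, c) v z))
      (fun l => (differentiable_lin _ _).comp hπ) hall
    rw [ht, Multiset.mem_filter] at hl
    refine hl.2 (hyperplane_eq_of_subset ha (hs l hl.1) fun z hz => ?_)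
    simpa [planeProj_of_mem (l := (a, c)) v hz] using hl0 z
  · push Not at hall
    have hd := dense_ne_zero ((differentiable_linProd t).comp hπ) hall
    have hpre : planeProj (a, c) v ⁻¹' U ∈ 𝓝 z₁ := by
      refine hπ.continuous.continuousAt.preimage_mem_nhds ?_
      rwa [planeProj_of_mem (l := (a, c)) v hz₁]
    obtain ⟨w, hw, hwU⟩ := hd.inter_nhds_nonempty hpre
    refine ⟨planeProj (a, c) v w, hwU, lin_planeProj hv' w, fun l hl hne h0 => hw ?_⟩
    exact linProd_eq_zero_iff.2 ⟨l, Multiset.mem_filter.2 ⟨hl, hne⟩, h0⟩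

open Classical in
-- By periodicity every point of the class has at least this multiplicity. The value is attained at
-- a point of the plane near `z₁` lying on no other plane of `s`.
theorem classMult_eq_countP (hper : IsPeriodic F) (hdiv : HasDivisor F Z)
    {s : Multiset (Cn n × ℂ)} {F' : Cn n → ℂ} (hF' : Differentiable ℂ F')
    (hFF' : ∀ z, F z = linProd s z * F' z) (hs : ∀ l ∈ s, l.1 ≠ 0)
    {a : Cn n} (ha : a ≠ 0) {c : ℂ} {U : Set (Cn n)} {z₁ : Cn n} (hU : U ∈ 𝓝 z₁)
    (hz₁ : lin a c z₁ = 0) (hne : ∀ w ∈ U, F' w ≠ 0) :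
    classMult Z (translates (hyperplane a c)) =
      s.countP fun l => hyperplane l.1 l.2 = hyperplane a c := by
  have hmult : ∀ w, (Z w : ℕ∞) = s.countP (fun l => lin l.1 l.2 w = 0) + zeroMult F' w := fun w => by
    rw [← hdiv w, ← zeroMult_linProd hs, ← zeroMult_mul (differentiable_linProd s) hF']
    exact congrArg (zeroMult · w) (funext hFF')
  have hZper : ∀ k w, Z (w - intVec k) = Z w := fun k w => by
    have h1 : (fun z => F (z - intVec k)) = F := funext fun z => by
      rw [← hper.add_intVec k, sub_add_cancel]
    have h2 : zeroMult F w = zeroMult F (w - intVec k) := by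
      conv_lhs => rw [← h1]
      unfold zeroMult
      simp only [add_sub_right_comm]
    have h3 := hdiv w
    rw [h2, hdiv (w - intVec k)] at h3
    exact_mod_cast h3
  have hle : ∀ w ∈ ⋃₀ translates (hyperplane a c),
      s.countP (fun l => hyperplane l.1 l.2 = hyperplane a c) ≤ Z w := by
    rintro w ⟨_, ⟨k, rfl⟩, hw⟩
    rw [← hZper k w]
    have h1 := hmult (w - intVec k)
    have h2 : s.countP (fun l => hyperplane l.1 l.2 = hyperplane a c) ≤
        s.countP (fun l => lin l.1 l.2 (w - intVec k) = 0) := by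
      rw [Multiset.countP_eq_card_filter, Multiset.countP_eq_card_filter]
      refine Multiset.card_le_card (Multiset.monotone_filter_right s fun l hl => ?_)
      have : w - intVec k ∈ hyperplane l.1 l.2 := hl ▸ hw
      exact this
    have h3 : ((s.countP (fun l => lin l.1 l.2 (w - intVec k) = 0) : ℕ) : ℕ∞) ≤
        (Z (w - intVec k) : ℕ∞) := by rw [h1]; exact le_self_add
    exact h2.trans (by exact_mod_cast h3)
  obtain ⟨w, hwU, hw0, hwl⟩ := exists_generic_point hs ha hU hz₁
  have hwmem : w ∈ ⋃₀ translates (hyperplane a c) :=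
    ⟨_, self_mem_translates _, hw0⟩
  have hZw : Z w = s.countP (fun l => hyperplane l.1 l.2 = hyperplane a c) := by
    have h1 := hmult w
    rw [zeroMult_eq_zero_iff.2 (hne w hwU), add_zero] at h1
    have h2 : Z w = s.countP (fun l => lin l.1 l.2 w = 0) := by exact_mod_cast h1
    rw [h2]
    refine Multiset.countP_congr rfl fun l hl => ?_
    refine propext ⟨fun h => by_contra fun hne => hwl l hl hne h, fun h => ?_⟩
    have : w ∈ hyperplane l.1 l.2 := h ▸ hw0
    exact this
  refine le_antisymm ?_ ?_
  · rw [← hZw]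
    exact Nat.sInf_le ⟨w, hwmem, rfl⟩
  · refine le_csInf ⟨_, w, hwmem, rfl⟩ ?_
    rintro _ ⟨x, hx, rfl⟩
    exact hle x hx

theorem IsPeriodic.vanish_translate (hper : IsPeriodic F) {a : Cn n} {c : ℂ}
    (h : ∀ z, lin a c z = 0 → F z = 0) (k : Fin n → ℤ) (z : Cn n)
    (hz : lin a (c - pair a (intVec k)) z = 0) : F z = 0 := by
  have h1 : z ∈ {z | z - intVec k ∈ hyperplane a c} := by rw [translate_hyperplane]; exact hz
  have := h _ h1
  rwa [← hper.add_intVec k, sub_add_cancel] at this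

theorem exists_plane_of_mem_planeClasses (hper : IsPeriodic F) {K : Set (Set (Cn n))}
    (hK : K ∈ planeClasses F) {z : Cn n} (hz : z ∈ ⋃₀ K) :
    ∃ (a : Cn n) (c : ℂ), a ≠ 0 ∧ (∀ z, lin a c z = 0 → F z = 0) ∧
      K = translates (hyperplane a c) ∧ lin a c z = 0 := by
  obtain ⟨a, c, ha, hsub, rfl⟩ := hK
  obtain ⟨P, ⟨k, rfl⟩, hzk⟩ := hz
  refine ⟨a, c - pair a (intVec k), ha, hper.vanish_translate hsub k, ?_, ?_⟩
  · rw [← translate_hyperplane]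
    exact (translates_eq_of_mem ⟨k, rfl⟩).symm
  · have : z ∈ {z | z - intVec k ∈ hyperplane a c} := hzk
    rw [translate_hyperplane] at this
    exact this

/-- Near each point, the classes of hyperplanes in the zero set are finite in number, and the
divisor is the sum of their multiplicities. -/
theorem finite_planeClasses (hF : IsEntirePeriodicPlane F) (hdiv : HasDivisor F Z) (ρ : ℝ) :
    {K ∈ planeClasses F | (⋃₀ K ∩ Metric.ball 0 ρ).Nonempty}.Finite := by
  classical
  obtain ⟨s, F', hF', hFF', hs, hne⟩ :=
    exists_eq_linProd_mul_ne_zero hF.entire hdiv.ne_zero hF.plane ρ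
  refine ((s.map fun l => translates (hyperplane l.1 l.2)).toFinset.finite_toSet).subset ?_
  rintro K ⟨hK, z, hzK, hzρ⟩
  obtain ⟨a, c, ha, hsub, rfl, hz⟩ := exists_plane_of_mem_planeClasses hF.periodic hK hzK
  obtain ⟨l, hl, hla⟩ := exists_mem_of_hyperplane_subset hF' hFF' hs ha hsub hz (hne z hzρ)
  simp only [Finset.mem_coe, Multiset.mem_toFinset, Multiset.mem_map]
  exact ⟨l, hl, by rw [hla]⟩

/-- The multiplicity at `z` is the number of affine factors vanishing there. They are grouped by
class; distinct planes of one class are parallel, so those of a class through `z` all coincide and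
their number is the class multiplicity. -/
theorem exists_finset_planeClasses (hF : IsEntirePeriodicPlane F) (hdiv : HasDivisor F Z)
    (z : Cn n) : ∃ 𝒦 : Finset (Set (Set (Cn n))),
      (∀ K, K ∈ 𝒦 ↔ K ∈ planeClasses F ∧ z ∈ ⋃₀ K) ∧ Z z = ∑ K ∈ 𝒦, classMult Z K := by
  classical
  obtain ⟨s, F', hF', hFF', hs, hne⟩ :=
    exists_eq_linProd_mul_ne_zero hF.entire hdiv.ne_zero hF.plane (‖z‖ + 1)
  have hzρ : z ∈ Metric.ball (0 : Cn n) (‖z‖ + 1) := by simp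
  have hU := Metric.isOpen_ball.mem_nhds hzρ
  set t := s.filter fun l => lin l.1 l.2 z = 0 with ht
  let g : Cn n × ℂ → Set (Set (Cn n)) := fun l => translates (hyperplane l.1 l.2)
  have hZ : Z z = t.card := by
    have h1 : (Z z : ℕ∞) = s.countP (fun l => lin l.1 l.2 z = 0) + zeroMult F' z := by
      rw [← hdiv z, ← zeroMult_linProd hs, ← zeroMult_mul (differentiable_linProd s) hF']
      exact congrArg (zeroMult · z) (funext hFF')
    rw [zeroMult_eq_zero_iff.2 (hne z hzρ), add_zero, Multiset.countP_eq_card_filter] at h1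
    exact_mod_cast h1
  refine ⟨(t.map g).toFinset, fun K => ?_, ?_⟩
  · rw [Multiset.mem_toFinset, Multiset.mem_map]
    constructor
    · rintro ⟨l, hl, rfl⟩
      rw [ht, Multiset.mem_filter] at hl
      refine ⟨⟨l.1, l.2, hs l hl.1, fun w hw => ?_, rfl⟩, _, self_mem_translates _, hl.2⟩
      rw [hFF', linProd_eq_zero_iff.2 ⟨l, hl.1, hw⟩, zero_mul]
    · rintro ⟨hK, hzK⟩
      obtain ⟨a, c, ha, hsub, rfl, hz⟩ := exists_plane_of_mem_planeClasses hF.periodic hK hzK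
      obtain ⟨l, hl, hla⟩ := exists_mem_of_hyperplane_subset hF' hFF' hs ha hsub hz (hne z hzρ)
      refine ⟨l, Multiset.mem_filter.2 ⟨hl, ?_⟩, by simp only [g, hla]⟩
      have : z ∈ hyperplane l.1 l.2 := hla ▸ hz
      exact this
  · rw [hZ, ← Multiset.card_map g t, ← Multiset.toFinset_sum_count_eq (t.map g)]
    refine Finset.sum_congr rfl fun K hK => ?_
    rw [Multiset.mem_toFinset, Multiset.mem_map] at hK
    obtain ⟨l₀, hl₀, rfl⟩ := hK
    rw [ht, Multiset.mem_filter] at hl₀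
    rw [classMult_eq_countP hF.periodic hdiv hF' hFF' hs (hs l₀ hl₀.1) hU hl₀.2 hne,
      Multiset.count_map, Multiset.countP_eq_card_filter, ht, Multiset.filter_filter]
    congr 1
    refine Multiset.filter_congr fun l hl => ?_
    constructor
    · rintro ⟨h1, h2⟩
      refine eq_of_mem_translates_hyperplane (a := l.1) (c := l.2) (self_mem_translates _) ?_ h2 hl₀.2
      change _ ∈ g l
      rw [← h1]
      exact self_mem_translates _
    · intro h
      refine ⟨by simp only [g, h], ?_⟩
      have : z ∈ hyperplane l.1 l.2 := h ▸ hl₀.2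
      exact this

/-- The divisor of an entire periodic function with plane zeros is a locally finite sum of
periodic reproductions of hyperplanes. -/
theorem exists_family (hF : IsEntirePeriodicPlane F) (hdiv : HasDivisor F Z) :
    ∃ (J : Type) (a : J → Cn n) (c : J → ℂ), (∀ j, a j ≠ 0) ∧ (∀ j, DiscretePeriods (a j)) ∧
      (∀ ρ : ℝ, {j | (repro (a j) (c j) ∩ Metric.ball 0 ρ).Nonempty}.Finite) ∧
      ∀ z, HasSum (fun j => reproMult (a j) (c j) z) (Z z) := by
  classical
  have hrep : ∀ K, K ∈ planeClasses F → ∃ (a : Cn n) (c : ℂ), a ≠ 0 ∧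
      (∀ z, lin a c z = 0 → F z = 0) ∧ K = translates (hyperplane a c) := fun K hK => hK
  choose! a c ha hsub hKa using hrep
  let M : Set (Set (Cn n)) → ℕ := fun K => if K ∈ planeClasses F then classMult Z K else 0
  -- Each class is repeated according to its multiplicity; the value `0` of `M` elsewhere keeps
  -- every index inside `planeClasses F`.
  let J : Type := Σ K : Set (Set (Cn n)), Fin (M K)
  have hJ : ∀ j : J, j.1 ∈ planeClasses F := fun j => by
    by_contra h
    have h0 : M j.1 = 0 := if_neg h
    exact (Fin.cast h0 j.2).elim0
  have hrepro : ∀ j : J, repro (a j.1) (c j.1) = ⋃₀ j.1 := fun j => by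
    rw [← sUnion_translates_hyperplane, ← hKa j.1 (hJ j)]
  refine ⟨J, fun j => a j.1, fun j => c j.1, fun j => ha _ (hJ j), fun j =>
    discretePeriods_of_plane_zeros hF.entire hdiv.ne_zero hF.periodic (ha _ (hJ j))
      (hsub _ (hJ j)), fun ρ => ?_, fun z => ?_⟩
  · have hfin := finite_planeClasses hF hdiv ρ
    refine ((hfin.toFinset.sigma fun K => (Finset.univ : Finset (Fin (M K)))).finite_toSet).subset ?_
    rintro j hj
    rw [Set.mem_ofPred_eq, hrepro j] at hj
    simp only [Finset.coe_sigma, Set.mem_sigma_iff, Finset.mem_coe, Set.Finite.mem_toFinset,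
      Finset.mem_univ, and_true]
    exact ⟨hJ j, hj⟩
  · obtain ⟨𝒦, h𝒦, hZ⟩ := exists_finset_planeClasses hF hdiv z
    have hzero : ∀ j : J, j ∉ (𝒦.sigma fun K => (Finset.univ : Finset (Fin (M K)))) →
        reproMult (a j.1) (c j.1) z = 0 := fun j hj => by
      have hj' : j.1 ∉ 𝒦 := fun h => hj (Finset.mem_sigma.2 ⟨h, Finset.mem_univ _⟩)
      rw [reproMult, Set.indicator_of_notMem]
      rw [hrepro j]
      exact fun h => hj' ((h𝒦 j.1).2 ⟨hJ j, h⟩)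
    have hsum := hasSum_sum_of_ne_finset_zero (L := .unconditional J) hzero
    convert hsum using 1
    rw [hZ, Finset.sum_sigma]
    refine Finset.sum_congr rfl fun K hK => ?_
    obtain ⟨hKF, hzK⟩ := (h𝒦 K).1 hK
    have h1 : ∀ i : Fin (M K), reproMult (a K) (c K) z = 1 := fun i => by
      rw [reproMult, Set.indicator_of_mem]
      · rfl
      · rw [← sUnion_translates_hyperplane, ← hKa K hKF]; exact hzK
    rw [Finset.sum_congr rfl fun i _ => h1 i]
    simp [M, hKF]

end Decomposition

/-! ### The exponent of a periodic function with given divisor -/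

section Uniqueness

variable {n : ℕ} {D : Families n} (N : D.Normalization) {F : Cn n → ℂ} {Z : Cn n → ℕ}

/-- An entire function with values in `2πiℤ` is constant. -/
theorem exists_int_of_exp_eq_one {g : Cn n → ℂ} (hg : Differentiable ℂ g)
    (h : ∀ z, Complex.exp (g z) = 1) : ∃ m : ℤ, ∀ z, g z = 2 * Real.pi * Complex.I * m := by
  have hconst : ∀ z, g z = g 0 := by
    have hderiv : ∀ z, fderiv ℂ g z = 0 := fun z => by
      have h1 := (hg z).hasFDerivAt.cexp
      have h2 : (fun z => Complex.exp (g z)) = fun _ => 1 := funext h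
      rw [h2, h z, one_smul] at h1
      exact h1.unique (hasFDerivAt_const _ _)
    exact fun z => is_const_of_fderiv_eq_zero hg hderiv z 0
  obtain ⟨m, hm⟩ := Complex.exp_eq_one_iff.1 (h 0)
  exact ⟨m, fun z => by rw [hconst z, hm]; ring⟩

/-- Two exponential multiples of a nonzero entire function coincide only if the exponents differ
by a constant in `2πiℤ`. -/
theorem exists_int_of_exp_mul_eq {g₁ g₂ G : Cn n → ℂ} (h₁ : Differentiable ℂ g₁)
    (h₂ : Differentiable ℂ g₂) (hG : Differentiable ℂ G) (hne : ∃ w, G w ≠ 0)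
    (h : ∀ z, Complex.exp (g₁ z) * G z = Complex.exp (g₂ z) * G z) :
    ∃ m : ℤ, ∀ z, g₁ z = g₂ z + 2 * Real.pi * Complex.I * m := by
  rcases eq_zero_or_eq_zero_of_mul_eq_zero (h₁.cexp.sub h₂.cexp) hG
    (fun z => by simp only [Pi.sub_apply]; rw [sub_mul, h z, sub_self]) with h0 | h0
  · obtain ⟨m, hm⟩ := exists_int_of_exp_eq_one (h₁.sub h₂) fun z => by
      have : Complex.exp (g₁ z) = Complex.exp (g₂ z) := sub_eq_zero.1 (h0 z)
      rw [Pi.sub_apply, Complex.exp_sub, this, div_self (Complex.exp_ne_zero _)]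
    exact ⟨m, fun z => by rw [← hm z, Pi.sub_apply]; ring⟩
  · obtain ⟨w, hw⟩ := hne
    exact absurd (h0 w) hw

/-- The divisor `Z` is the sum of the two families of periodic reproductions. -/
def Families.SumsTo (D : Families n) (Z : Cn n → ℕ) : Prop :=
  ∃ Z' Z'' : Cn n → ℕ, Z = Z' + Z'' ∧
    (∀ z, HasSum (fun j : Idx D.μ₁ => reproMult (D.a₁ j) (D.c₁ j) z) (Z' z)) ∧
    Z'' = ∑ j, reproMult (D.a₂ j) (D.c₂ j)

namespace Families.Normalization

/-- The exponent `G_p` of the multiplier of `Ftilde`. -/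
def multiplierExp (p : Fin n) (z : Cn n) : ℂ := ∑ q, N.σ p q * z q + N.τ p

theorem differentiable_multiplierExp (p : Fin n) : Differentiable ℂ (N.multiplierExp p) := by
  unfold multiplierExp; fun_prop

theorem multiplierExp_add_unitVec (p q : Fin n) (z : Cn n) :
    N.multiplierExp p (z + unitVec q) = N.multiplierExp p z + N.σ p q := by
  have h : ∑ r, N.σ p r * (unitVec q : Cn n) r = N.σ p q := by
    simp [unitVec, PiLp.single_apply]
  simp only [multiplierExp, PiLp.add_apply, mul_add, Finset.sum_add_distrib, h]
  ring

/-- The representation `Z = Z' + Z''` without the balance condition determines the multiplicities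
of `F₁ Ftilde`. -/
theorem zeroMult_F₁_mul_Ftilde {d : ℕ → ℕ} (hd : N.Admissible d)
    (hsum : D.SumsTo Z) (z : Cn n) :
    zeroMult (fun w => N.F₁ d w * N.Ftilde w) z = Z z := by
  obtain ⟨Z', Z'', rfl, h1, rfl⟩ := hsum
  rw [zeroMult_mul (N.differentiable_F₁ hd) N.differentiable_Ftilde, N.zeroMult_F₁ hd (h1 z),
    N.zeroMult_Ftilde]
  simp

/-- The exponent relating a periodic function with divisor `Z` to `F₁ Ftilde`. -/
theorem exists_exponent {d : ℕ → ℕ} (hd : N.Admissible d)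
    (hsum : D.SumsTo Z)
    (hF : IsEntirePeriodicPlane F) (hdiv : HasDivisor F Z) :
    ∃ (h : Cn n → ℂ) (m : Fin n → ℤ), Differentiable ℂ h ∧
      (∀ z, F z = Complex.exp (h z) * (N.F₁ d z * N.Ftilde z)) ∧
      ∀ p z, h (z + unitVec p) + N.multiplierExp p z = h z + 2 * Real.pi * Complex.I * m p := by
  have hG : Differentiable ℂ fun w => N.F₁ d w * N.Ftilde w :=
    (N.differentiable_F₁ hd).mul N.differentiable_Ftilde
  obtain ⟨h, hh, hFh⟩ := exists_eq_exp_mul_of_zeroMult_eq hF.entire hG hdiv.ne_zero hF.plane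
    fun z => by rw [hdiv z, N.zeroMult_F₁_mul_Ftilde hd hsum z]
  have hex : ∀ p, ∃ m : ℤ, ∀ z, h (z + unitVec p) + N.multiplierExp p z =
      h z + 2 * Real.pi * Complex.I * m := fun p => by
    refine exists_int_of_exp_mul_eq ((hh.comp (differentiable_id.add_const _)).add
      (N.differentiable_multiplierExp p)) hh hG ?_ fun z => ?_
    · obtain ⟨w, hw⟩ := hdiv.ne_zero
      rw [hFh] at hw
      exact ⟨w, right_ne_zero_of_mul hw⟩
    · have h1 := hF.periodic p z
      rw [hFh, hFh, N.F₁_periodic d p z, N.Ftilde_add_unitVec] at h1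
      rw [← h1, Complex.exp_add]
      simp only [multiplierExp]
      ring
  choose m hm using hex
  exact ⟨h, m, hh, hFh, hm⟩

/-- The two shifts commute: computing `h(ω_p + ω_q)` in both orders, everything cancels except `σ p
q` and `σ q p`. -/
theorem σ_symm_of_exponent {h : Cn n → ℂ} {m : Fin n → ℤ}
    (hm : ∀ p z, h (z + unitVec p) + N.multiplierExp p z = h z + 2 * Real.pi * Complex.I * m p)
    (p q : Fin n) : N.σ p q = N.σ q p := by
  have h1 := hm p (0 + unitVec q)
  have h2 := hm q (0 + unitVec p)
  rw [add_right_comm, N.multiplierExp_add_unitVec] at h2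
  rw [N.multiplierExp_add_unitVec] at h1
  linear_combination h1 - h2 + hm q 0 - hm p 0

theorem exists_eq_exp_mul {d : ℕ → ℕ} (hd : N.Admissible d)
    (hsum : D.SumsTo Z)
    (hF : IsEntirePeriodicPlane F) (hdiv : HasDivisor F Z) :
    ∃ (m : Fin n → ℤ) (Ψ : Cn n → ℂ), Differentiable ℂ Ψ ∧ IsPeriodic Ψ ∧
      ∀ z, F z = Complex.exp (Ψ z + 2 * Real.pi * Complex.I * pair (intVec m) z) *
        N.F₁ d z * N.F₂ z := by
  obtain ⟨h, m, hh, hFh, hm⟩ := N.exists_exponent hd hsum hF hdiv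
  have hσ := N.σ_symm_of_exponent hm
  refine ⟨m, fun z => h z + N.H z - 2 * Real.pi * Complex.I * pair (intVec m) z,
    (hh.add N.differentiable_H).sub ((differentiable_pair _).const_mul _), fun p z => ?_,
    fun z => ?_⟩
  · have h1 := hm p z
    have h2 := N.H_add_unitVec hσ p z
    have h3 : pair (intVec m) (unitVec p) = m p := by rw [pair_unitVec]; rfl
    simp only [multiplierExp] at h1
    simp only [pair_add, h3, h2]
    linear_combination h1
  · rw [hFh z, sub_add_cancel, F₂, Complex.exp_add]
    have : Complex.exp (N.H z) * Complex.exp (-N.H z) = 1 := by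
      rw [← Complex.exp_add, add_neg_cancel, Complex.exp_zero]
    linear_combination -(Complex.exp (h z) * N.F₁ d z * N.Ftilde z) * this

/-- Symmetry of `σ` enters only through the periodicity of `F₂`. The zero set is the union of the
reproductions in the two families, each of which is a union of hyperplanes. -/
theorem exp_mul_isEntirePeriodicPlane {d : ℕ → ℕ} (hd : N.Admissible d)
    (hσ : ∀ p q, N.σ p q = N.σ q p)
    (hsum : D.SumsTo Z)
    (ha₁ : ∀ j : ℕ, (j : ℕ∞) < D.μ₁ → D.a₁ j ≠ 0)
    {m : Fin n → ℤ} {Ψ : Cn n → ℂ} (hΨ : Differentiable ℂ Ψ) (hper : IsPeriodic Ψ)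
    (hF : ∀ z, F z = Complex.exp (Ψ z + 2 * Real.pi * Complex.I * pair (intVec m) z) *
        N.F₁ d z * N.F₂ z) : IsEntirePeriodicPlane F ∧ HasDivisor F Z := by
  have hE : Differentiable ℂ fun z => Ψ z + 2 * Real.pi * Complex.I * pair (intVec m) z :=
    hΨ.add ((differentiable_pair _).const_mul _)
  have hF' : F = fun z => (N.F₁ d z * N.F₂ z) *
      Complex.exp (Ψ z + 2 * Real.pi * Complex.I * pair (intVec m) z) :=
    funext fun z => by rw [hF z]; ring
  have hG : Differentiable ℂ fun z => N.F₁ d z * N.F₂ z :=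
    (N.differentiable_F₁ hd).mul N.differentiable_F₂
  have hdiv : HasDivisor F Z := fun z => by
    obtain ⟨Z', Z'', rfl, h1, rfl⟩ := hsum
    rw [hF', zeroMult_mul_exp hG hE, zeroMult_mul (N.differentiable_F₁ hd) N.differentiable_F₂,
      N.zeroMult_F₁ hd (h1 z), N.zeroMult_F₂]
    simp
  refine ⟨⟨hF' ▸ hG.mul hE.cexp, fun p z => ?_, ?_⟩, hdiv⟩
  · have h3 : pair (intVec m) (unitVec p) = m p := by rw [pair_unitVec]; rfl
    have h4 : Complex.exp (2 * Real.pi * Complex.I * m p) = 1 :=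
      Complex.exp_eq_one_iff.2 ⟨m p, by ring⟩
    rw [hF, hF, N.F₁_periodic d p z, N.F₂_periodic hσ p z, hper p z, pair_add, h3, mul_add,
      ← add_assoc, Complex.exp_add _ (2 * Real.pi * Complex.I * m p), h4, mul_one]
  · refine ⟨{l | l.1 ≠ 0 ∧ ∀ z, lin l.1 l.2 z = 0 → F z = 0}, fun l hl => hl.1, ?_⟩
    have hzero : ∀ z, F z = 0 ↔ Z z ≠ 0 := fun z => by
      rw [← not_iff_not, not_not, ← ne_eq, ← zeroMult_eq_zero_iff, hdiv z, Nat.cast_eq_zero]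
    have hfam : ∀ z, F z = 0 ↔ (∃ j : Idx D.μ₁, z ∈ repro (D.a₁ j) (D.c₁ j)) ∨
        ∃ j, z ∈ repro (D.a₂ j) (D.c₂ j) := fun z => by
      obtain ⟨Z', Z'', rfl, h1, rfl⟩ := hsum
      have hmult : ∀ (a : Cn n) (c : ℂ), reproMult a c z = 0 ↔ z ∉ repro a c := fun a c => by
        simp [reproMult]
      have h2 : Z' z = 0 ↔ ∀ j : Idx D.μ₁, reproMult (D.a₁ j) (D.c₁ j) z = 0 := by
        constructor
        · intro h j
          have := le_hasSum (h1 z) j fun _ _ => Nat.zero_le _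
          omega
        · intro h
          have := h1 z
          simp only [h] at this
          exact this.unique hasSum_zero
      rw [hzero, ← not_iff_not, not_not, Pi.add_apply, Nat.add_eq_zero_iff, h2,
        Finset.sum_apply, Finset.sum_eq_zero_iff]
      simp [hmult]
    have hplane : ∀ (a : Cn n) (c : ℂ) (z : Cn n), z ∈ repro a c → a ≠ 0 →
        (∀ w ∈ repro a c, F w = 0) →
        ∃ l : Cn n × ℂ, (l.1 ≠ 0 ∧ ∀ z, lin l.1 l.2 z = 0 → F z = 0) ∧ lin l.1 l.2 z = 0 := by
      intro a c z hz ha hw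
      obtain ⟨k, hk⟩ := Set.mem_iUnion.1 hz
      have hl : ∀ w, lin a (c - pair a (intVec k)) w = lin a c (w - intVec k) := fun w => by
        rw [lin_sub, lin, lin]; ring
      refine ⟨(a, c - pair a (intVec k)), ⟨ha, fun w h => hw w (Set.mem_iUnion.2 ⟨k, ?_⟩)⟩, ?_⟩
      · exact (hl w).symm.trans h
      · exact (hl z).trans hk
    ext z
    simp only [Set.mem_ofPred_eq, Set.mem_iUnion, exists_prop, hyperplane]
    constructor
    · intro h
      rcases (hfam z).1 h with ⟨j, hj⟩ | ⟨j, hj⟩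
      · exact hplane _ _ z hj (ha₁ j j.2) fun w hw => (hfam w).2 (Or.inl ⟨j, hw⟩)
      · exact hplane _ _ z hj (N.a₂_ne_zero j) fun w hw => (hfam w).2 (Or.inr ⟨j, hw⟩)
    · rintro ⟨l, hl, hz⟩
      exact hl.2 z hz

end Families.Normalization

end Uniqueness

/-! ### Splitting into the two classes, finiteness and growth -/

section Construction

variable {n : ℕ} {a : Cn n} {c : ℂ}

theorem sub_intVec_mem_repro {z : Cn n} (hz : z ∈ repro a c) (k : Fin n → ℤ) :
    z - intVec k ∈ repro a c := by
  rw [mem_repro_iff] at hz ⊢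
  rw [lin_sub]
  exact (periodGroup a).sub_mem hz ⟨k, rfl⟩

/-- A periodic reproduction with a point of bounded imaginary part has a bounded point. -/
theorem repro_inter_ball_nonempty {z : Cn n} (hz : z ∈ repro a c) {M : ℝ}
    (hM : ∀ p, |(z p).im| ≤ M) :
    (repro a c ∩ Metric.ball 0 (n * (1 + M) + 1)).Nonempty := by
  -- An integer translation brings the real parts into `[0, 1)` and leaves the imaginary parts
  -- unchanged.
  refine ⟨z - intVec fun p => ⌊(z p).re⌋, sub_intVec_mem_repro hz _, ?_⟩
  rw [mem_ball_zero_iff]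
  set w : Cn n := z - intVec fun p => ⌊(z p).re⌋ with hw
  have hwp : ∀ p, ‖w p‖ ≤ 1 + M := fun p => by
    refine (Complex.norm_le_abs_re_add_abs_im _).trans (add_le_add ?_ ?_)
    · have : (w p).re = Int.fract (z p).re := by simp [hw, intVec]
      rw [this, abs_of_nonneg (Int.fract_nonneg _)]
      exact (Int.fract_lt_one _).le
    · have : (w p).im = (z p).im := by simp [hw, intVec]
      rw [this]
      exact hM p
  have hsum : w = ∑ p, w p • unitVec p := by
    ext q
    simp [unitVec, Pi.single_apply]
  calc ‖w‖ = ‖∑ p, w p • (unitVec p : Cn n)‖ := by rw [← hsum]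
    _ ≤ ∑ p, ‖w p • (unitVec p : Cn n)‖ := norm_sum_le _ _
    _ ≤ ∑ _p : Fin n, (1 + M) := Finset.sum_le_sum fun p _ => by
        simpa [norm_smul, unitVec] using hwp p
    _ < _ := by simp; linarith

theorem mem_repro_of_lin_eq_zero {z : Cn n} (h : lin a c z = 0) : z ∈ repro a c := by
  rw [mem_repro_iff, h]
  exact (periodGroup a).zero_mem

/-- The map `x ↦ ⟨a, x⟩` sends `ℝⁿ` onto `ℂ`, so the plane contains a real point. The radius is
independent of `a` and `c`. -/
theorem repro_inter_ball_nonempty_of_perpDim_two (h : perpDim a = 2) (c : ℂ) :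
    (repro a c ∩ Metric.ball 0 (n + 1 : ℝ)).Nonempty := by
  obtain ⟨x, hx⟩ := exists_realMap_eq h (-c)
  have hz : lin a c (WithLp.toLp 2 fun p => (x p : ℂ)) = 0 := by
    have : pair a (WithLp.toLp 2 fun p => (x p : ℂ)) = -c := hx
    rw [lin, this, neg_add_cancel]
  simpa using repro_inter_ball_nonempty (mem_repro_of_lin_eq_zero hz) (M := 0) (by simp)

/-- The point `-c a / |a|²` of the plane has imaginary parts of absolute value at most `|Im c| /
|a|`. -/
theorem repro_inter_ball_nonempty_of_real (ha : a ≠ 0) (hr : ∀ p, (a p).im = 0) {M : ℝ}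
    (hM : |c.im| / ‖a‖ ≤ M) :
    (repro a c ∩ Metric.ball 0 (n * (1 + M) + 1)).Nonempty := by
  have hna : (‖a‖ : ℂ) ≠ 0 := by simpa using ha
  have hre : ∀ p, a p = ((a p).re : ℂ) := fun p => Complex.ext (by simp) (by simp [hr p])
  have hsq : pair a a = (‖a‖ : ℂ) ^ 2 := by
    have h1 : ‖a‖ ^ 2 = ∑ p, (a p).re ^ 2 := by
      rw [EuclideanSpace.norm_sq_eq]
      refine Finset.sum_congr rfl fun p _ => ?_
      rw [hre p, Complex.norm_real, Complex.ofReal_re, Real.norm_eq_abs, sq_abs]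
    rw [← Complex.ofReal_pow, h1, pair]
    push_cast
    refine Finset.sum_congr rfl fun p _ => ?_
    rw [← hre p, sq]
  have hz : lin a c ((-c / (‖a‖ : ℂ) ^ 2) • a) = 0 := by
    rw [lin, pair_smul, hsq, div_mul_cancel₀ _ (pow_ne_zero 2 hna), neg_add_cancel]
  refine repro_inter_ball_nonempty (mem_repro_of_lin_eq_zero hz) fun p => le_trans ?_ hM
  have hpos : 0 < ‖a‖ := norm_pos_iff.2 ha
  have him : (((-c / (‖a‖ : ℂ) ^ 2) • a) p).im = -c.im / ‖a‖ ^ 2 * (a p).re := by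
    rw [PiLp.smul_apply, smul_eq_mul, hre p, Complex.im_mul_ofReal, ← Complex.ofReal_pow,
      Complex.div_ofReal_im, Complex.neg_im, Complex.ofReal_re]
  have hle : |(a p).re| ≤ ‖a‖ := (Complex.abs_re_le_norm _).trans (PiLp.norm_apply_le a p)
  rw [him, abs_mul, abs_div, abs_neg, abs_of_pos (pow_pos hpos 2), div_mul_eq_mul_div,
    div_le_div_iff₀ (pow_pos hpos 2) hpos]
  nlinarith [mul_le_mul_of_nonneg_left hle (mul_nonneg (abs_nonneg c.im) hpos.le)]

theorem pair_smul_left (w : ℂ) (a z : Cn n) : pair (w • a) z = w * pair a z := by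
  simp only [pair, PiLp.smul_apply, smul_eq_mul, Finset.mul_sum, mul_assoc]

theorem repro_smul {w : ℂ} (hw : w ≠ 0) (a : Cn n) (c : ℂ) :
    repro (w • a) (w * c) = repro a c := by
  ext z
  simp only [repro, lin, pair_smul_left, ← mul_add, mul_eq_zero, hw, false_or]

theorem DiscretePeriods.of_smul {w : ℂ} (hw : w ≠ 0) (h : DiscretePeriods (w • a)) :
    DiscretePeriods a := by
  obtain ⟨ε, hε, h⟩ := h
  have hpos : 0 < ‖w‖ := norm_pos_iff.2 hw
  refine ⟨ε / ‖w‖, div_pos hε hpos, ?_⟩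
  rintro _ ⟨k, rfl⟩ hk
  have h1 := h (w * pair a (intVec k)) ⟨k, (pair_smul_left w a _).symm⟩ (by
    rw [norm_mul, mul_comm]; exact (lt_div_iff₀ hpos).1 hk)
  exact (mul_eq_zero.1 h1).resolve_left hw

theorem exists_real_equation (ha : perpDim a = 1) (hd : DiscretePeriods a) (c : ℂ) :
    ∃ (b : Cn n) (c' : ℂ), b ≠ 0 ∧ (∀ p, (b p).im = 0) ∧ DiscretePeriods b ∧
      repro b c' = repro a c := by
  obtain ⟨w, b, hw, hb⟩ := exists_eq_real_mul ha
  have hab : a = w • (WithLp.toLp 2 fun p => (b p : ℂ) : Cn n) := by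
    ext p; simpa using hb p
  refine ⟨WithLp.toLp 2 fun p => (b p : ℂ), c / w, fun h => ?_, fun p => by simp, ?_, ?_⟩
  · rw [h, smul_zero] at hab
    exact ne_zero_of_perpDim (by omega) hab
  · rw [hab] at hd
    exact hd.of_smul hw
  · rw [← repro_smul hw, ← hab, mul_div_cancel₀ _ hw]

theorem exists_idx_equiv (J : Type) [Countable J] : ∃ μ : ℕ∞, Nonempty (Idx μ ≃ J) := by
  rcases finite_or_infinite J with h | h
  · refine ⟨(Nat.card J : ℕ), ⟨Equiv.trans ?_ (Finite.equivFin J).symm⟩⟩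
    exact (Equiv.subtypeEquivRight fun j => by rw [Nat.cast_lt]).trans Fin.equivSubtype.symm
  · obtain ⟨e⟩ := nonempty_equiv_of_countable (α := ℕ) (β := J)
    exact ⟨⊤, ⟨(Equiv.subtypeUnivEquiv fun j => ENat.natCast_lt_top j).trans e⟩⟩

variable {F : Cn n → ℂ} {Z : Cn n → ℕ}

/-- The decomposition of the divisor of an entire periodic function with plane zeros, except for
the balance condition. -/
theorem exists_families (hF : IsEntirePeriodicPlane F) (hdiv : HasDivisor F Z) :
    ∃ D : Families n,
      (∀ j : ℕ, (j : ℕ∞) < D.μ₁ →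
        D.a₁ j ≠ 0 ∧ (∀ p, (D.a₁ j p).im = 0) ∧ DiscretePeriods (D.a₁ j)) ∧
      (D.μ₁ = ⊤ → Tendsto (fun j : ℕ => |(D.c₁ j).im| / ‖D.a₁ j‖) atTop atTop) ∧
      (∀ j, perpDim (D.a₂ j) = 2 ∧ DiscretePeriods (D.a₂ j)) ∧ D.SumsTo Z := by
  classical
  obtain ⟨J, a, c, ha, hd, hfin, hsum⟩ := exists_family hF hdiv
  have hcount : Countable J := by
    rw [← Set.countable_univ_iff]
    refine (Set.countable_iUnion fun r : ℕ => (hfin r).countable).mono fun j _ => ?_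
    obtain ⟨z, hz⟩ := exists_mem_hyperplane (ha j) (c j)
    obtain ⟨r, hr⟩ := exists_nat_gt ‖z‖
    exact Set.mem_iUnion.2 ⟨r, z, mem_repro_of_lin_eq_zero hz, by simpa using hr⟩
  let s : Set J := {j | perpDim (a j) = 1}
  have hs : ∀ j : (sᶜ : Set J), perpDim (a j) = 2 := fun j => by
    have h1 := one_le_perpDim (ha j)
    have h2 := perpDim_le_two (a j)
    have h3 : perpDim (a j) ≠ 1 := j.2
    omega
  -- All reproductions of the second class meet one and the same ball, so local finiteness bounds
  -- their number.
  have hsfin : (sᶜ : Set J).Finite := (hfin (n + 1)).subset fun j hj =>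
    repro_inter_ball_nonempty_of_perpDim_two (hs ⟨j, hj⟩) _
  choose b c' hb hbr hbd hbrepro using
    fun j : s => exists_real_equation j.2 (hd j) (c j)
  obtain ⟨μ, ⟨e⟩⟩ := exists_idx_equiv s
  have := hsfin.to_subtype
  let e₂ := (Finite.equivFin (sᶜ : Set J)).symm
  let D : Families n :=
    { μ₁ := μ
      a₁ := fun i => if h : (i : ℕ∞) < μ then b (e ⟨i, h⟩) else 0
      c₁ := fun i => if h : (i : ℕ∞) < μ then c' (e ⟨i, h⟩) else 0
      μ₂ := Nat.card (sᶜ : Set J)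
      a₂ := fun i => a (e₂ i)
      c₂ := fun i => c (e₂ i) }
  have ha₁ : ∀ (i : ℕ) (h : (i : ℕ∞) < μ), D.a₁ i = b (e ⟨i, h⟩) := fun i h => dif_pos h
  have hc₁ : ∀ (i : ℕ) (h : (i : ℕ∞) < μ), D.c₁ i = c' (e ⟨i, h⟩) := fun i h => dif_pos h
  refine ⟨D, fun i h => ?_, fun hμ => ?_, fun i => ⟨hs _, hd _⟩, ?_⟩
  · rw [ha₁ i h]
    exact ⟨hb _, hbr _, hbd _⟩
  · have hlt : ∀ i : ℕ, (i : ℕ∞) < μ := fun i => by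
      rw [show μ = ⊤ from hμ]; exact ENat.natCast_lt_top i
    -- Indices whose ratio is below `M` give reproductions that meet a ball depending only on `n`
    -- and `M`; there are finitely many of these.
    refine tendsto_atTop.2 fun M => ?_
    rw [← Nat.cofinite_eq_atTop, eventually_cofinite]
    have hinj : Function.Injective fun i : ℕ => ((e ⟨i, hlt i⟩ : s) : J) := fun i i' h => by
      simpa using e.injective (Subtype.ext h)
    refine ((hfin (n * (1 + M) + 1)).preimage hinj.injOn).subset fun i hi => ?_
    rw [Set.mem_ofPred_eq, not_le, ha₁ i (hlt i), hc₁ i (hlt i)] at hi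
    rw [Set.mem_preimage, Set.mem_ofPred_eq, ← hbrepro]
    exact repro_inter_ball_nonempty_of_real (hb _) (hbr _) hi.le
  · let f : Cn n → J → ℕ := fun z j => reproMult (a j) (c j) z
    have hf : ∀ z, (Function.support (f z)).Finite := fun z => (hfin (‖z‖ + 1)).subset fun j hj =>
      ⟨z, by simpa [f, reproMult] using hj, by simp⟩
    have hsum₁ : ∀ z, Summable (f z ∘ ((↑) : s → J)) := fun z =>
      summable_of_hasFiniteSupport
        ((hf z).preimage Subtype.val_injective.injOn)
    have hZ₂ : ∀ z, HasSum (f z ∘ ((↑) : (sᶜ : Set J) → J))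
        (∑ i, reproMult (D.a₂ i) (D.c₂ i) z) := fun z => by
      rw [← e₂.hasSum_iff]
      exact hasSum_fintype _
    refine ⟨fun z => ∑' j : s, f z j, _, funext fun z => ?_, fun z => ?_, rfl⟩
    · rw [Pi.add_apply, Finset.sum_apply]
      exact (hsum z).unique ((hsum₁ z).hasSum.add_compl (hZ₂ z))
    · have h1 := e.hasSum_iff.2 (hsum₁ z).hasSum
      refine (congrArg (fun g => HasSum g (∑' j : s, f z j)) (funext fun j => ?_)).mpr h1
      rw [ha₁ j j.2, hc₁ j j.2, reproMult, hbrepro]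
      rfl

end Construction

/-! ### Assembly of the theorem -/

/-- The two families given by a representation satisfy the hypotheses for a normalization. -/
theorem Families.Represents.nonempty_normalization {n : ℕ} {D : Families n} {Z : Cn n → ℕ}
    (h : D.Represents Z) : Nonempty D.Normalization :=
  PlaneZeros.nonempty_normalization
    (fun j hj =>
      have h0 := ne_zero_of_perpDim (by rw [h.class_one j hj]; exact one_ne_zero)
      ⟨h0, h.real_one j hj, discretePeriods_of_isAnalyticSubset h0 (h.analytic_one j hj)⟩)
    fun j => ⟨h.class_two j, discretePeriods_of_isAnalyticSubset
      (ne_zero_of_perpDim (by rw [h.class_two j]; exact two_ne_zero)) (h.analytic_two j)⟩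

/-- The families come from the geometry of the zeros, without the balance condition. Since
`exists_exponent` does not use that condition, the periodicity of `F` can supply it afterwards. -/
theorem exists_represents {n : ℕ} {F : Cn n → ℂ} {Z : Cn n → ℕ}
    (hF : IsEntirePeriodicPlane F) (hdiv : HasDivisor F Z) :
    ∃ D : Families n, D.Represents Z := by
  obtain ⟨D, h₁, hg, h₂, hsum⟩ := exists_families hF hdiv
  obtain ⟨N⟩ := nonempty_normalization h₁ h₂
  obtain ⟨h, m, -, -, hm⟩ := N.exists_exponent (N.admissible_id hg) hsum hF hdiv
  exact ⟨D,
    { class_one := fun j hj => perpDim_of_real (h₁ j hj).1 (h₁ j hj).2.1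
      analytic_one := fun j hj => (h₁ j hj).2.2.isAnalyticSubset _
      real_one := fun j hj => (h₁ j hj).2.1
      growth := hg
      class_two := fun j => (h₂ j).1
      analytic_two := fun j => (h₂ j).2.isAnalyticSubset _
      balance := fun p q => (N.balance_iff p q).2 (N.σ_symm_of_exponent hm p q)
      sum_eq := hsum }⟩

theorem Families.Normalization.isEntirePeriodicPlane_iff {n : ℕ} {D : Families n}
    (N : D.Normalization) {Z : Cn n → ℕ} (h : D.Represents Z) {d : ℕ → ℕ} (hd : N.Admissible d)
    (F : Cn n → ℂ) :
    (IsEntirePeriodicPlane F ∧ HasDivisor F Z) ↔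
      ∃ (m : Fin n → ℤ) (Ψ : Cn n → ℂ), Differentiable ℂ Ψ ∧ IsPeriodic Ψ ∧
        ∀ z, F z = Complex.exp (Ψ z + 2 * Real.pi * Complex.I * pair (intVec m) z) *
          N.F₁ d z * N.F₂ z := by
  constructor
  · rintro ⟨hF, hdiv⟩
    exact N.exists_eq_exp_mul hd h.sum_eq hF hdiv
  · rintro ⟨m, Ψ, hΨ, hper, hF⟩
    exact N.exp_mul_isEntirePeriodicPlane hd (fun p q => (N.balance_iff p q).1 (h.balance p q))
      h.sum_eq (fun j hj => ne_zero_of_perpDim (by rw [h.class_one j hj]; exact one_ne_zero))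
      hΨ hper hF

end PlaneZeros

end

theorem theorem2 (n : ℕ) (Z : PlaneZeros.Cn n → ℕ) (hZ : PlaneZeros.IsDivisor Z)
    (hper : PlaneZeros.IsPeriodic Z) :
    ((∃ F : PlaneZeros.Cn n → ℂ,
        PlaneZeros.IsEntirePeriodicPlane F ∧ PlaneZeros.HasDivisor F Z) ↔
      ∃ D : PlaneZeros.Families n, D.Represents Z) ∧
    ∀ D : PlaneZeros.Families n, D.Represents Z →
      Nonempty D.Normalization ∧
      ∀ N : D.Normalization,
        N.Admissible (fun j => j) ∧
        ∀ d : ℕ → ℕ, N.Admissible d →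
          HasProdLocallyUniformlyOn (fun (j : PlaneZeros.Idx D.μ₁) z => N.phi (d j) j z)
            (N.F₁ d) Set.univ ∧
          ∀ F : PlaneZeros.Cn n → ℂ,
            (PlaneZeros.IsEntirePeriodicPlane F ∧ PlaneZeros.HasDivisor F Z) ↔
              ∃ (m : Fin n → ℤ) (Ψ : PlaneZeros.Cn n → ℂ),
                Differentiable ℂ Ψ ∧ PlaneZeros.IsPeriodic Ψ ∧
                ∀ z, F z =
                  Complex.exp (Ψ z +
                    2 * Real.pi * Complex.I * PlaneZeros.pair (PlaneZeros.intVec m) z) *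
                  N.F₁ d z * N.F₂ z := by
  refine ⟨⟨fun ⟨F, hF, hdiv⟩ => PlaneZeros.exists_represents hF hdiv, fun ⟨D, hD⟩ => ?_⟩,
    fun D hD => ⟨hD.nonempty_normalization, fun N => ⟨N.admissible_id hD.growth, fun d hd =>
      ⟨N.hasProd_F₁ hd, N.isEntirePeriodicPlane_iff hD hd⟩⟩⟩⟩
  obtain ⟨N⟩ := hD.nonempty_normalization
  -- Existence is the case `m = 0`, `Ψ = 0` with degrees `d j = j`, the indices being counted from
  -- zero.
  exact ⟨_, (N.isEntirePeriodicPlane_iff hD (N.admissible_id hD.growth) _).2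
    ⟨0, fun _ => 0, differentiable_const 0, fun _ _ => rfl, fun _ => rfl⟩⟩
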